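/- **Setting.** Let $s\ge 1$, let $\mathcal X$ be a set of inputs, and let ${\cal X}_s\subset{\cal X}_{s-1}\subset\dots\subset{\cal X}_1\subset\mathcal X$ be finite nested designs, $n_t=|{\cal X}_t|$. For each level $t$ let $\mathbf h_t:\mathcal X\to\mathbb R^{p_t}$ be a vector of fixed basis functions and $r(\cdot,\cdot\mid\phi_t)$ a correlation function (symmetric, positive semidefinite, equal to $1$ on the diagonal), with $\phi=(\phi_1,\dots,\phi_s)$ fixed. The autoregressive cokriging model is $y_1=\delta_1$ and $y_t(\cdot)=\gamma_{t-1}y_{t-1}(\cdot)+\delta_t(\cdot)$ for $t=2,\dots,s$, where, given $(\beta,\gamma,\sigma^2)$, the $\delta_t$ are independent Gaussian processes with mean $\mathbf h_t(\cdot)^\top\beta_t$ and covariance $\sigma_t^2\,r(\cdot,\cdot\mid\phi_t)$. The data are $\mathbf y=(\mathbf y_1,\dots,\mathbf y_s)$ with $\mathbf y_t=y_t({\cal X}_t)$, and $(\beta,\gamma,\sigma^2)$ has the improper prior $\propto\prod_{t=1}^s 1/\sigma_t^2$ on $\sigma_t^2>0$. For $\mathbf x_0\in\mathcal X$, the predictive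 distribution of $(y_1(\mathbf x_0),\dots,y_s(\mathbf x_0))$ given $(\mathbf y,\phi)$ is its conditional law given $\mathbf y$ and $(\beta,\gamma,\sigma^2)$, integrated over the posterior of $(\beta,\gamma,\sigma^2)$. (The posterior is formed from the continuous version of the density of $\mathbf y$, and the conditional law is the version that is weakly continuous in $\mathbf y$.) Its marginal means $\hat y_t(\mathbf x_0)=E[y_t(\mathbf x_0)\mid\mathbf y,\phi]$ and variances $\hat v_t(\mathbf x_0)=\mathrm{Var}[y_t(\mathbf x_0)\mid\mathbf y,\phi]$ are called the cokriging predictor and the cokriging variance. Put $\mathbf R_t=r({\cal X}_t,{\cal X}_t\mid\phi_t)$, $\mathbf r_t=r({\cal X}_t,\mathbf x_0\mid\phi_t)$, $\mathbf H_t=\mathbf h_t({\cal X}_t)$, $\mathbf X_1=\mathbf H_1$ and, for $t>1$, $W_{t-1}=y_{t-1}({\cal X}_t)$ and $\mathbf X_t=[\mathbf H_t,\,W_{t-1}]$. Let $q_t$ be the number of columns of $\mathbf X_t$, and $$\hat{\mathbf b}_t=(\mathbf X_t^\top\mathbf R_t^{-1}\mathbf X_t)^{-1}\mathbf X_t^\top\mathbf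 R_t^{-1}\mathbf y_t,\qquad \hat\sigma_t^2=\frac{(\mathbf y_t-\mathbf X_t\hat{\mathbf b}_t)^\top\mathbf R_t^{-1}(\mathbf y_t-\mathbf X_t\hat{\mathbf b}_t)}{n_t-q_t},$$ with $\hat\gamma_{t-1}$ the last entry of $\hat{\mathbf b}_t$ for $t>1$, and $$\mathbf Q_t^H=\mathbf R_t^{-1}-\mathbf R_t^{-1}\mathbf H_t(\mathbf H_t^\top\mathbf R_t^{-1}\mathbf H_t)^{-1}\mathbf H_t^\top\mathbf R_t^{-1}.$$ **Theorem.** Assume that $n_t-q_t>2$, that $\mathbf R_t$ is positive definite, that $\mathbf X_t$ has linearly independent columns and that $\mathbf y_t$ is not in the column space of $\mathbf X_t$, for every $t$. Then, for every $\mathbf x_0\in\mathcal X$, the predictive distribution is a probability measure with finite second moments, and for $t=1,\dots,s$ $$\hat y_t(\mathbf x_0)=\mathbf f_t^\top\hat{\mathbf b}_t+\mathbf r_t^\top\mathbf R_t^{-1}(\mathbf y_t-\mathbf X_t\hat{\mathbf b}_t),$$ $$\hat v_t(\mathbf x_0)=\hat\gamma_{t-1}^2\,\hat v_{t-1}(\mathbf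 x_0)+\frac{n_t-q_t}{n_t-q_t-2}\,\hat\sigma_t^2\,\bigl\{r(\mathbf x_0,\mathbf x_0\mid\phi_t)-\mathbf r_t^\top\mathbf R_t^{-1}\mathbf r_t+\kappa_t\bigr\},$$ where $\mathbf f_1=\mathbf h_1(\mathbf x_0)$, $\mathbf f_t=[\mathbf h_t(\mathbf x_0)^\top,\hat y_{t-1}(\mathbf x_0)]^\top$ for $t>1$, and $$\kappa_t=[\mathbf f_t-\mathbf X_t^\top\mathbf R_t^{-1}\mathbf r_t]^\top(\mathbf X_t^\top\mathbf R_t^{-1}\mathbf X_t)^{-1}[\mathbf f_t-\mathbf X_t^\top\mathbf R_t^{-1}\mathbf r_t]+\hat v_{t-1}(\mathbf x_0)\,\{W_{t-1}^\top\mathbf Q_t^H W_{t-1}\}^{-1};$$ for $t=1$ the terms with $\hat v_0$ are absent. Moreover, all $\hat y_t(\mathbf x_0),\hat v_t(\mathbf x_0)$ can be computed exactly with $O(\sum_{t=1}^s n_t^3)$ operations: there is an absolute constant $C$ such that, for all designs and numbers of basis functions with $n_t-q_t>2$, there is a straight-line program depending only on these, whose instructions read one input, load a rational constant, or perform one of $+,-,\times,\div$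 on two values computed before, which has at most $C\sum_{t=1}^s n_t^3$ instructions and which, whenever the assumptions above hold, never divides by zero and computes these $2s$ numbers from the entries of $\mathbf y_t$, $\mathbf H_t$, $\mathbf h_t(\mathbf x_0)$, $\mathbf R_t$, $\mathbf r_t$ and $r(\mathbf x_0,\mathbf x_0\mid\phi_t)$. -/

import Mathlib

open MeasureTheory ProbabilityTheory Matrix
open scoped BoundedContinuousFunction ENNReal NNReal

noncomputable section

/-! ### Continuous versions of densities and of conditional laws -/

/-- The continuous version of the density of `μ` with respect to Lebesgue measure (zero if there is
none). When the reference measure charges every nonempty open set, it is unique. -/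
def contDensity {α : Type*} [MeasureSpace α] [TopologicalSpace α] (μ : Measure α) : α → ℝ≥0 :=
  open Classical in
  if hf : ∃ f : α → ℝ≥0, Continuous f ∧ μ = volume.withDensity (fun a => (f a : ℝ≥0∞))
  then hf.choose else 0

/-- The (weakly) continuous version of the conditional law of the second coordinate given the first
one, under the law `P` on `α × β` (zero if there is none). It is unique when the first marginal
of `P` charges every nonempty open set. -/
def contCondLaw {α β : Type*} [MeasurableSpace α] [TopologicalSpace α]
    [MeasurableSpace β] [TopologicalSpace β] (P : Measure (α × β)) : α → Measure β :=
  open Classical in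
  if hκ : ∃ κ : Kernel α β, IsMarkovKernel κ ∧ P.fst ⊗ₘ κ = P ∧
      ∀ f : β →ᵇ ℝ, Continuous fun a => ∫ b, f b ∂(κ a)
  then fun a => hκ.choose a else 0

/-! ### Generalized least squares and kriging

`R` is a correlation matrix, `X` a matrix of regressors, `y` a vector of outputs, `r₀` the vector
of correlations between the design and a new input, `f₀` the regressors at the new input. -/

section Kriging

variable {ι κ : Type*} [Fintype ι] [Fintype κ]

open scoped Classical in
/-- `(Xᵀ R⁻¹ X)⁻¹ Xᵀ R⁻¹ y`. -/
def glsCoef (R : Matrix ι ι ℝ) (X : Matrix ι κ ℝ) (y : ι → ℝ) : κ → ℝ :=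
  (Xᵀ * R⁻¹ * X)⁻¹ *ᵥ (Xᵀ *ᵥ (R⁻¹ *ᵥ y))

/-- `y - X b̂`. -/
def glsResid (R : Matrix ι ι ℝ) (X : Matrix ι κ ℝ) (y : ι → ℝ) : ι → ℝ :=
  y - X *ᵥ glsCoef R X y

open scoped Classical in
/-- `(y - X b̂)ᵀ R⁻¹ (y - X b̂) / (n - q)`, with `n` rows and `q` columns in `X`. -/
def glsVar (R : Matrix ι ι ℝ) (X : Matrix ι κ ℝ) (y : ι → ℝ) : ℝ :=
  (glsResid R X y ⬝ᵥ (R⁻¹ *ᵥ glsResid R X y)) / ((Fintype.card ι : ℝ) - (Fintype.card κ : ℝ))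

open scoped Classical in
/-- `f₀ᵀ b̂ + r₀ᵀ R⁻¹ (y - X b̂)`. -/
def krigMean (R : Matrix ι ι ℝ) (X : Matrix ι κ ℝ) (y : ι → ℝ) (r₀ : ι → ℝ) (f₀ : κ → ℝ) : ℝ :=
  f₀ ⬝ᵥ glsCoef R X y + r₀ ⬝ᵥ (R⁻¹ *ᵥ glsResid R X y)

open scoped Classical in
/-- `r₀ᵀ R⁻¹ r₀`. -/
def krigReduction (R : Matrix ι ι ℝ) (r₀ : ι → ℝ) : ℝ := r₀ ⬝ᵥ (R⁻¹ *ᵥ r₀)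

open scoped Classical in
/-- `(f₀ - Xᵀ R⁻¹ r₀)ᵀ (Xᵀ R⁻¹ X)⁻¹ (f₀ - Xᵀ R⁻¹ r₀)`. -/
def glsTerm (R : Matrix ι ι ℝ) (X : Matrix ι κ ℝ) (r₀ : ι → ℝ) (f₀ : κ → ℝ) : ℝ :=
  (f₀ - Xᵀ *ᵥ (R⁻¹ *ᵥ r₀)) ⬝ᵥ ((Xᵀ * R⁻¹ * X)⁻¹ *ᵥ (f₀ - Xᵀ *ᵥ (R⁻¹ *ᵥ r₀)))

open scoped Classical in
/-- `R⁻¹ - R⁻¹ H (Hᵀ R⁻¹ H)⁻¹ Hᵀ R⁻¹`. -/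
def projQ (R : Matrix ι ι ℝ) (H : Matrix ι κ ℝ) : Matrix ι ι ℝ :=
  R⁻¹ - R⁻¹ * H * (Hᵀ * R⁻¹ * H)⁻¹ * Hᵀ * R⁻¹

end Kriging

/-! ### The autoregressive cokriging model

The `s + 1` code levels are numbered `0, …, s`, level `0` being the least accurate one. -/

/-- A hierarchically nested design, with the number of basis functions at each level. -/
structure CokrigingDesign (𝒳 : Type*) (s : ℕ) where
  /-- the inputs at which the code of level `t` is run -/
  pts : Fin (s + 1) → Finset 𝒳
  nested : ∀ t : Fin s, pts t.succ ⊆ pts t.castSucc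
  /-- the number of basis functions at level `t` -/
  p : Fin (s + 1) → ℕ

/-- `r` is a correlation function: a symmetric positive semidefinite kernel equal to one on the
diagonal. -/
structure IsCorrelation {𝒳 : Type*} (r : 𝒳 → 𝒳 → ℝ) : Prop where
  diag : ∀ x, r x x = 1
  posSemidef : ∀ F : Finset 𝒳, (Matrix.of fun x x' : F => r x x').PosSemidef

/-- The basis functions, and the correlation functions `r t = r(·, ·|φₜ)` at the given values of the
correlation parameters. -/
structure CokrigingModel {𝒳 : Type*} {s : ℕ} (D : CokrigingDesign 𝒳 s) where
  h : ∀ t, 𝒳 → Fin (D.p t) → ℝ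
  r : Fin (s + 1) → 𝒳 → 𝒳 → ℝ
  isCorrelation : ∀ t, IsCorrelation (r t)

/-- The autoregression `y₀ = δ₀`, `yₜ₊₁ = γₜ yₜ + δₜ₊₁`. -/
def arField {ι : Type*} {s : ℕ} (γ : Fin s → ℝ) (δ : Fin (s + 1) → ι → ℝ) (t : Fin (s + 1)) :
    ι → ℝ :=
  Fin.induction (motive := fun _ => ι → ℝ) (δ 0) (fun t yt x => γ t * yt x + δ t.succ x) t

namespace CokrigingDesign

variable {𝒳 : Type*} {s : ℕ} (D : CokrigingDesign 𝒳 s)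

/-- The number of runs at level `t`. -/
def n (t : Fin (s + 1)) : ℕ := (D.pts t).card

/-- The number of regression coefficients at level `t`: those of the basis functions, and for
`t ≠ 0` the scale discrepancy. -/
def q (t : Fin (s + 1)) : ℕ := D.p t + if t = 0 then 0 else 1

/-- The code output at all levels. -/
abbrev Data : Type _ := ∀ t : Fin (s + 1), D.pts t → ℝ

/-- The parameters `(β, γ, σ²)`. -/
abbrev Param : Type := (∀ t : Fin (s + 1), Fin (D.p t) → ℝ) × (Fin s → ℝ) × (Fin (s + 1) → ℝ)

/-- The vector of outputs of level `t` at the design of level `t + 1`. -/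
def W (y : D.Data) (t : Fin s) : D.pts t.succ → ℝ :=
  fun x => y t.castSucc ⟨x.1, D.nested t x.2⟩

open scoped Classical in
/-- All inputs of the design, together with `x₀`. -/
def allPts (x₀ : 𝒳) : Finset 𝒳 := insert x₀ (Finset.univ.biUnion D.pts)

lemma mem_allPts_self (x₀ : 𝒳) : x₀ ∈ D.allPts x₀ := by
  classical
  exact Finset.mem_insert_self _ _

lemma mem_allPts (x₀ : 𝒳) {t : Fin (s + 1)} {x : 𝒳} (hx : x ∈ D.pts t) : x ∈ D.allPts x₀ := by
  classical
  exact Finset.mem_insert_of_mem (Finset.mem_biUnion.2 ⟨t, Finset.mem_univ t, hx⟩)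

/-- From the values of all levels at all inputs, extract the code output and the vector
`(y₀(x₀), …, yₛ(x₀))`. -/
def observe (x₀ : 𝒳) (u : Fin (s + 1) → D.allPts x₀ → ℝ) : D.Data × (Fin (s + 1) → ℝ) :=
  (fun t x => u t ⟨x.1, D.mem_allPts x₀ x.2⟩, fun t => u t ⟨x₀, D.mem_allPts_self x₀⟩)

/-- The improper prior with density proportional to `∏ₜ 1 / σₜ²` on `(β, γ, σ²)`, `σₜ² > 0`. -/
def prior : Measure D.Param :=
  (volume.restrict {θ : D.Param | ∀ t, 0 < θ.2.2 t}).withDensity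
    (fun θ => ∏ t, ENNReal.ofReal (1 / θ.2.2 t))

end CokrigingDesign

namespace CokrigingModel

variable {𝒳 : Type*} {s : ℕ} {D : CokrigingDesign 𝒳 s} (M : CokrigingModel D)

/-! #### Probabilistic side: sampling law, posterior, predictive distribution -/

open scoped Classical in
/-- The law on the finite set `F` of the Gaussian process with mean function `h_tᵀ β_t` and
covariance function `σ_t² r(·, ·|φ_t)`. -/
def gpLaw (F : Finset 𝒳) (θ : D.Param) (t : Fin (s + 1)) : Measure (F → ℝ) :=
  (multivariateGaussian (WithLp.toLp 2 fun x : F => M.h t x ⬝ᵥ θ.1 t)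
    (θ.2.2 t • Matrix.of fun x x' : F => M.r t x x')).map WithLp.ofLp

/-- The law of `(y₀, …, yₛ)` on the finite set `F`, given the parameters: the processes
`y₀ = δ₀, δ₁, …, δₛ` are independent Gaussian processes, and `yₜ₊₁ = γₜ yₜ + δₜ₊₁`. -/
def fieldLaw (F : Finset 𝒳) (θ : D.Param) : Measure (Fin (s + 1) → F → ℝ) :=
  (Measure.pi (M.gpLaw F θ)).map (arField θ.2.1)

/-- The joint law of the code output and of `(y₀(x₀), …, yₛ(x₀))`, given the parameters. -/
def jointLaw (x₀ : 𝒳) (θ : D.Param) : Measure (D.Data × (Fin (s + 1) → ℝ)) :=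
  (M.fieldLaw (D.allPts x₀) θ).map (D.observe x₀)

/-- The likelihood of the parameters. -/
def likelihood (x₀ : 𝒳) (y : D.Data) (θ : D.Param) : ℝ≥0 := contDensity (M.jointLaw x₀ θ).fst y

/-- Prior times likelihood. -/
def unnormPosterior (x₀ : 𝒳) (y : D.Data) : Measure D.Param :=
  D.prior.withDensity (fun θ => (M.likelihood x₀ y θ : ℝ≥0∞))

/-- The posterior distribution of `(β, γ, σ²)` given the code output. -/
def posterior (x₀ : 𝒳) (y : D.Data) : Measure D.Param :=
  (M.unnormPosterior x₀ y Set.univ)⁻¹ • M.unnormPosterior x₀ y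

/-- The predictive distribution of `(y₀(x₀), …, yₛ(x₀))` given the code output (and the correlation
parameters): the conditional law given the code output and `(β, γ, σ²)`, integrated over the
posterior distribution of `(β, γ, σ²)`. -/
def predictive (x₀ : 𝒳) (y : D.Data) : Measure (Fin (s + 1) → ℝ) :=
  (M.posterior x₀ y).bind (fun θ => contCondLaw (M.jointLaw x₀ θ) y)

/-- The cokriging predictor at level `t`: the mean of `yₜ(x₀)` given the code output. -/
def predictor (x₀ : 𝒳) (y : D.Data) (t : Fin (s + 1)) : ℝ :=
  ∫ u, u t ∂(M.predictive x₀ y)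

/-- The cokriging variance at level `t`: the variance of `yₜ(x₀)` given the code output. -/
def predVariance (x₀ : 𝒳) (y : D.Data) (t : Fin (s + 1)) : ℝ :=
  variance (fun u => u t) (M.predictive x₀ y)

/-! #### Matrices of the regression problem -/

/-- The correlation matrix `R_t` of the design of level `t`. -/
def R (t : Fin (s + 1)) : Matrix (D.pts t) (D.pts t) ℝ := Matrix.of fun x x' => M.r t x x'

/-- The vector of correlations between the design of level `t` and `x₀`. -/
def rvec (x₀ : 𝒳) (t : Fin (s + 1)) : D.pts t → ℝ := fun x => M.r t x x₀

/-- The matrix `H_t` of the basis functions at the design of level `t`. -/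
def H (t : Fin (s + 1)) : Matrix (D.pts t) (Fin (D.p t)) ℝ := Matrix.of fun x => M.h t x

/-- The regression matrix `[H_{t+1}, W_t]` of level `t + 1`; the one of level `0` is `H_0`. -/
def X (y : D.Data) (t : Fin s) : Matrix (D.pts t.succ) (Fin (D.p t.succ) ⊕ Unit) ℝ :=
  Matrix.fromCols (M.H t.succ) (Matrix.replicateCol Unit (D.W y t))

/-- The regressors of level `t + 1` at `x₀`, with `a` plugged in for `yₜ(x₀)`. -/
def f (x₀ : 𝒳) (t : Fin s) (a : ℝ) : Fin (D.p t.succ) ⊕ Unit → ℝ :=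
  Sum.elim (M.h t.succ x₀) (fun _ => a)

/-- The generalized least squares estimate of the scale discrepancy `γ_t` from level `t` to level
`t + 1`. -/
def gammaHat (y : D.Data) (t : Fin s) : ℝ :=
  glsCoef (M.R t.succ) (M.X y t) (y t.succ) (Sum.inr ())

/-- The term `κ` of level `t + 1`, as a function of the mean `a` and the variance `v` of
`yₜ(x₀)`. -/
def kappa (x₀ : 𝒳) (y : D.Data) (t : Fin s) (a v : ℝ) : ℝ :=
  glsTerm (M.R t.succ) (M.X y t) (M.rvec x₀ t.succ) (M.f x₀ t a) +
    v * (D.W y t ⬝ᵥ (projQ (M.R t.succ) (M.H t.succ) *ᵥ D.W y t))⁻¹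

/-- The regression problems of all levels are nondegenerate: the correlation matrices are positive
definite, the regression matrices have linearly independent columns, and no output vector is
fitted exactly by its regressors. -/
structure Nondegenerate (y : D.Data) : Prop where
  posDef : ∀ t, (M.R t).PosDef
  indep_zero : LinearIndependent ℝ (M.H 0).col
  indep_succ : ∀ t : Fin s, LinearIndependent ℝ (M.X y t).col
  resid_zero : ∀ b, M.H 0 *ᵥ b ≠ y 0
  resid_succ : ∀ (t : Fin s) (b), M.X y t *ᵥ b ≠ y t.succ

end CokrigingModel

/-! ### Arithmetic straight-line programs -/

/-- An instruction of a straight-line program: read an input, load a rational constant, or perform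
an arithmetic operation on two values computed before, given by their addresses. -/
inductive Instr (ι : Type*) where
  | input (i : ι)
  | const (c : ℚ)
  | add (j k : ℕ)
  | sub (j k : ℕ)
  | mul (j k : ℕ)
  | div (j k : ℕ)

open scoped Classical in
/-- The value of an instruction, given the inputs and the list of the values computed before.
It is undefined for an address out of range and for a division by zero. -/
def Instr.eval {ι : Type*} (x : ι → ℝ) (m : List ℝ) : Instr ι → Option ℝ
  | .input i => some (x i)
  | .const c => some (c : ℝ)
  | .add j k => m[j]?.bind fun a => m[k]?.bind fun b => some (a + b)
  | .sub j k => m[j]?.bind fun a => m[k]?.bind fun b => some (a - b)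
  | .mul j k => m[j]?.bind fun a => m[k]?.bind fun b => some (a * b)
  | .div j k => m[j]?.bind fun a => m[k]?.bind fun b => if b = 0 then none else some (a / b)

/-- Run a straight-line program from a list of values: each instruction appends its value. The number
of steps of the run is the length of the program. -/
def runFrom {ι : Type*} (x : ι → ℝ) : List ℝ → List (Instr ι) → Option (List ℝ)
  | m, [] => some m
  | m, i :: P => (i.eval x m).bind fun v => runFrom x (m ++ [v]) P

/-- The names of the inputs of a program that computes cokriging predictions. -/
inductive CokrigingInput {𝒳 : Type*} {s : ℕ} (D : CokrigingDesign 𝒳 s) where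
  | output (t : Fin (s + 1)) (x : D.pts t)
  | basis (t : Fin (s + 1)) (x : D.pts t) (j : Fin (D.p t))
  | basisNew (t : Fin (s + 1)) (j : Fin (D.p t))
  | corr (t : Fin (s + 1)) (x x' : D.pts t)
  | corrNew (t : Fin (s + 1)) (x : D.pts t)
  | corrSelf (t : Fin (s + 1))

/-- The values of these inputs: the code output, and the values of the basis functions and of the
correlation functions at the design and at `x₀`. -/
def CokrigingModel.inputValue {𝒳 : Type*} {s : ℕ} {D : CokrigingDesign 𝒳 s} (M : CokrigingModel D)
    (x₀ : 𝒳) (y : D.Data) : CokrigingInput D → ℝ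
  | .output t x => y t x
  | .basis t x j => M.h t x j
  | .basisNew t j => M.h t x₀ j
  | .corr t x x' => M.r t x x'
  | .corrNew t x => M.r t x x₀
  | .corrSelf t => M.r t x₀ x₀

end

/-! ### Products of measures with densities -/

/-! Fix the parameters. Replacing `y` by the values of the discrepancies, `y_t - γ_{t-1} W_{t-1}`,
is a linear map equal to the identity minus a nilpotent one, so it has determinant one and the
likelihood is a product over the levels of Gaussian densities at `y_t - X_t b_t`, where `b_t`
collects `β_t` and `γ_{t-1}` (`det_detrend`, `likelihood_eq`). Given the data, each `δ_t(x₀)` is its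
simple kriging prediction plus an independent normal error (`map_multivariateGaussian_split`,
`contCondLaw_jointLaw`). Continuity makes both the density and the conditional law unique, so the
abstract definitions coincide with these explicit ones.

The prior is a product over the levels too, hence so is the posterior. At one level the normal
equations split the sum of squares into residual and regression parts, which exhibits `(b_t, σ_t²)`
as normal - inverse gamma with shape `(n_t - q_t)/2` and scale half the residual sum of squares
(`exists_withDensity_nigDensity_eq`). The scale is positive because `y_t` is not fitted exactly; the
mean of `σ_t²` is finite because `n_t - q_t > 2`.

The predictive distribution is therefore the law of an autoregression driven by pairs (`γ_{t-1}`,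
`δ_t(x₀)`) that are independent across levels (`predictive_eq`). In particular `y_{t-1}(x₀)` is
independent of the pair of level `t`. If `y_{t-1}(x₀)` is frozen at `u`, the value `y_t(x₀)` is a
universal kriging prediction with regressors `[h_t(x₀), u]`: its mean is affine in `u` with slope
the estimate of `γ_{t-1}`, and its variance is quadratic in `u`, the leading coefficient being the
multiple of a diagonal entry of `(Xᵀ R⁻¹ X)⁻¹`, which equals `(Wᵀ Q W)⁻¹` (`moments_krig`,
`glsCov_inr_inr`). Averaging over `u` by the law of total variance, with expansions about the mean
of `u` so that linear terms vanish, gives the recursion (`integral_variance_mul_add_prod`,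
`predictive_moments`).

For the cost, each level uses a bounded number of products and inversions of matrices of size at
most `n_t`. The inverted matrices are positive definite, so inversion by bordering never meets a
zero pivot and a single program serves all nondegenerate data (`Cost.inv_fin`, `cost_mean_var`). -/

theorem lintegral_fin_prod_eq_prod {n : ℕ} {E : Fin n → Type*}
    {mE : ∀ i, MeasurableSpace (E i)} {μ : (i : Fin n) → Measure (E i)} [∀ i, SigmaFinite (μ i)]
    {f : (i : Fin n) → E i → ℝ≥0∞} (hf : ∀ i, Measurable (f i)) :
    ∫⁻ x : (i : Fin n) → E i, ∏ i, f i (x i) ∂(Measure.pi μ) = ∏ i, ∫⁻ x, f i x ∂(μ i) := by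
  induction n with
  | zero => simp
  | succ n n_ih =>
      calc
        _ = ∫⁻ x : E 0 × ((i : Fin n) → E (Fin.succ i)),
            f 0 x.1 * ∏ i : Fin n, f (Fin.succ i) (x.2 i)
            ∂((μ 0).prod (Measure.pi (fun i ↦ μ i.succ))) := by
          rw [← ((measurePreserving_piFinSuccAbove μ 0).symm).lintegral_comp (by fun_prop)]
          refine lintegral_congr fun x => ?_
          rw [Fin.prod_univ_succ]
          rfl
        _ = (∫⁻ x, f 0 x ∂μ 0)
            * ∏ i : Fin n, ∫⁻ (x : E (Fin.succ i)), f (Fin.succ i) x ∂(μ i.succ) := by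
          rw [← n_ih fun i => hf _]
          have hm : Measurable fun x : (∀ i : Fin n, E i.succ) => ∏ i : Fin n, f i.succ (x i) :=
            Finset.measurable_prod _ fun i _ => (hf i.succ).comp (measurable_pi_apply i)
          exact lintegral_prod_mul (μ := μ 0) (ν := Measure.pi fun i => μ i.succ)
            (hf 0).aemeasurable hm.aemeasurable
        _ = ∏ i, ∫⁻ x, f i x ∂(μ i) := by rw [Fin.prod_univ_succ]

theorem lintegral_fintype_prod_eq_prod {ι : Type*} [Fintype ι] {E : ι → Type*}
    {mE : ∀ i, MeasurableSpace (E i)} {μ : (i : ι) → Measure (E i)} [∀ i, SigmaFinite (μ i)]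
    {f : (i : ι) → E i → ℝ≥0∞} (hf : ∀ i, Measurable (f i)) :
    ∫⁻ x : (i : ι) → E i, ∏ i, f i (x i) ∂(Measure.pi μ) = ∏ i, ∫⁻ x, f i x ∂(μ i) := by
  let e := (Fintype.equivFin ι).symm
  rw [← (measurePreserving_piCongrLeft _ e).lintegral_comp (by fun_prop)]
  simp_rw [← e.prod_comp, MeasurableEquiv.coe_piCongrLeft, Equiv.piCongrLeft_apply_apply]
  exact lintegral_fin_prod_eq_prod fun i => hf _

/-- Rectangles determine a product measure, and the indicator of a rectangle is the product of the
indicators of its sides, so Tonelli factors its mass. -/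
theorem pi_withDensity {ι : Type*} [Fintype ι] {E : ι → Type*}
    {mE : ∀ i, MeasurableSpace (E i)} {μ : (i : ι) → Measure (E i)} [∀ i, SigmaFinite (μ i)]
    {f : (i : ι) → E i → ℝ≥0∞} (hf : ∀ i, Measurable (f i))
    [∀ i, SigmaFinite ((μ i).withDensity (f i))] :
    Measure.pi (fun i => (μ i).withDensity (f i)) =
      (Measure.pi μ).withDensity (fun x => ∏ i, f i (x i)) := by
  refine Measure.pi_eq fun s hs => ?_
  rw [withDensity_apply _ (MeasurableSet.univ_pi hs), ← lintegral_indicator (MeasurableSet.univ_pi hs)]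
  have h : (Set.univ.pi s).indicator (fun x => ∏ i, f i (x i)) =
      fun x => ∏ i, (s i).indicator (f i) (x i) := by
    classical
    ext x
    by_cases hx : x ∈ Set.univ.pi s
    · rw [Set.indicator_of_mem hx]
      exact Finset.prod_congr rfl fun i _ => (Set.indicator_of_mem (hx i trivial) _).symm
    · rw [Set.indicator_of_notMem hx]
      obtain ⟨i, hi⟩ : ∃ i, x i ∉ s i := by simpa [Set.mem_pi] using hx
      exact (Finset.prod_eq_zero (Finset.mem_univ i) (Set.indicator_of_notMem hi _)).symm
  rw [h, lintegral_fintype_prod_eq_prod fun i => (hf i).indicator (hs i)]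
  exact Finset.prod_congr rfl fun i _ => by
    rw [withDensity_apply _ (hs i), lintegral_indicator (hs i)]

theorem withDensity_map {α β : Type*} [MeasurableSpace α] [MeasurableSpace β] {μ : Measure α}
    {e : α → β} (he : Measurable e) {g : β → ℝ≥0∞} (hg : Measurable g) :
    (μ.map e).withDensity g = (μ.withDensity (fun a => g (e a))).map e := by
  ext s hs
  rw [withDensity_apply _ hs, Measure.map_apply he hs, withDensity_apply _ (he hs),
    setLIntegral_map hs hg he]

/-! ### Families of pairs and pairs of families -/

/-- Split a family of pairs into the pair of the families of components. -/
def unzipPi {T : Type*} {α β : T → Type*} (z : ∀ t, α t × β t) : (∀ t, α t) × (∀ t, β t) :=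
  (fun t => (z t).1, fun t => (z t).2)

theorem measurable_unzipPi {T : Type*} {α β : T → Type*} [∀ t, MeasurableSpace (α t)]
    [∀ t, MeasurableSpace (β t)] : Measurable (unzipPi (α := α) (β := β)) :=
  (measurable_pi_lambda _ fun t => (measurable_pi_apply t).fst).prodMk
    (measurable_pi_lambda _ fun t => (measurable_pi_apply t).snd)

/-- Randomness is produced level by level as pairs (design part, noise), while conditioning
separates all design parts from all noises; this is the passage between the two groupings. -/
theorem map_unzipPi {T : Type*} [Fintype T] {α β : T → Type*} [∀ t, MeasurableSpace (α t)]
    [∀ t, MeasurableSpace (β t)] (μ : ∀ t, Measure (α t)) (ν : ∀ t, Measure (β t))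
    [∀ t, SigmaFinite (μ t)] [∀ t, SigmaFinite (ν t)] :
    (Measure.pi fun t => (μ t).prod (ν t)).map unzipPi = (Measure.pi μ).prod (Measure.pi ν) := by
  open Measure in
  refine (FiniteSpanningSetsIn.ext ?_ (isPiSystem_pi.prod isPiSystem_pi)
    ((FiniteSpanningSetsIn.pi fun i ↦ (μ i).toFiniteSpanningSetsIn).prod
    (FiniteSpanningSetsIn.pi (fun i ↦ (ν i).toFiniteSpanningSetsIn))) ?_).symm
  · refine (generateFrom_eq_prod generateFrom_pi generateFrom_pi ?_ ?_).symm
    · exact (FiniteSpanningSetsIn.pi (fun i ↦ (μ i).toFiniteSpanningSetsIn)).isCountablySpanning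
    · exact (FiniteSpanningSetsIn.pi (fun i ↦ (ν i).toFiniteSpanningSetsIn)).isCountablySpanning
  · rintro _ ⟨s, ⟨s, hs, rfl⟩, ⟨_, ⟨t, ht, rfl⟩, rfl⟩⟩
    simp only [Set.mem_pi, Set.mem_univ, forall_const, Set.mem_ofPred_eq] at hs ht
    rw [Measure.map_apply measurable_unzipPi
      ((MeasurableSet.univ_pi hs).prod (MeasurableSet.univ_pi ht))]
    rw [show unzipPi ⁻¹' (Set.univ.pi s ×ˢ Set.univ.pi t) =
        (Set.univ.pi fun i ↦ s i ×ˢ t i) by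
        ext; simp [Set.mem_pi, forall_and, unzipPi]]
    simp_rw [pi_pi, prod_prod, pi_pi, Finset.prod_mul_distrib]

/-! ### Uniqueness of continuous versions -/

/-- Two densities of the same measure agree almost everywhere, and continuous functions that agree
almost everywhere for a measure charging all open sets are equal. -/
theorem contDensity_eq {α : Type*} [MeasureSpace α] [TopologicalSpace α] [BorelSpace α]
    [SigmaFinite (volume : Measure α)] [(volume : Measure α).IsOpenPosMeasure]
    {μ : Measure α} {f : α → ℝ≥0} (hf : Continuous f)
    (hμ : μ = volume.withDensity (fun a => (f a : ℝ≥0∞))) : contDensity μ = f := by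
  classical
  have h : ∃ f : α → ℝ≥0, Continuous f ∧ μ = volume.withDensity (fun a => (f a : ℝ≥0∞)) :=
    ⟨f, hf, hμ⟩
  rw [contDensity, dif_pos h]
  obtain ⟨h1, h2⟩ := h.choose_spec
  refine (h1.ae_eq_iff_eq volume hf).1 ?_
  have h3 := (withDensity_eq_iff_of_sigmaFinite
    (μ := (volume : Measure α)) (f := fun a => (h.choose a : ℝ≥0∞)) (g := fun a => (f a : ℝ≥0∞))
    (by fun_prop) (by fun_prop)).1 (h2.symm.trans hμ)
  filter_upwards [h3] with a ha
  exact_mod_cast ha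

/-- When the second coordinate is a function `g` of the first one and of an independent noise,
freezing the first coordinate gives a version of the conditional law. Dominated convergence makes it
weakly continuous. Any other continuous version agrees almost everywhere with it, hence everywhere
after testing against each bounded continuous function. -/
theorem contCondLaw_map_prod {α β γ : Type*} [MeasurableSpace α] [TopologicalSpace α] [BorelSpace α]
    [MeasurableSpace β] [TopologicalSpace β] [BorelSpace β] [HasOuterApproxClosed β]
    [FirstCountableTopology α]
    [MeasurableSpace.CountableOrCountablyGenerated α β] [MeasurableSpace γ]
    (μ : Measure α) (ν : Measure γ) [IsProbabilityMeasure μ] [IsProbabilityMeasure ν]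
    [μ.IsOpenPosMeasure] {g : α → γ → β} (hg : Measurable (Function.uncurry g))
    (hg' : ∀ c, Continuous fun a => g a c) (a : α) :
    contCondLaw ((μ.prod ν).map fun p => (p.1, g p.1 p.2)) a = ν.map (g a) := by
  classical
  have hga : ∀ a, Measurable (g a) := fun a => hg.comp measurable_prodMk_left
  have hP : Measurable fun p : α × γ => (p.1, g p.1 p.2) := measurable_fst.prodMk hg
  -- The explicit candidate: draw the noise, freeze the first coordinate, apply `g`.
  let κ₀ : Kernel α β :=
    (Kernel.deterministic id measurable_id ×ₖ Kernel.const α ν).map (Function.uncurry g)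
  have hκ₀ : ∀ a, κ₀ a = ν.map (g a) := by
    intro a
    rw [Kernel.map_apply _ hg, Kernel.prod_apply,
      Kernel.deterministic_apply, Kernel.const_apply, Measure.dirac_prod,
      Measure.map_map hg measurable_prodMk_left]
    rfl
  have hmk : IsMarkovKernel κ₀ := ⟨fun a => by
    rw [hκ₀]; exact Measure.isProbabilityMeasure_map (hga a).aemeasurable⟩
  have hfst : ((μ.prod ν).map fun p => (p.1, g p.1 p.2)).fst = μ := by
    rw [Measure.fst, Measure.map_map measurable_fst hP]
    exact Measure.fst_prod
  have hcomp : μ ⊗ₘ κ₀ = (μ.prod ν).map fun p => (p.1, g p.1 p.2) := by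
    ext s hs
    rw [Measure.compProd_apply hs, Measure.map_apply hP hs, Measure.prod_apply (hP hs)]
    refine lintegral_congr fun a => ?_
    rw [hκ₀, Measure.map_apply (hga a) (measurable_prodMk_left hs)]
    rfl
  have hcont : ∀ f : β →ᵇ ℝ, Continuous fun a => ∫ b, f b ∂(κ₀ a) := by
    intro f
    have h : ∀ a, ∫ b, f b ∂(κ₀ a) = ∫ c, f (g a c) ∂ν := fun a => by
      rw [hκ₀, integral_map (hga a).aemeasurable f.continuous.measurable.aestronglyMeasurable]
    simp_rw [h]
    refine continuous_of_dominated (bound := fun _ => ‖f‖) (fun a => ?_)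
      (fun a => ?_) (integrable_const _) ?_
    · exact (f.continuous.measurable.comp (hga a)).aestronglyMeasurable
    · exact .of_forall fun c => f.norm_coe_le_norm _
    · exact .of_forall fun c => f.continuous.comp (hg' c)
  set P := (μ.prod ν).map fun p => (p.1, g p.1 p.2) with hPdef
  have hex : ∃ κ : Kernel α β, IsMarkovKernel κ ∧ P.fst ⊗ₘ κ = P ∧
      ∀ f : β →ᵇ ℝ, Continuous fun a => ∫ b, f b ∂(κ a) :=
    ⟨κ₀, hmk, by rw [hfst, hcomp], hcont⟩
  rw [contCondLaw, dif_pos hex, ← hκ₀]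
  obtain ⟨h1, h2, h3⟩ := hex.choose_spec
  generalize hex.choose = κ at h1 h2 h3 ⊢
  rw [hfst] at h2
  have hae := Kernel.ae_eq_of_compProd_eq (h2.trans hcomp.symm)
  refine ext_of_forall_integral_eq_of_IsFiniteMeasure fun f => ?_
  refine congrFun (((h3 f).ae_eq_iff_eq μ (hcont f)).1 ?_) a
  filter_upwards [hae] with b hb
  rw [hb]

/-! ### Gaussian vectors -/

/-- The law of a vector of independent standard normal variables. -/
noncomputable def stdNormal (κ : Type*) [Fintype κ] : Measure (κ → ℝ) :=
  Measure.pi fun _ => gaussianReal 0 1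

instance {κ : Type*} [Fintype κ] : IsProbabilityMeasure (stdNormal κ) := by
  unfold stdNormal; infer_instance

section Gaussian

variable {ι κ : Type*} [Fintype ι] [Fintype κ]

theorem stdNormal_eq_withDensity : stdNormal κ = volume.withDensity (fun w : κ → ℝ =>
    ENNReal.ofReal ((√(2 * Real.pi))⁻¹ ^ Fintype.card κ * Real.exp (-(w ⬝ᵥ w) / 2))) := by
  have : SigmaFinite ((volume : Measure ℝ).withDensity (gaussianPDF 0 1)) := by
    rw [← gaussianReal_of_var_ne_zero _ one_ne_zero]; infer_instance
  unfold stdNormal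
  simp_rw [gaussianReal_of_var_ne_zero _ (one_ne_zero (α := ℝ≥0))]
  rw [pi_withDensity fun _ => measurable_gaussianPDF 0 1]
  congr 1
  ext w
  simp only [gaussianPDF, gaussianPDFReal]
  rw [← ENNReal.ofReal_prod_of_nonneg fun i _ => by positivity, Finset.prod_mul_distrib,
    ← Real.exp_sum]
  simp [dotProduct, ← Finset.sum_div, Finset.sum_neg_distrib, pow_two]

-- Linear change of variables: `L` scales Lebesgue measure by the inverse of `|det L|` and the
-- translation by `m` preserves it.
open scoped Classical in
theorem map_stdNormal_eq_withDensity {L : Matrix κ κ ℝ} (hL : L.det ≠ 0) (m : κ → ℝ) :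
    (stdNormal κ).map (fun w => m + L *ᵥ w) = volume.withDensity (fun x : κ → ℝ =>
      ENNReal.ofReal ((√(2 * Real.pi))⁻¹ ^ Fintype.card κ * |L.det|⁻¹ *
        Real.exp (-((L⁻¹ *ᵥ (x - m)) ⬝ᵥ (L⁻¹ *ᵥ (x - m))) / 2))) := by
  have he : Measurable fun w : κ → ℝ => m + L *ᵥ w :=
    (continuous_const.add (Continuous.matrix_mulVec continuous_const continuous_id)).measurable
  have hmap : (volume : Measure (κ → ℝ)).map (fun w => m + L *ᵥ w) =
      ENNReal.ofReal (|L.det|⁻¹) • volume := by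
    have h1 : (fun w : κ → ℝ => m + L *ᵥ w) = (fun x => m + x) ∘ (Matrix.toLin' L) := by
      ext w; simp
    rw [h1, ← Measure.map_map (measurable_const_add m)
      (LinearMap.continuous_on_pi _).measurable,
      Real.map_matrix_volume_pi_eq_smul_volume_pi hL, Measure.map_smul, abs_inv]
    rw [(measurePreserving_add_left volume m).map_eq]
  set d : (κ → ℝ) → ℝ≥0∞ := fun w =>
    ENNReal.ofReal ((√(2 * Real.pi))⁻¹ ^ Fintype.card κ * Real.exp (-(w ⬝ᵥ w) / 2)) with hd
  have hdm : Measurable fun x => d (L⁻¹ *ᵥ (x - m)) := by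
    refine ENNReal.measurable_ofReal.comp (Continuous.measurable ?_)
    simp only [dotProduct, mulVec]
    fun_prop
  have h2 : ∀ w, d (L⁻¹ *ᵥ (m + L *ᵥ w - m)) = d w := fun w => by
    rw [add_sub_cancel_left, mulVec_mulVec, Matrix.nonsing_inv_mul _ (Ne.isUnit hL), one_mulVec]
  have h3 := withDensity_map (μ := volume) he hdm
  simp_rw [h2] at h3
  rw [stdNormal_eq_withDensity, ← h3, hmap, withDensity_smul_measure, ← withDensity_smul _ hdm]
  congr 1
  ext x
  simp only [Pi.smul_apply, smul_eq_mul, hd]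
  rw [← ENNReal.ofReal_mul (by positivity)]
  congr 1
  ring

open scoped Classical in
/-- The density at `z` of a centred Gaussian vector with covariance matrix `v • R`, where
`R = L Lᵀ`. -/
noncomputable def gaussDensity (L R : Matrix κ κ ℝ) (v : ℝ) (z : κ → ℝ) : ℝ :=
  (√(2 * Real.pi))⁻¹ ^ Fintype.card κ * |L.det|⁻¹ * (√v)⁻¹ ^ Fintype.card κ *
    Real.exp (-krigReduction R z / (2 * v))

theorem det_ne_zero_of_mul_transpose [DecidableEq κ] {L R : Matrix κ κ ℝ} (hpos : R.PosDef)
    (hR : L * Lᵀ = R) : L.det ≠ 0 := fun h => by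
  have := hpos.det_pos.ne'
  rw [← hR, det_mul, h, zero_mul] at this
  exact this rfl

/-- Isolates the factor that depends neither on the variance nor on the argument, so that posterior
computations only need to follow the power of `v` and the exponent. -/
theorem exists_gaussDensity_eq {L R : Matrix κ κ ℝ} (hpos : R.PosDef) (hR : L * Lᵀ = R) :
    ∃ C : ℝ, 0 < C ∧ ∀ v z, gaussDensity L R v z =
      C * ((√v)⁻¹ ^ Fintype.card κ * Real.exp (-krigReduction R z / (2 * v))) := by
  classical
  have hL := abs_pos.2 (det_ne_zero_of_mul_transpose hpos hR)
  refine ⟨(√(2 * Real.pi))⁻¹ ^ Fintype.card κ * |L.det|⁻¹, by positivity, fun v z => ?_⟩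
  rw [gaussDensity, ← mul_assoc]

theorem gaussDensity_pos {L R : Matrix κ κ ℝ} (hpos : R.PosDef) (hR : L * Lᵀ = R) {v : ℝ}
    (hv : 0 < v) (z : κ → ℝ) : 0 < gaussDensity L R v z := by
  obtain ⟨C, hC, h⟩ := exists_gaussDensity_eq hpos hR
  have hs : 0 < √v := Real.sqrt_pos.2 hv
  rw [h]
  positivity

theorem measurable_gaussDensity (L R : Matrix κ κ ℝ) :
    Measurable fun p : ℝ × (κ → ℝ) => gaussDensity L R p.1 p.2 := by
  unfold gaussDensity krigReduction
  simp only [mulVec, dotProduct]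
  fun_prop

theorem continuous_gaussDensity (L R : Matrix κ κ ℝ) (v : ℝ) :
    Continuous (gaussDensity L R v) := by
  unfold gaussDensity krigReduction
  fun_prop

theorem map_stdNormal_smul_eq_withDensity {L R : Matrix κ κ ℝ} (hpos : R.PosDef)
    (hR : L * Lᵀ = R) (m : κ → ℝ) {v : ℝ} (hv : 0 < v) :
    (stdNormal κ).map (fun w => m + √v • L *ᵥ w) =
      volume.withDensity (fun x : κ → ℝ => ENNReal.ofReal (gaussDensity L R v (x - m))) := by
  classical
  have hL := det_ne_zero_of_mul_transpose hpos hR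
  have hs : 0 < √v := Real.sqrt_pos.2 hv
  have hdet : (√v • L).det ≠ 0 := by
    rw [det_smul]; positivity
  have h1 := map_stdNormal_eq_withDensity hdet m
  simp only [smul_mulVec] at h1 ⊢
  rw [h1]
  congr 1
  ext x
  have hinv : (√v • L)⁻¹ = (√v)⁻¹ • L⁻¹ := by
    refine Matrix.inv_eq_left_inv ?_
    rw [smul_mul_smul_comm, inv_mul_cancel₀ hs.ne', one_smul,
      Matrix.nonsing_inv_mul _ (Ne.isUnit hL)]
  have hq : ∀ z : κ → ℝ, (L⁻¹ *ᵥ z) ⬝ᵥ (L⁻¹ *ᵥ z) = z ⬝ᵥ (R⁻¹ *ᵥ z) := fun z => by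
    rw [← hR, Matrix.mul_inv_rev, ← mulVec_mulVec, ← Matrix.transpose_nonsing_inv,
      dotProduct_mulVec z, vecMul_transpose]
  rw [gaussDensity, krigReduction, hinv, det_smul, abs_mul, abs_of_pos (pow_pos hs _), mul_inv, ← inv_pow]
  simp only [smul_mulVec, smul_dotProduct, dotProduct_smul, smul_eq_mul, hq]
  congr 2
  · ring
  · congr 1
    rw [← mul_assoc, ← mul_inv, Real.mul_self_sqrt hv.le]
    field_simp

/-- Both sides have the same characteristic function. No rank condition is imposed on `B`, and the
right side sees `B` only through `B * Bᵀ`, so factors of the same covariance are interchangeable. -/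
theorem map_stdNormal_eq_multivariateGaussian [DecidableEq ι] (B : Matrix ι κ ℝ) (m : ι → ℝ) :
    (stdNormal κ).map (fun w => m + B *ᵥ w) =
      (multivariateGaussian (WithLp.toLp 2 m) (B * Bᵀ)).map WithLp.ofLp := by
  have hm : Measurable fun w : κ → ℝ => m + B *ᵥ w :=
    (continuous_const.add (Continuous.matrix_mulVec continuous_const continuous_id)).measurable
  have hpsd : (B * Bᵀ).PosSemidef := by
    simpa using Matrix.posSemidef_self_mul_conjTranspose B
  suffices h : ((stdNormal κ).map (fun w => m + B *ᵥ w)).map (WithLp.toLp 2) =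
      multivariateGaussian (WithLp.toLp 2 m) (B * Bᵀ) by
    rw [← h, Measure.map_map (by fun_prop) (by fun_prop)]
    simp [Function.comp_def]
  apply Measure.ext_of_charFun (E := EuclideanSpace ℝ ι)
  ext t
  rw [charFun_multivariateGaussian hpsd, Measure.map_map (by fun_prop) hm, charFun_apply,
    integral_map (by fun_prop) (by fun_prop)]
  have h1 : ∀ w : κ → ℝ, Complex.exp ((inner ℝ ((WithLp.toLp 2 ∘ fun w => m + B *ᵥ w) w) t : ℝ) * Complex.I)
      = Complex.exp ((inner ℝ t (WithLp.toLp 2 m) : ℝ) * Complex.I) *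
        Complex.exp ((inner ℝ (WithLp.toLp 2 w) (WithLp.toLp 2 (Bᵀ *ᵥ t.ofLp)) : ℝ) * Complex.I) := by
    intro w
    rw [← Complex.exp_add, ← add_mul, ← Complex.ofReal_add]
    congr 3
    simp only [Function.comp, EuclideanSpace.inner_eq_star_dotProduct, star_trivial]
    rw [dotProduct_add, dotProduct_comm m, dotProduct_comm t.ofLp (B *ᵥ w), mulVec_transpose,
      ← dotProduct_mulVec, dotProduct_comm]
    rw [dotProduct_comm t.ofLp (B *ᵥ w)]
  simp_rw [h1]
  rw [integral_const_mul]
  have h2 := charFun_stdGaussian (E := EuclideanSpace ℝ κ) (WithLp.toLp 2 (Bᵀ *ᵥ t.ofLp))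
  rw [← map_pi_eq_stdGaussian, charFun_apply, integral_map (by fun_prop) (by fun_prop)] at h2
  rw [stdNormal, h2, ← Complex.exp_add]
  congr 1
  have h3 : ‖WithLp.toLp 2 (Bᵀ *ᵥ t.ofLp)‖ ^ 2 = t.ofLp ⬝ᵥ (B * Bᵀ) *ᵥ t.ofLp := by
    rw [EuclideanSpace.real_norm_sq_eq, ← mulVec_mulVec, dotProduct_mulVec, ← mulVec_transpose]
    simp [dotProduct, pow_two]
  rw [← Complex.ofReal_pow, h3]
  push_cast
  ring

theorem exists_mul_transpose_eq [DecidableEq ι] {S : Matrix ι ι ℝ} (hS : S.PosSemidef) :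
    ∃ B : Matrix ι ι ℝ, B * Bᵀ = S := by
  open scoped MatrixOrder in
  refine ⟨CFC.sqrt S, ?_⟩
  have h : (CFC.sqrt S)ᵀ = CFC.sqrt S := by
    have h := (CFC.sqrt_nonneg S).isSelfAdjoint.star_eq
    rwa [star_eq_conjTranspose, conjTranspose_eq_transpose_of_trivial] at h
  rw [h, CFC.sqrt_mul_sqrt_self _ hS.nonneg]

end Gaussian

theorem measurable_const_add_mulVec {ι κ : Type*} [Fintype κ] (A : Matrix ι κ ℝ) (b : ι → ℝ) :
    Measurable fun w : κ → ℝ => b + A *ᵥ w := by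
  refine measurable_pi_lambda _ fun i => ?_
  simp only [Pi.add_apply, mulVec, dotProduct]
  fun_prop

/-! ### Conditioning a Gaussian vector on its values at a design -/

section Split

variable {ι F : Type*} [Fintype ι]

theorem measurePreserving_stdNormal_sum_unit :
    MeasurePreserving (fun w : ι ⊕ Unit → ℝ => (fun i => w (Sum.inl i), w (Sum.inr ())))
      (stdNormal (ι ⊕ Unit)) ((stdNormal ι).prod (gaussianReal 0 1)) := by
  have h1 := measurePreserving_sumPiEquivProdPi (X := fun _ : ι ⊕ Unit => ℝ)
    (fun _ => gaussianReal 0 1)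
  have h2 := measurePreserving_funUnique (gaussianReal 0 1) Unit
  have h3 := (MeasurePreserving.id (stdNormal ι)).prod h2
  exact h3.comp h1

-- The difference of the two sides is the only entry of a Schur complement in a positive
-- semidefinite matrix. It is the kriging variance, so its square root below is meaningful.
open scoped Classical in
theorem posSemidef_krigReduction_le {S : Matrix F F ℝ} (hS : S.PosSemidef) (e : ι → F) (x : F)
    (hR : (S.submatrix e e).PosDef) :
    krigReduction (S.submatrix e e) (fun i => S (e i) x) ≤ S x x := by
  have h1 := hS.submatrix (Sum.elim e (fun _ : Unit => x))
  have h2 : S.submatrix (Sum.elim e (fun _ : Unit => x)) (Sum.elim e (fun _ : Unit => x)) =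
      fromBlocks (S.submatrix e e) (replicateCol Unit fun i => S (e i) x)
        (replicateCol Unit fun i => S (e i) x)ᴴ (Matrix.of fun _ _ => S x x) := by
    ext (i | i) (j | j)
    · rfl
    · rfl
    · have := hS.isHermitian.apply x (e j)
      simpa using this.symm
    · rfl
  rw [h2] at h1
  have : Invertible (S.submatrix e e) := hR.isUnit.invertible
  have h3 := ((PosDef.fromBlocks₁₁ _ _ hR).1 h1).diag_nonneg (i := ())
  rw [krigReduction]
  have h4 : ((replicateCol Unit fun i => S (e i) x)ᴴ * (S.submatrix e e)⁻¹ *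
      replicateCol Unit fun i => S (e i) x) () () =
      (fun i => S (e i) x) ⬝ᵥ ((S.submatrix e e)⁻¹ *ᵥ fun i => S (e i) x) := by
    rw [dotProduct_mulVec]
    simp [Matrix.mul_apply, dotProduct, vecMul]
  simp only [Matrix.sub_apply, h4] at h3
  simpa using h3

open scoped Classical in
/-- Kriging: the joint law of a Gaussian vector on a design and of its value at another point,
in terms of independent standard normal variables. -/
theorem map_multivariateGaussian_split [Fintype F] [DecidableEq F] {S : Matrix F F ℝ} (hS : S.PosSemidef) (m : F → ℝ)
    (e : ι → F) (x : F) {L : Matrix ι ι ℝ} (hR : (S.submatrix e e).PosDef)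
    (hL : L * Lᵀ = S.submatrix e e) {v : ℝ} (hv : 0 < v) :
    ((multivariateGaussian (WithLp.toLp 2 m) (v • S)).map WithLp.ofLp).map
        (fun δ => (fun i => δ (e i), δ x)) =
      ((stdNormal ι).prod (gaussianReal 0 1)).map (fun p =>
        ((fun i => m (e i)) + √v • L *ᵥ p.1,
          m x + (fun i => S (e i) x) ⬝ᵥ ((S.submatrix e e)⁻¹ *ᵥ (√v • L *ᵥ p.1)) +
            √v * √(S x x - krigReduction (S.submatrix e e) (fun i => S (e i) x)) * p.2)) := by
  set R := S.submatrix e e with hRdef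
  set r : ι → ℝ := fun i => S (e i) x with hr
  set c : ℝ := S x x - krigReduction R r with hc
  have hc0 : 0 ≤ c := sub_nonneg.2 (posSemidef_krigReduction_le hS e x hR)
  have hRu : IsUnit R.det := hR.det_pos.ne'.isUnit
  have hRT : Rᵀ = R := by
    simpa using hR.isHermitian.eq
  -- The vector of simple kriging weights.
  set a : ι → ℝ := R⁻¹ *ᵥ r with ha
  have hRa : R *ᵥ a = r := by
    rw [ha, mulVec_mulVec, Matrix.mul_nonsing_inv _ hRu, one_mulVec]
  have hasym : ∀ z, r ⬝ᵥ (R⁻¹ *ᵥ z) = a ⬝ᵥ z := fun z => by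
    rw [dotProduct_mulVec, ← mulVec_transpose, transpose_nonsing_inv, hRT]
  have hred : krigReduction R r = a ⬝ᵥ r := by rw [krigReduction, hasym]
  obtain ⟨B, hB⟩ := exists_mul_transpose_eq (hS.smul hv.le)
  let E : ι ⊕ Unit → F := Sum.elim e (fun _ => x)
  -- A block triangular factor of the covariance: the upper rows generate the design values, the
  -- last row adds to their kriging combination an independent error of variance `v * c`.
  let B' : Matrix (ι ⊕ Unit) (ι ⊕ Unit) ℝ :=
    fromBlocks (√v • L) 0 (√v • replicateRow Unit (a ᵥ* L)) (Matrix.of fun _ _ => √v * √c)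
  have hvv : √v * √v = v := Real.mul_self_sqrt hv.le
  have hB' : B' * B'ᵀ = (v • S).submatrix E E := by
    simp only [B', fromBlocks_transpose, fromBlocks_multiply, transpose_smul, smul_mul_smul_comm,
      hvv, hL]
    have h1 : ∀ i, (L * (replicateRow Unit (a ᵥ* L))ᵀ) i () = r i := fun i => by
      rw [← hRa, ← hL, ← mulVec_mulVec, mulVec_transpose]
      simp [Matrix.mul_apply, mulVec, dotProduct]
    ext (i | i) (j | j)
    · simp [E, R]
    · have := h1 i
      simp only [transpose_replicateRow] at this
      simp [E, this, r, ← mul_assoc, hvv]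
    · have h2 : (replicateRow Unit (a ᵥ* L) * Lᵀ) i j = r j := by
        rw [← h1 j]
        simp [Matrix.mul_apply, mul_comm]
      have h3 : S x (e j) = S (e j) x := by simpa using (hS.isHermitian.apply x (e j)).symm
      simp [E, h2, h3, r, ← mul_assoc, hvv]
    · have h2 : (replicateRow Unit (a ᵥ* L) * (replicateRow Unit (a ᵥ* L))ᵀ) i j = a ⬝ᵥ r := by
        have : (a ᵥ* L) ⬝ᵥ (a ᵥ* L) = a ⬝ᵥ r := by
          rw [← hRa, ← hL, ← dotProduct_mulVec, ← mulVec_mulVec, mulVec_transpose]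
        rw [← this]
        simp [Matrix.mul_apply, dotProduct]
      have h3 : ((Matrix.of fun _ _ => √v * √c : Matrix Unit Unit ℝ) *
          (Matrix.of fun _ _ => √v * √c : Matrix Unit Unit ℝ)ᵀ) i j = v * c := by
        simp only [Matrix.mul_apply, Matrix.of_apply, Matrix.transpose_apply, Finset.univ_unique,
          Finset.sum_singleton]
        rw [mul_mul_mul_comm, hvv, Real.mul_self_sqrt hc0]
      rw [transpose_replicateRow] at h2
      simp only [fromBlocks_apply₂₂, Matrix.add_apply, h3, Matrix.submatrix_apply, E, Sum.elim_inr,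
        transpose_replicateRow, Matrix.smul_apply, smul_eq_mul, Matrix.smul_mul, Matrix.mul_smul,
        h2]
      rw [← mul_assoc, hvv, hc, hred]
      ring
  let sp : (ι ⊕ Unit → ℝ) → (ι → ℝ) × ℝ := fun w => (fun i => w (Sum.inl i), w (Sum.inr ()))
  have hsp : Measurable sp := by fun_prop
  -- Both factors have the same product with their transpose, which determines the law. The
  -- covariance here may be singular, for instance when `x` is a design point, so densities could
  -- not be compared.
  have key : (stdNormal F).map (fun w => m ∘ E + (B.submatrix E id) *ᵥ w) =
      (stdNormal (ι ⊕ Unit)).map (fun w => m ∘ E + B' *ᵥ w) := by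
    rw [map_stdNormal_eq_multivariateGaussian, map_stdNormal_eq_multivariateGaussian, hB', ← hB]
    congr 2
  have h1 := map_stdNormal_eq_multivariateGaussian B m
  rw [hB] at h1
  rw [← h1, ← measurePreserving_stdNormal_sum_unit.map_eq,
    Measure.map_map (by fun_prop) (measurable_const_add_mulVec _ _),
    Measure.map_map ?_ measurePreserving_stdNormal_sum_unit.measurable]
  · have h2 := congrArg (Measure.map sp) key
    rw [Measure.map_map hsp (measurable_const_add_mulVec _ _), Measure.map_map hsp (measurable_const_add_mulVec _ _)] at h2
    refine Eq.trans ?_ (h2.trans ?_)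
    · congr 1
    · congr 1
      ext w : 1
      refine Prod.ext ?_ ?_
      · ext i
        simp [sp, B', E, mulVec, dotProduct, Finset.mul_sum, mul_assoc]
      · simp only [sp, B', E, Function.comp, hasym]
        have : a ⬝ᵥ (√v • (L *ᵥ fun i => w (Sum.inl i))) =
            √v * ((a ᵥ* L) ⬝ᵥ fun i => w (Sum.inl i)) := by
          rw [dotProduct_smul, dotProduct_mulVec, smul_eq_mul]
        rw [this]
        simp [mulVec, dotProduct, Finset.mul_sum, mul_assoc, add_assoc]
  · refine Measurable.prodMk ?_ ?_
    · simp only [← smul_mulVec]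
      exact (measurable_const_add_mulVec (√v • L) _).comp measurable_fst
    · simp only [mulVec, dotProduct]
      fun_prop

end Split

/-! ### Autoregression -/

/-- The autoregression `arField` at a single input. -/
def arSeq {s : ℕ} (γ : Fin s → ℝ) (z : Fin (s + 1) → ℝ) (t : Fin (s + 1)) : ℝ :=
  arField γ (fun t (_ : Unit) => z t) t ()

theorem arField_succ {ι : Type*} {s : ℕ} (γ : Fin s → ℝ) (δ : Fin (s + 1) → ι → ℝ) (t : Fin s)
    (x : ι) : arField γ δ t.succ x = γ t * arField γ δ t.castSucc x + δ t.succ x := rfl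

theorem arSeq_zero {s : ℕ} (γ : Fin s → ℝ) (z : Fin (s + 1) → ℝ) : arSeq γ z 0 = z 0 := rfl

theorem arSeq_succ {s : ℕ} (γ : Fin s → ℝ) (z : Fin (s + 1) → ℝ) (t : Fin s) :
    arSeq γ z t.succ = γ t * arSeq γ z t.castSucc + z t.succ := rfl

theorem arField_apply {ι : Type*} {s : ℕ} (γ : Fin s → ℝ) (δ : Fin (s + 1) → ι → ℝ)
    (t : Fin (s + 1)) (x : ι) : arField γ δ t x = arSeq γ (fun t => δ t x) t := by
  induction t using Fin.induction with
  | zero => rfl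
  | succ t ih => rw [arField_succ, arSeq_succ, ih]

theorem continuous_arSeq_apply {s : ℕ} (t : Fin (s + 1)) :
    Continuous fun p : (Fin s → ℝ) × (Fin (s + 1) → ℝ) => arSeq p.1 p.2 t := by
  induction t using Fin.induction with
  | zero => simp only [arSeq_zero]; fun_prop
  | succ t ih => simp only [arSeq_succ]; fun_prop

theorem continuous_arSeq {s : ℕ} :
    Continuous fun p : (Fin s → ℝ) × (Fin (s + 1) → ℝ) => arSeq p.1 p.2 :=
  continuous_pi continuous_arSeq_apply

theorem measurable_arSeq {s : ℕ} (γ : Fin s → ℝ) : Measurable (arSeq γ) :=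
  (continuous_arSeq.comp (Continuous.prodMk_right γ)).measurable

theorem measurable_arField {ι : Type*} {s : ℕ} (γ : Fin s → ℝ) :
    Measurable (arField (ι := ι) γ) := by
  refine measurable_pi_lambda _ fun t => measurable_pi_lambda _ fun x => ?_
  simp only [arField_apply]
  have h : Measurable fun (δ : Fin (s + 1) → ι → ℝ) t => δ t x := by fun_prop
  exact (measurable_pi_apply t).comp ((measurable_arSeq γ).comp h)

/-! ### Recovering the discrepancies from the data -/

namespace CokrigingDesign

variable {𝒳 : Type*} {s : ℕ} (D : CokrigingDesign 𝒳 s)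

/-- The part `γ_t W_t` of the output of level `t + 1` that is explained by level `t`. -/
def shift (γ : Fin s → ℝ) : D.Data →ₗ[ℝ] D.Data :=
  LinearMap.pi fun t => Fin.cases (motive := fun t => D.Data →ₗ[ℝ] (D.pts t → ℝ)) 0
    (fun t =>
      { toFun := fun y => γ t • D.W y t
        map_add' := fun y y' => smul_add _ (D.W y t) (D.W y' t)
        map_smul' := fun c y => smul_comm (γ t) c (D.W y t) }) t

theorem shift_zero (γ : Fin s → ℝ) (y : D.Data) : D.shift γ y 0 = 0 := rfl

theorem shift_succ (γ : Fin s → ℝ) (y : D.Data) (t : Fin s) :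
    D.shift γ y t.succ = γ t • D.W y t := rfl

/-- Each application reads only the level below and returns zero at level `0`, so the zeros climb
one level at a time. -/
theorem shift_pow_apply (γ : Fin s → ℝ) (k : ℕ) (y : D.Data) (t : Fin (s + 1)) (ht : t.val < k) :
    (D.shift γ ^ k) y t = 0 := by
  induction k generalizing t with
  | zero => omega
  | succ k ih =>
    rw [pow_succ', Module.End.mul_apply]
    cases t using Fin.cases with
    | zero => rfl
    | succ t =>
      rw [shift_succ]
      ext x
      have := ih t.castSucc (by simp at ht ⊢; omega)
      simp [W, this]

theorem isNilpotent_shift (γ : Fin s → ℝ) : IsNilpotent (D.shift γ) :=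
  ⟨s + 1, LinearMap.ext fun y => funext fun t => D.shift_pow_apply γ _ y t t.isLt⟩

/-- From the output `y`, the output of the discrepancies `δ` at the design. -/
def detrend (γ : Fin s → ℝ) : D.Data →ₗ[ℝ] D.Data := 1 - D.shift γ

theorem detrend_zero (γ : Fin s → ℝ) (y : D.Data) : D.detrend γ y 0 = y 0 :=
  sub_zero (y 0)

theorem detrend_succ (γ : Fin s → ℝ) (y : D.Data) (t : Fin s) :
    D.detrend γ y t.succ = y t.succ - γ t • D.W y t := rfl

/-- A nilpotent map has characteristic polynomial `X ^ d`; its value at `1` is the determinant of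
the identity minus the map. Hence no Jacobian appears in the likelihood. -/
theorem det_detrend (γ : Fin s → ℝ) : LinearMap.det (D.detrend γ) = 1 := by
  have h := LinearMap.eval_charpoly (D.shift γ) 1
  rw [(D.isNilpotent_shift γ).charpoly_eq_X_pow_finrank] at h
  simpa [detrend] using h.symm

/-- `detrend` as an equivalence. -/
noncomputable def detrendEquiv (γ : Fin s → ℝ) : D.Data ≃L[ℝ] D.Data :=
  (LinearEquiv.ofIsUnitDet (f := D.detrend γ) (v := Module.finBasis ℝ D.Data)
    (v' := Module.finBasis ℝ D.Data)
    (by rw [LinearMap.det_toMatrix, det_detrend]; exact isUnit_one)).toContinuousLinearEquiv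

theorem detrendEquiv_apply (γ : Fin s → ℝ) (y : D.Data) : D.detrendEquiv γ y = D.detrend γ y := rfl

theorem map_detrendEquiv_symm_volume (γ : Fin s → ℝ) :
    (volume : Measure D.Data).map (D.detrendEquiv γ).symm = volume := by
  have h1 : (volume : Measure D.Data).map (D.detrendEquiv γ) = volume := by
    have := Measure.map_linearMap_addHaar_eq_smul_addHaar (volume : Measure D.Data)
      (f := D.detrend γ) (by rw [det_detrend]; exact one_ne_zero)
    rw [det_detrend] at this
    simp only [inv_one, abs_one, ENNReal.ofReal_one, one_smul] at this
    exact this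
  conv_lhs => rw [← h1]
  rw [Measure.map_map (D.detrendEquiv γ).symm.continuous.measurable
    (D.detrendEquiv γ).continuous.measurable]
  simp [Function.comp_def]

theorem measurable_observe (x₀ : 𝒳) : Measurable (D.observe x₀) :=
  Measurable.prodMk
    (measurable_pi_lambda _ fun t => measurable_pi_lambda _ fun _ =>
      (measurable_pi_apply _).comp (measurable_pi_apply t))
    (measurable_pi_lambda _ fun t => (measurable_pi_apply _).comp (measurable_pi_apply t))

theorem detrend_observe_arField (x₀ : 𝒳) (γ : Fin s → ℝ)
    (δ : Fin (s + 1) → D.allPts x₀ → ℝ) :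
    D.detrend γ (D.observe x₀ (arField γ δ)).1 =
      fun t x => δ t ⟨x.1, D.mem_allPts x₀ x.2⟩ := by
  ext t x
  cases t using Fin.cases with
  | zero => rw [detrend_zero]; rfl
  | succ t =>
    rw [detrend_succ]
    simp [observe, W, arField_succ]

end CokrigingDesign

/-- Transfer of a product measure when each factor is a law of a pair `(d, z)` where `z` is a function of
`d` and of an independent variable. -/
theorem map_pi_of_split {T : Type*} [Fintype T] {A B B' : T → Type*} {Y Z : Type*}
    [∀ t, MeasurableSpace (A t)] [∀ t, MeasurableSpace (B t)] [∀ t, MeasurableSpace (B' t)]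
    [MeasurableSpace Y] [MeasurableSpace Z]
    (μ : ∀ t, Measure (A t)) [∀ t, IsProbabilityMeasure (μ t)]
    (σ : ∀ t, Measure (B t)) [∀ t, IsProbabilityMeasure (σ t)]
    (ν : Measure ℝ) [IsProbabilityMeasure ν]
    {split : ∀ t, A t → B' t × ℝ} (hsplit : ∀ t, Measurable (split t))
    {dv : ∀ t, B t → B' t} (hdv : ∀ t, Measurable (dv t))
    {cv : ∀ t, B' t → ℝ → ℝ} (hcv : ∀ t, Measurable fun p : B' t × ℝ => cv t p.1 p.2)
    (h : ∀ t, (μ t).map (split t) =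
      ((σ t).prod ν).map (fun p => (dv t p.1, cv t (dv t p.1) p.2)))
    {Einv : (∀ t, B' t) → Y} (hEinv : Measurable Einv) {E : Y → ∀ t, B' t} (hE : Measurable E)
    (hEE : ∀ d, E (Einv d) = d) {ar : (T → ℝ) → Z} (har : Measurable ar)
    {obs : (∀ t, A t) → Y × Z}
    (hobs : ∀ δ, obs δ = (Einv fun t => (split t (δ t)).1, ar fun t => (split t (δ t)).2)) :
    (Measure.pi μ).map obs =
      (((Measure.pi σ).map (fun w => Einv (fun t => dv t (w t)))).prod
        (Measure.pi fun _ : T => ν)).map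
        (fun p => (p.1, ar (fun t => cv t (E p.1 t) (p.2 t)))) := by
  let lev : ∀ t, B t × ℝ → B' t × ℝ := fun t p => (dv t p.1, cv t (dv t p.1) p.2)
  have hlev : ∀ t, Measurable (lev t) := fun t =>
    ((hdv t).comp measurable_fst).prodMk
      ((hcv t).comp (((hdv t).comp measurable_fst).prodMk measurable_snd))
  let Ψ : (∀ t, B' t × ℝ) → Y × Z := fun z => (Einv fun t => (z t).1, ar fun t => (z t).2)
  have hΨ : Measurable Ψ :=
    (hEinv.comp (measurable_pi_lambda _ fun t => (measurable_pi_apply t).fst)).prodMk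
      (har.comp (measurable_pi_lambda _ fun t => (measurable_pi_apply t).snd))
  have hsp : Measurable fun (δ : ∀ t, A t) t => split t (δ t) :=
    measurable_pi_lambda _ fun t => (hsplit t).comp (measurable_pi_apply t)
  have hlevpi : Measurable fun (p : ∀ t, B t × ℝ) t => lev t (p t) :=
    measurable_pi_lambda _ fun t => (hlev t).comp (measurable_pi_apply t)
  have hobs' : obs = Ψ ∘ fun δ t => split t (δ t) := funext hobs
  have hpr1 : ∀ t, IsProbabilityMeasure ((μ t).map (split t)) := fun t =>
    Measure.isProbabilityMeasure_map (hsplit t).aemeasurable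
  have hpr2 : ∀ t, IsProbabilityMeasure (((σ t).prod ν).map (lev t)) := fun t =>
    Measure.isProbabilityMeasure_map (hlev t).aemeasurable
  have h' : ∀ t, (μ t).map (split t) = ((σ t).prod ν).map (lev t) := h
  have hdpi : Measurable fun (w : ∀ t, B t) t => dv t (w t) :=
    measurable_pi_lambda _ fun t => (hdv t).comp (measurable_pi_apply t)
  have hG : Measurable fun p : Y × (T → ℝ) => (p.1, ar (fun t => cv t (E p.1 t) (p.2 t))) := by
    refine measurable_fst.prodMk (har.comp (measurable_pi_lambda _ fun t => ?_))
    exact (hcv t).comp ((measurable_pi_iff.1 (hE.comp measurable_fst) t).prodMk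
      ((measurable_pi_apply t).comp measurable_snd))
  have hEd : Measurable fun w : ∀ t, B t => Einv (fun t => dv t (w t)) := hEinv.comp hdpi
  -- Everything observed is a function of the splits of the separate levels, so the product measure
  -- may be replaced by the product of the laws of these splits, and each of those by its
  -- representation with independent noise.
  rw [hobs', ← Measure.map_map hΨ hsp, Measure.pi_map_pi fun t => (hsplit t).aemeasurable]
  simp_rw [h']
  rw [← Measure.pi_map_pi fun t => (hlev t).aemeasurable, Measure.map_map hΨ hlevpi]
  have hid : (Measure.pi fun _ : T => ν) = (Measure.pi fun _ : T => ν).map id :=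
    Measure.map_id.symm
  rw [hid, Measure.map_prod_map _ _ hEd measurable_id, ← map_unzipPi,
    Measure.map_map (hEd.prodMap measurable_id) measurable_unzipPi,
    Measure.map_map hG ((hEd.prodMap measurable_id).comp measurable_unzipPi)]
  congr 1
  ext p : 1
  refine Prod.ext rfl ?_
  simp only [Function.comp, Ψ, lev, unzipPi, Prod.map, id, hEE]

/-- The regression on the correlations `r₀` of the vector `z`. -/
noncomputable def krigWeighted {ι : Type*} [Fintype ι] (R : Matrix ι ι ℝ) (r₀ z : ι → ℝ) : ℝ :=
  open scoped Classical in r₀ ⬝ᵥ (R⁻¹ *ᵥ z)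

theorem measurable_krigWeighted {ι : Type*} [Fintype ι] (R : Matrix ι ι ℝ) (r₀ : ι → ℝ) :
    Measurable (krigWeighted R r₀) := by
  unfold krigWeighted
  simp only [mulVec, dotProduct]
  fun_prop

/-! ### Likelihood and conditional law at fixed parameters -/

namespace CokrigingModel

variable {𝒳 : Type*} {s : ℕ} {D : CokrigingDesign 𝒳 s} (M : CokrigingModel D)

/-- The value of `δ_t` at `x₀`, given its values `d` at the design, in terms of a standard normal
variable `ξ`. -/
noncomputable def condVal (x₀ : 𝒳) (θ : D.Param) (t : Fin (s + 1)) (d : D.pts t → ℝ) (ξ : ℝ) : ℝ :=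
  M.h t x₀ ⬝ᵥ θ.1 t + krigWeighted (M.R t) (M.rvec x₀ t) (d - M.H t *ᵥ θ.1 t) +
    √(θ.2.2 t) * √(M.r t x₀ x₀ - krigReduction (M.R t) (M.rvec x₀ t)) * ξ

/-- The values of `δ_t` at the design, in terms of standard normal variables `w`. -/
noncomputable def designVal (θ : D.Param) (t : Fin (s + 1)) (L : Matrix (D.pts t) (D.pts t) ℝ)
    (w : D.pts t → ℝ) : D.pts t → ℝ :=
  M.H t *ᵥ θ.1 t + √(θ.2.2 t) • L *ᵥ w

theorem measurable_designVal (θ : D.Param) (t : Fin (s + 1)) (L : Matrix (D.pts t) (D.pts t) ℝ) :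
    Measurable (M.designVal θ t L) := by
  unfold designVal
  simp only [← smul_mulVec]
  exact measurable_const_add_mulVec (√(θ.2.2 t) • L) _

theorem measurable_condVal (x₀ : 𝒳) (θ : D.Param) (t : Fin (s + 1)) {α : Type*}
    [MeasurableSpace α] {f : α → D.pts t → ℝ} {g : α → ℝ} (hf : Measurable f) (hg : Measurable g) :
    Measurable fun a => M.condVal x₀ θ t (f a) (g a) := by
  have h : ∀ x, Measurable fun a => f a x := fun x => measurable_pi_iff.1 hf x
  simp only [condVal, krigWeighted, mulVec, dotProduct, Pi.sub_apply]
  fun_prop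

theorem map_gpLaw_split (x₀ : 𝒳) {θ : D.Param} {t : Fin (s + 1)} (hθ : 0 < θ.2.2 t)
    (hR : (M.R t).PosDef) {L : Matrix (D.pts t) (D.pts t) ℝ} (hL : L * Lᵀ = M.R t) :
    (M.gpLaw (D.allPts x₀) θ t).map
        (fun δ => ((fun x : D.pts t => δ ⟨x.1, D.mem_allPts x₀ x.2⟩),
          δ ⟨x₀, D.mem_allPts_self x₀⟩)) =
      ((stdNormal (D.pts t)).prod (gaussianReal 0 1)).map (fun p =>
        (M.designVal θ t L p.1, M.condVal x₀ θ t (M.designVal θ t L p.1) p.2)) := by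
  classical
  have hS := (M.isCorrelation t).posSemidef (D.allPts x₀)
  have := map_multivariateGaussian_split hS (fun x => M.h t x ⬝ᵥ θ.1 t)
    (fun x : D.pts t => (⟨x.1, D.mem_allPts x₀ x.2⟩ : D.allPts x₀)) ⟨x₀, D.mem_allPts_self x₀⟩
    (L := L) hR hL hθ
  simp only [condVal, designVal, add_sub_cancel_left]
  refine Eq.trans ?_ (this.trans ?_)
  · rw [gpLaw]
  · rfl

/-- In the coordinates of the discrepancies the density is a product over the levels; it is
transported to the data by the volume-preserving inverse of `detrend`. -/
theorem map_pi_stdNormal_eq_withDensity {θ : D.Param} (hθ : ∀ t, 0 < θ.2.2 t)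
    (hR : ∀ t, (M.R t).PosDef) {L : ∀ t, Matrix (D.pts t) (D.pts t) ℝ}
    (hL : ∀ t, L t * (L t)ᵀ = M.R t) :
    (Measure.pi fun t => stdNormal (D.pts t)).map (fun w => (D.detrendEquiv θ.2.1).symm
        (fun t => M.designVal θ t (L t) (w t))) =
      volume.withDensity (fun y : D.Data => ∏ t, ENNReal.ofReal
        (gaussDensity (L t) (M.R t) (θ.2.2 t) (D.detrend θ.2.1 y t - M.H t *ᵥ θ.1 t))) := by
  have hm := fun t => M.measurable_designVal θ t (L t)
  have hd : ∀ t, Measurable fun x : D.pts t → ℝ =>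
      ENNReal.ofReal (gaussDensity (L t) (M.R t) (θ.2.2 t) (x - M.H t *ᵥ θ.1 t)) := fun t =>
    ENNReal.measurable_ofReal.comp
      ((continuous_gaussDensity _ _ _).comp (continuous_id.sub continuous_const)).measurable
  have h1 := fun t => map_stdNormal_smul_eq_withDensity (hR t) (hL t) (M.H t *ᵥ θ.1 t) (hθ t)
  have hsf : ∀ t, IsProbabilityMeasure ((stdNormal (D.pts t)).map
      (M.designVal θ t (L t))) := fun t =>
    Measure.isProbabilityMeasure_map (hm t).aemeasurable
  have hsf' : ∀ t, SigmaFinite ((volume : Measure (D.pts t → ℝ)).withDensity (fun x =>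
      ENNReal.ofReal (gaussDensity (L t) (M.R t) (θ.2.2 t) (x - M.H t *ᵥ θ.1 t)))) := fun t => by
    have h := hsf t
    rw [← h1 t]
    unfold designVal at h
    infer_instance
  have h2 : (Measure.pi fun t => stdNormal (D.pts t)).map
        (fun w t => M.designVal θ t (L t) (w t)) =
      volume.withDensity (fun d : D.Data => ∏ t, ENNReal.ofReal
        (gaussDensity (L t) (M.R t) (θ.2.2 t) (d t - M.H t *ᵥ θ.1 t))) := by
    rw [Measure.pi_map_pi fun t => (hm t).aemeasurable]
    have h1' : ∀ t, (stdNormal (D.pts t)).map (M.designVal θ t (L t)) = _ := h1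
    simp_rw [h1']
    exact pi_withDensity hd
  have hprod : Measurable fun y : D.Data => ∏ t, ENNReal.ofReal
      (gaussDensity (L t) (M.R t) (θ.2.2 t) (y t - M.H t *ᵥ θ.1 t)) :=
    Finset.measurable_prod _ fun t _ => (hd t).comp (measurable_pi_apply t)
  have hE := (D.detrendEquiv θ.2.1).symm.continuous.measurable
  have h3 := withDensity_map (μ := (volume : Measure D.Data)) hE
    (hprod.comp (D.detrendEquiv θ.2.1).continuous.measurable)
  simp only [Function.comp_def, ContinuousLinearEquiv.apply_symm_apply] at h3
  rw [D.map_detrendEquiv_symm_volume, ← h2, Measure.map_map hE] at h3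
  · exact h3.symm
  · exact measurable_pi_lambda _ fun t => (hm t).comp (measurable_pi_apply t)

theorem measurable_designData {θ : D.Param} (L : ∀ t, Matrix (D.pts t) (D.pts t) ℝ) :
    Measurable fun w : D.Data =>
      (D.detrendEquiv θ.2.1).symm (fun t => M.designVal θ t (L t) (w t)) :=
  (D.detrendEquiv θ.2.1).symm.continuous.measurable.comp (measurable_pi_lambda _ fun t =>
    (M.measurable_designVal θ t (L t)).comp (measurable_pi_apply t))

theorem measurable_arSeq_condVal (x₀ : 𝒳) (θ : D.Param) :
    Measurable fun p : D.Data × (Fin (s + 1) → ℝ) =>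
      arSeq θ.2.1 (fun t => M.condVal x₀ θ t (D.detrendEquiv θ.2.1 p.1 t) (p.2 t)) := by
  refine (measurable_arSeq θ.2.1).comp (measurable_pi_lambda _ fun t => ?_)
  exact M.measurable_condVal x₀ θ t (measurable_pi_iff.1
    ((D.detrendEquiv θ.2.1).continuous.measurable.comp measurable_fst) t)
    (measurable_pi_iff.1 measurable_snd t)

/-- Brings the joint law to the form "data, and a function of data and independent noise" to which
`contCondLaw_map_prod` applies. -/
theorem jointLaw_eq (x₀ : 𝒳) {θ : D.Param} (hθ : ∀ t, 0 < θ.2.2 t)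
    (hR : ∀ t, (M.R t).PosDef) {L : ∀ t, Matrix (D.pts t) (D.pts t) ℝ}
    (hL : ∀ t, L t * (L t)ᵀ = M.R t) :
    M.jointLaw x₀ θ = (((Measure.pi fun t => stdNormal (D.pts t)).map
        (fun w => (D.detrendEquiv θ.2.1).symm (fun t => M.designVal θ t (L t) (w t)))).prod
      (stdNormal (Fin (s + 1)))).map
      (fun p => (p.1, arSeq θ.2.1 (fun t =>
        M.condVal x₀ θ t (D.detrendEquiv θ.2.1 p.1 t) (p.2 t)))) := by
  have hprob : ∀ t, IsProbabilityMeasure (M.gpLaw (D.allPts x₀) θ t) := fun t => by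
    rw [gpLaw]
    exact Measure.isProbabilityMeasure_map (by fun_prop)
  rw [jointLaw, fieldLaw, Measure.map_map (D.measurable_observe x₀) (measurable_arField θ.2.1)]
  refine map_pi_of_split (M.gpLaw (D.allPts x₀) θ) (fun t => stdNormal (D.pts t))
    (gaussianReal 0 1) (fun t => by exact Measurable.prodMk (by fun_prop) (by fun_prop))
    (fun t => M.measurable_designVal θ t (L t))
    (fun t => M.measurable_condVal x₀ θ t measurable_fst measurable_snd)
    (fun t => M.map_gpLaw_split x₀ (hθ t) (hR t) (hL t))
    (D.detrendEquiv θ.2.1).symm.continuous.measurable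
    (D.detrendEquiv θ.2.1).continuous.measurable
    (fun d => (D.detrendEquiv θ.2.1).apply_symm_apply d) (measurable_arSeq θ.2.1) fun δ => ?_
  refine Prod.ext ?_ ?_
  · refine ((D.detrendEquiv θ.2.1).symm_apply_eq.2 ?_).symm
    rw [D.detrendEquiv_apply]
    exact (D.detrend_observe_arField x₀ θ.2.1 δ).symm
  · ext t
    exact arField_apply θ.2.1 δ t _

theorem likelihood_eq (x₀ : 𝒳) (y : D.Data) {θ : D.Param} (hθ : ∀ t, 0 < θ.2.2 t)
    (hR : ∀ t, (M.R t).PosDef) {L : ∀ t, Matrix (D.pts t) (D.pts t) ℝ}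
    (hL : ∀ t, L t * (L t)ᵀ = M.R t) :
    (M.likelihood x₀ y θ : ℝ≥0∞) = ∏ t, ENNReal.ofReal
      (gaussDensity (L t) (M.R t) (θ.2.2 t) (D.detrend θ.2.1 y t - M.H t *ᵥ θ.1 t)) := by
  have hm := M.measurable_designData (θ := θ) L
  have hpr := Measure.isProbabilityMeasure_map
    (μ := Measure.pi fun t => stdNormal (D.pts t)) hm.aemeasurable
  have hfst : (M.jointLaw x₀ θ).fst = volume.withDensity (fun y : D.Data =>
      ((∏ t, (gaussDensity (L t) (M.R t) (θ.2.2 t)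
        (D.detrendEquiv θ.2.1 y t - M.H t *ᵥ θ.1 t)).toNNReal : ℝ≥0) : ℝ≥0∞)) := by
    rw [M.jointLaw_eq x₀ hθ hR hL, Measure.fst, Measure.map_map measurable_fst
      (measurable_fst.prodMk (M.measurable_arSeq_condVal x₀ θ))]
    simp only [ENNReal.ofNNReal_finsetProd]
    exact Measure.fst_prod.trans (M.map_pi_stdNormal_eq_withDensity hθ hR hL)
  have hcont : Continuous fun y : D.Data => ∏ t, (gaussDensity (L t) (M.R t) (θ.2.2 t)
        (D.detrendEquiv θ.2.1 y t - M.H t *ᵥ θ.1 t)).toNNReal := by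
    refine continuous_finsetProd _ fun t _ => continuous_real_toNNReal.comp
      ((continuous_gaussDensity _ _ _).comp (Continuous.sub ?_ continuous_const))
    exact (continuous_apply t).comp (D.detrendEquiv θ.2.1).continuous
  rw [likelihood, contDensity_eq hcont hfst, ENNReal.ofNNReal_finsetProd]
  rfl

theorem contCondLaw_jointLaw (x₀ : 𝒳) (y : D.Data) {θ : D.Param} (hθ : ∀ t, 0 < θ.2.2 t)
    (hR : ∀ t, (M.R t).PosDef) {L : ∀ t, Matrix (D.pts t) (D.pts t) ℝ}
    (hL : ∀ t, L t * (L t)ᵀ = M.R t) :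
    contCondLaw (M.jointLaw x₀ θ) y = (stdNormal (Fin (s + 1))).map
      (fun ξ => arSeq θ.2.1 (fun t => M.condVal x₀ θ t (D.detrend θ.2.1 y t) (ξ t))) := by
  have hm := M.measurable_designData (θ := θ) L
  have hpr := Measure.isProbabilityMeasure_map
    (μ := Measure.pi fun t => stdNormal (D.pts t)) hm.aemeasurable
  -- Uniqueness of the continuous conditional law needs the law of the data to charge every open
  -- set; it does, since its density is positive everywhere.
  have hpos : ((Measure.pi fun t => stdNormal (D.pts t)).map (fun w =>
      (D.detrendEquiv θ.2.1).symm (fun t => M.designVal θ t (L t) (w t)))).IsOpenPosMeasure := by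
    refine Measure.AbsolutelyContinuous.isOpenPosMeasure (μ := (volume : Measure D.Data)) ?_
    have h := M.map_pi_stdNormal_eq_withDensity hθ hR hL
    refine Measure.AbsolutelyContinuous.trans ?_ (Measure.absolutelyContinuous_of_eq h.symm)
    refine withDensity_absolutelyContinuous' (Measurable.aemeasurable ?_) (.of_forall fun y => ?_)
    · refine Finset.measurable_prod _ fun t _ => ENNReal.measurable_ofReal.comp
        ((continuous_gaussDensity _ _ _).comp (Continuous.sub ?_ continuous_const)).measurable
      exact (continuous_apply t).comp (D.detrendEquiv θ.2.1).continuous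
    · refine Finset.prod_ne_zero_iff.2 fun t _ => ?_
      rw [ne_eq, ENNReal.ofReal_eq_zero, not_le]
      exact gaussDensity_pos (hR t) (hL t) (hθ t) _
  rw [M.jointLaw_eq x₀ hθ hR hL]
  refine contCondLaw_map_prod _ (stdNormal (Fin (s + 1)))
    (g := fun y ξ => arSeq θ.2.1 (fun t => M.condVal x₀ θ t (D.detrendEquiv θ.2.1 y t) (ξ t)))
    (M.measurable_arSeq_condVal x₀ θ) (fun ξ => ?_) y
  refine Continuous.comp (g := arSeq θ.2.1) (continuous_arSeq.comp (Continuous.prodMk_right θ.2.1))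
    (continuous_pi fun t => ?_)
  have h : Continuous fun y : D.Data => D.detrendEquiv θ.2.1 y t :=
    (continuous_apply t).comp (D.detrendEquiv θ.2.1).continuous
  have h' : ∀ x, Continuous fun y : D.Data => D.detrendEquiv θ.2.1 y t x := fun x =>
    (continuous_apply x).comp h
  simp only [condVal, krigWeighted, mulVec, dotProduct, Pi.sub_apply]
  fun_prop

end CokrigingModel

/-! ### The inverse gamma distribution -/

section InvGamma

open Set Real

/-- The substitution `v ↦ v⁻¹` turns this into Euler's integral for the Gamma function. -/
theorem integral_rpow_neg_mul_exp_neg_div_Ioi {a c : ℝ} (ha : 0 < a) (hc : 0 < c) :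
    ∫ v in Ioi (0 : ℝ), v ^ (-a - 1) * exp (-c / v) = (1 / c) ^ a * Gamma a := by
  rw [← integral_rpow_mul_exp_neg_mul_Ioi ha hc,
    ← integral_comp_rpow_Ioi (fun t => t ^ (a - 1) * exp (-(c * t))) (p := -1) (by norm_num)]
  refine setIntegral_congr_fun measurableSet_Ioi fun v hv => ?_
  have hv' : (0 : ℝ) < v := hv
  simp only [smul_eq_mul]
  rw [← rpow_mul hv'.le, ← mul_assoc, abs_neg, abs_one, one_mul, ← rpow_add hv']
  congr 2
  · ring
  · rw [rpow_neg_one, neg_div, div_eq_mul_inv]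

theorem integrableOn_rpow_neg_mul_exp_neg_div_Ioi {a c : ℝ} (ha : 0 < a) (hc : 0 < c) :
    IntegrableOn (fun v : ℝ => v ^ (-a - 1) * exp (-c / v)) (Ioi 0) := by
  -- The integral of a non-integrable function is zero by convention, whereas the value just
  -- computed is positive.
  by_contra h
  have h1 := integral_rpow_neg_mul_exp_neg_div_Ioi ha hc
  rw [integral_undef h] at h1
  have := Gamma_pos_of_pos ha
  have h2 : 0 < (1 / c) ^ a * Gamma a := by positivity
  exact h2.ne h1

/-- The density of the inverse gamma distribution of shape `a` and scale `c`. -/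
noncomputable def invGammaDensity (a c v : ℝ) : ℝ :=
  ((1 / c) ^ a * Gamma a)⁻¹ * (v ^ (-a - 1) * exp (-c / v))

theorem measurable_invGammaDensity (a c : ℝ) : Measurable (invGammaDensity a c) := by
  unfold invGammaDensity
  fun_prop

theorem invGammaDensity_nonneg {a c v : ℝ} (ha : 0 < a) (hc : 0 < c) (hv : 0 < v) :
    0 ≤ invGammaDensity a c v := by
  have := Gamma_pos_of_pos ha
  unfold invGammaDensity
  positivity

/-- The inverse gamma distribution of shape `a` and scale `c`. -/
noncomputable def invGamma (a c : ℝ) : Measure ℝ :=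
  (volume.restrict (Ioi 0)).withDensity fun v => ENNReal.ofReal (invGammaDensity a c v)

theorem integral_invGamma {a c : ℝ} (ha : 0 < a) (hc : 0 < c) (f : ℝ → ℝ) :
    ∫ v, f v ∂(invGamma a c) = ∫ v in Ioi 0, invGammaDensity a c v * f v := by
  rw [invGamma, integral_withDensity_eq_integral_toReal_smul
    (measurable_invGammaDensity a c).ennreal_ofReal (.of_forall fun _ => ENNReal.ofReal_lt_top)]
  refine setIntegral_congr_fun measurableSet_Ioi fun v hv => ?_
  simp only [smul_eq_mul]
  rw [ENNReal.toReal_ofReal (invGammaDensity_nonneg ha hc hv)]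

theorem isProbabilityMeasure_invGamma {a c : ℝ} (ha : 0 < a) (hc : 0 < c) :
    IsProbabilityMeasure (invGamma a c) := by
  have hG := Gamma_pos_of_pos ha
  refine ⟨?_⟩
  rw [invGamma, withDensity_apply _ MeasurableSet.univ, Measure.restrict_univ,
    ← ofReal_integral_eq_lintegral_ofReal]
  · unfold invGammaDensity
    rw [integral_const_mul, integral_rpow_neg_mul_exp_neg_div_Ioi ha hc, inv_mul_cancel₀,
      ENNReal.ofReal_one]
    positivity
  · exact (integrableOn_rpow_neg_mul_exp_neg_div_Ioi ha hc).const_mul _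
  · filter_upwards [ae_restrict_mem measurableSet_Ioi] with v hv
    exact invGammaDensity_nonneg ha hc hv

theorem ae_pos_invGamma (a c : ℝ) : ∀ᵐ v ∂(invGamma a c), 0 < v :=
  (withDensity_absolutelyContinuous _ _).ae_le (ae_restrict_mem measurableSet_Ioi)

/-- A factor `v` lowers the shape by one, and the constants compare through `Γ(a) = (a - 1) Γ(a -
1)`. The mean of the inverse gamma law then follows from the normalization at shape `a - 1`. -/
theorem invGammaDensity_mul_self {a c v : ℝ} (ha : 1 < a) (hc : 0 < c) (hv : 0 < v) :
    invGammaDensity a c v * v = c / (a - 1) * invGammaDensity (a - 1) c v := by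
  have h1 : v ^ (-(a - 1) - 1) = v ^ (-a - 1) * v := by
    rw [← rpow_add_one hv.ne']
    congr 1
    ring
  have h2 : Gamma a = (a - 1) * Gamma (a - 1) := by
    rw [← Gamma_add_one (by linarith), sub_add_cancel]
  have h3 : (1 / c) ^ a = (1 / c) ^ (a - 1) * (1 / c) := by
    rw [← rpow_add_one (by positivity), sub_add_cancel]
  have h4 := Gamma_pos_of_pos (show 0 < a - 1 by linarith)
  have h5 : (0 : ℝ) < (1 / c) ^ (a - 1) := by positivity
  have h6 : 0 < a - 1 := by linarith
  unfold invGammaDensity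
  rw [h1, h2, h3]
  field_simp

theorem integral_id_invGamma {a c : ℝ} (ha : 1 < a) (hc : 0 < c) :
    ∫ v, v ∂(invGamma a c) = c / (a - 1) := by
  have h0 : 0 < a - 1 := by linarith
  rw [integral_invGamma (by linarith) hc]
  have h := isProbabilityMeasure_invGamma h0 hc
  have h1 := integral_invGamma h0 hc (fun _ => 1)
  simp only [integral_const, measureReal_def, measure_univ, ENNReal.toReal_one, smul_eq_mul,
    mul_one] at h1
  rw [setIntegral_congr_fun measurableSet_Ioi fun v hv => invGammaDensity_mul_self ha hc hv,
    integral_const_mul, ← h1, mul_one]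

theorem integrable_id_invGamma {a c : ℝ} (ha : 1 < a) (hc : 0 < c) :
    Integrable (fun v : ℝ => v) (invGamma a c) := by
  by_contra h
  have h1 := integral_id_invGamma ha hc
  rw [integral_undef h] at h1
  have : 0 < c / (a - 1) := div_pos hc (by linarith)
  exact this.ne h1

end InvGamma

/-! ### Generalized least squares -/

section Gls

variable {ι κ : Type*} [Fintype ι] [Fintype κ]

open scoped Classical in
/-- The covariance matrix `(Xᵀ R⁻¹ X)⁻¹` of the generalized least squares estimate. -/
noncomputable def glsCov (R : Matrix ι ι ℝ) (X : Matrix ι κ ℝ) : Matrix κ κ ℝ :=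
  (Xᵀ * R⁻¹ * X)⁻¹

theorem posDef_gls [DecidableEq ι] {R : Matrix ι ι ℝ} {X : Matrix ι κ ℝ} (hR : R.PosDef)
    (hX : LinearIndependent ℝ X.col) : (Xᵀ * R⁻¹ * X).PosDef := by
  have h := hR.inv.conjTranspose_mul_mul_same (B := X) (by
    rw [mulVec_injective_iff]; exact hX)
  simpa using h

theorem posDef_glsCov {R : Matrix ι ι ℝ} {X : Matrix ι κ ℝ} (hR : R.PosDef)
    (hX : LinearIndependent ℝ X.col) : (glsCov R X).PosDef := by
  classical
  exact (posDef_gls hR hX).inv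

theorem krigReduction_pos {R : Matrix ι ι ℝ} (hR : R.PosDef) {z : ι → ℝ} (hz : z ≠ 0) :
    0 < krigReduction R z := by
  classical
  simpa [krigReduction] using hR.inv.dotProduct_mulVec_pos hz

open scoped Classical in
/-- The normal equations. -/
theorem transpose_mulVec_inv_mulVec_glsResid {R : Matrix ι ι ℝ} {X : Matrix ι κ ℝ}
    (hR : R.PosDef) (hX : LinearIndependent ℝ X.col) (y : ι → ℝ) :
    Xᵀ *ᵥ (R⁻¹ *ᵥ glsResid R X y) = 0 := by
  have hG : IsUnit (Xᵀ * R⁻¹ * X).det := (posDef_gls hR hX).det_pos.ne'.isUnit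
  have h : (Xᵀ * R⁻¹ * X) *ᵥ glsCoef R X y = Xᵀ *ᵥ (R⁻¹ *ᵥ y) := by
    rw [glsCoef, mulVec_mulVec, Matrix.mul_nonsing_inv _ hG, one_mulVec]
  rw [glsResid, mulVec_sub, mulVec_sub, ← h]
  simp [mulVec_mulVec, Matrix.mul_assoc]

/-- The sum of squares decomposes into the residual and the regression part. -/
theorem krigReduction_sub_mulVec {R : Matrix ι ι ℝ} {X : Matrix ι κ ℝ} (hR : R.PosDef)
    (hX : LinearIndependent ℝ X.col) (y : ι → ℝ) (b : κ → ℝ) :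
    krigReduction R (y - X *ᵥ b) = krigReduction R (glsResid R X y) +
      krigReduction (glsCov R X) (b - glsCoef R X y) := by
  classical
  have hG : IsUnit (Xᵀ * R⁻¹ * X).det := (posDef_gls hR hX).det_pos.ne'.isUnit
  have hRT : R⁻¹ᵀ = R⁻¹ := by
    rw [transpose_nonsing_inv]
    congr 1
    simpa using hR.isHermitian.eq
  have horth := transpose_mulVec_inv_mulVec_glsResid hR hX y
  have hinv : (glsCov R X)⁻¹ = Xᵀ * R⁻¹ * X := Matrix.nonsing_inv_nonsing_inv _ hG
  set e := glsResid R X y with he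
  set d := b - glsCoef R X y with hd
  have h1 : y - X *ᵥ b = e - X *ᵥ d := by
    rw [he, hd, glsResid, mulVec_sub]
    abel
  have h2 : (X *ᵥ d) ⬝ᵥ (R⁻¹ *ᵥ e) = 0 := by
    rw [dotProduct_comm, dotProduct_mulVec, ← mulVec_transpose, horth, zero_dotProduct]
  have h3 : e ⬝ᵥ (R⁻¹ *ᵥ (X *ᵥ d)) = 0 := by
    rw [dotProduct_mulVec, ← mulVec_transpose, hRT, dotProduct_comm, h2]
  have h4 : (X *ᵥ d) ⬝ᵥ (R⁻¹ *ᵥ (X *ᵥ d)) = d ⬝ᵥ ((Xᵀ * R⁻¹ * X) *ᵥ d) := by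
    rw [← mulVec_mulVec, ← mulVec_mulVec, dotProduct_mulVec d, vecMul_transpose]
  -- `glsCov` is the inverse of the Gram matrix, so its own inverse in `krigReduction` restores the
  -- Gram matrix.
  have h5 : krigReduction (glsCov R X) d = d ⬝ᵥ ((Xᵀ * R⁻¹ * X) *ᵥ d) := by
    rw [krigReduction, ← hinv]
  rw [h5, h1, krigReduction, krigReduction, mulVec_sub R⁻¹, sub_dotProduct, dotProduct_sub,
    dotProduct_sub, h2, h3, h4]
  ring

end Gls

/-! ### The normal - inverse gamma posterior distribution -/

section Nig

variable {ι κ : Type*} [Fintype ι] [Fintype κ]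

/-- The law of `(b + √v K w, v)` where `v` is inverse gamma and `w` standard normal. -/
noncomputable def nigLaw (K : Matrix κ κ ℝ) (b : κ → ℝ) (a c : ℝ) : Measure ((κ → ℝ) × ℝ) :=
  ((invGamma a c).prod (stdNormal κ)).map fun p => (b + √p.1 • K *ᵥ p.2, p.1)

theorem measurable_add_sqrt_smul_mulVec (K : Matrix κ κ ℝ) (b : κ → ℝ) :
    Measurable fun p : ℝ × (κ → ℝ) => (b + √p.1 • K *ᵥ p.2, p.1) := by
  refine Measurable.prodMk (measurable_pi_lambda _ fun i => ?_) measurable_fst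
  simp only [Pi.add_apply, Pi.smul_apply, mulVec, dotProduct, smul_eq_mul]
  fun_prop

theorem isProbabilityMeasure_nigLaw (K : Matrix κ κ ℝ) (b : κ → ℝ) {a c : ℝ} (ha : 0 < a)
    (hc : 0 < c) : IsProbabilityMeasure (nigLaw K b a c) := by
  have := isProbabilityMeasure_invGamma ha hc
  exact Measure.isProbabilityMeasure_map (measurable_add_sqrt_smul_mulVec K b).aemeasurable

/-- Prior times likelihood at one level. -/
noncomputable def nigDensity (L R : Matrix ι ι ℝ) (z : ι → ℝ) (v : ℝ) : ℝ≥0∞ :=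
  if 0 < v then ENNReal.ofReal (1 / v) * ENNReal.ofReal (gaussDensity L R v z) else 0

theorem measurable_nigDensity (L R : Matrix ι ι ℝ) :
    Measurable fun p : (ι → ℝ) × ℝ => nigDensity L R p.1 p.2 := by
  unfold nigDensity
  refine Measurable.ite (measurableSet_lt measurable_const measurable_snd) ?_ measurable_const
  unfold gaussDensity krigReduction
  simp only [mulVec, dotProduct]
  fun_prop

/-- Bayes' rule at one level. `krigReduction_sub_mulVec` splits the exponent into a residual part
and a quadratic form in `b`. The Gaussian density of `b` absorbs `v ^ (-q / 2)`, and the remaining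
power with the residual exponential is the inverse gamma kernel. -/
theorem exists_gaussDensity_eq_mul {R L : Matrix ι ι ℝ} {X : Matrix ι κ ℝ} {K : Matrix κ κ ℝ}
    (hR : R.PosDef) (hL : L * Lᵀ = R) (hX : LinearIndependent ℝ X.col)
    (hK : K * Kᵀ = glsCov R X) (hnq : Fintype.card κ < Fintype.card ι) (y : ι → ℝ)
    (hy : 0 < krigReduction R (glsResid R X y)) :
    ∃ C : ℝ, 0 < C ∧ ∀ (b : κ → ℝ) (v : ℝ), 0 < v →
      1 / v * gaussDensity L R v (y - X *ᵥ b) =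
        C * (invGammaDensity (((Fintype.card ι : ℝ) - Fintype.card κ) / 2)
          (krigReduction R (glsResid R X y) / 2) v *
          gaussDensity K (glsCov R X) v (b - glsCoef R X y)) := by
  obtain ⟨C₁, hC₁, h₁⟩ := exists_gaussDensity_eq hR hL
  obtain ⟨C₂, hC₂, h₂⟩ := exists_gaussDensity_eq (posDef_glsCov hR hX) hK
  set S := krigReduction R (glsResid R X y) with hS
  set n := Fintype.card ι
  set q := Fintype.card κ
  set a : ℝ := ((n : ℝ) - q) / 2 with ha
  have ha0 : 0 < a := by
    have : (q : ℝ) < n := by exact_mod_cast hnq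
    rw [ha]; linarith
  have hG := Real.Gamma_pos_of_pos ha0
  have hS2 : 0 < (1 / (S / 2)) ^ a := by positivity
  refine ⟨C₁ / C₂ * ((1 / (S / 2)) ^ a * Real.Gamma a), by positivity, fun b v hv => ?_⟩
  have hpow : ∀ m : ℕ, (√v)⁻¹ ^ m = v ^ (-(m : ℝ) / 2) := fun m => by
    rw [Real.sqrt_eq_rpow, ← Real.rpow_neg hv.le, ← Real.rpow_natCast, ← Real.rpow_mul hv.le]
    congr 1
    ring
  -- The prior factor `1 / v` accounts for the `-1` in the inverse gamma exponent: `-1 - n/2 = (-(n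
  -- - q)/2 - 1) - q/2`.
  have hv1 : 1 / v * (√v)⁻¹ ^ n = v ^ (-a - 1) * (√v)⁻¹ ^ q := by
    rw [hpow, hpow, ← Real.rpow_add hv, one_div, ← Real.rpow_neg_one, ← Real.rpow_add hv]
    congr 1
    rw [ha]
    ring
  rw [h₁, h₂, krigReduction_sub_mulVec hR hX, invGammaDensity]
  set Q := krigReduction (glsCov R X) (b - glsCoef R X y)
  have hexp : Real.exp (-(S + Q) / (2 * v)) =
      Real.exp (-(S / 2) / v) * Real.exp (-Q / (2 * v)) := by
    rw [← Real.exp_add]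
    congr 1
    field_simp
    ring
  rw [← hS, hexp]
  calc 1 / v * (C₁ * ((√v)⁻¹ ^ n * (Real.exp (-(S / 2) / v) * Real.exp (-Q / (2 * v)))))
      = C₁ * (1 / v * (√v)⁻¹ ^ n) * (Real.exp (-(S / 2) / v) * Real.exp (-Q / (2 * v))) := by ring
    _ = _ := by
      rw [hv1]
      field_simp

/-- The improper prior nevertheless yields a finite posterior, of total mass `C`. Both sides are
tested on functions with `v` integrated last: for fixed `v > 0` the map `w ↦ b̂ + √v K w` carries
the standard normal law to the Gaussian density of the coefficients. -/
theorem exists_withDensity_nigDensity_eq {R L : Matrix ι ι ℝ} {X : Matrix ι κ ℝ}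
    {K : Matrix κ κ ℝ} (hR : R.PosDef) (hL : L * Lᵀ = R) (hX : LinearIndependent ℝ X.col)
    (hK : K * Kᵀ = glsCov R X) (hnq : Fintype.card κ < Fintype.card ι) (y : ι → ℝ)
    (hy : 0 < krigReduction R (glsResid R X y)) :
    ∃ C : ℝ≥0∞, C ≠ 0 ∧ C ≠ ∞ ∧
      (volume : Measure ((κ → ℝ) × ℝ)).withDensity (fun p => nigDensity L R (y - X *ᵥ p.1) p.2) =
        C • nigLaw K (glsCoef R X y) (((Fintype.card ι : ℝ) - Fintype.card κ) / 2)
          (krigReduction R (glsResid R X y) / 2) := by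
  obtain ⟨C, hC, h⟩ := exists_gaussDensity_eq_mul hR hL hX hK hnq y hy
  set a : ℝ := ((Fintype.card ι : ℝ) - Fintype.card κ) / 2 with ha
  set c := krigReduction R (glsResid R X y) / 2 with hc
  have ha0 : 0 < a := by
    have : (Fintype.card κ : ℝ) < Fintype.card ι := by exact_mod_cast hnq
    rw [ha]; linarith
  have hc0 : 0 < c := half_pos hy
  have hprob := isProbabilityMeasure_invGamma ha0 hc0
  refine ⟨ENNReal.ofReal C, by simpa using hC, ENNReal.ofReal_ne_top, ?_⟩
  have hres : Measurable fun p : (κ → ℝ) × ℝ => (y - X *ᵥ p.1, p.2) := by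
    refine Measurable.prodMk (measurable_pi_lambda _ fun i => ?_) measurable_snd
    simp only [Pi.sub_apply, mulVec, dotProduct]
    fun_prop
  have hd := (measurable_nigDensity L R).comp hres
  simp only [Function.comp_def] at hd
  have hgd : Measurable fun p : (κ → ℝ) × ℝ => ENNReal.ofReal
      (gaussDensity K (glsCov R X) p.2 (p.1 - glsCoef R X y)) := by
    unfold gaussDensity krigReduction
    simp only [mulVec, dotProduct]
    fun_prop
  have hig := (measurable_invGammaDensity a c).ennreal_ofReal
  refine Measure.ext_of_lintegral _ fun f hf => ?_
  have hfm : Measurable fun p : ℝ × (κ → ℝ) => f (glsCoef R X y + √p.1 • K *ᵥ p.2, p.1) :=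
    hf.comp (measurable_add_sqrt_smul_mulVec K (glsCoef R X y))
  rw [lintegral_withDensity_eq_lintegral_mul _ hd hf, lintegral_smul_measure, nigLaw,
    lintegral_map hf (measurable_add_sqrt_smul_mulVec _ _),
    lintegral_prod _ hfm.aemeasurable,
    Measure.volume_eq_prod, lintegral_prod_symm _ (hd.mul hf).aemeasurable]
  have hin : Measurable fun v => ∫⁻ w, f (glsCoef R X y + √v • K *ᵥ w, v) ∂(stdNormal κ) :=
    hfm.lintegral_prod_right'
  rw [invGamma, lintegral_withDensity_eq_lintegral_mul _ hig hin, smul_eq_mul,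
    ← lintegral_const_mul _ (hig.mul hin), ← lintegral_indicator measurableSet_Ioi]
  refine lintegral_congr fun v => ?_
  by_cases hv : 0 < v
  · rw [Set.indicator_of_mem (show v ∈ Set.Ioi 0 from hv)]
    have hmap := map_stdNormal_smul_eq_withDensity (posDef_glsCov hR hX) hK (glsCoef R X y) hv
    have hfv : Measurable fun b => f (b, v) := hf.comp measurable_prodMk_right
    have hgv : Measurable fun b => ENNReal.ofReal
      (gaussDensity K (glsCov R X) v (b - glsCoef R X y)) := hgd.comp measurable_prodMk_right
    have hmv : Measurable fun w : κ → ℝ => glsCoef R X y + √v • K *ᵥ w := by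
      simp only [← smul_mulVec]
      exact measurable_const_add_mulVec _ _
    simp only [Pi.mul_apply]
    rw [← lintegral_map (f := fun b => f (b, v)) hfv hmv, hmap,
      lintegral_withDensity_eq_lintegral_mul _ hgv hfv, ← mul_assoc,
      ← lintegral_const_mul _ (hgv.mul hfv)]
    refine lintegral_congr fun b => ?_
    rw [nigDensity, if_pos hv, ← ENNReal.ofReal_mul (by positivity), h b v hv, Pi.mul_apply,
      ENNReal.ofReal_mul hC.le, ENNReal.ofReal_mul (invGammaDensity_nonneg ha0 hc0 hv)]
    ring
  · rw [Set.indicator_of_notMem (by simpa using hv)]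
    simp [nigDensity, hv]

end Nig

/-! ### The posterior distribution factors over the levels -/

theorem pi_smul_measure {T : Type*} [Fintype T] {A : T → Type*} [∀ t, MeasurableSpace (A t)]
    (C : T → ℝ≥0∞) (μ : ∀ t, Measure (A t)) [∀ t, SigmaFinite (μ t)]
    [∀ t, SigmaFinite (C t • μ t)] :
    Measure.pi (fun t => C t • μ t) = (∏ t, C t) • Measure.pi μ := by
  refine Measure.pi_eq fun s _ => ?_
  simp [Measure.pi_pi, Finset.prod_mul_distrib]

/-- Turns integration over the posterior into a pushforward of posterior times noise, on which
independence can be used. -/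
theorem bind_map_eq_map_prod {α β γ : Type*} [MeasurableSpace α] [MeasurableSpace β]
    [MeasurableSpace γ] (μ : Measure α) (ν : Measure β) [SFinite ν] {g : α → β → γ}
    (hg : Measurable (Function.uncurry g)) :
    μ.bind (fun a => ν.map (g a)) = (μ.prod ν).map (Function.uncurry g) := by
  have hga : ∀ a, Measurable (g a) := fun a => hg.comp measurable_prodMk_left
  have h : Measurable fun a => ν.map (g a) := by
    refine Measure.measurable_of_measurable_coe _ fun s hs => ?_
    simp_rw [Measure.map_apply (hga _) hs]
    exact measurable_measure_prodMk_left (hg hs)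
  ext s hs
  rw [Measure.bind_apply hs h.aemeasurable, Measure.map_apply hg hs, Measure.prod_apply (hg hs)]
  refine lintegral_congr fun a => ?_
  rw [Measure.map_apply (hga _) hs]
  rfl

theorem bind_congr_ae {α β : Type*} [MeasurableSpace α] [MeasurableSpace β] {μ : Measure α}
    {f g : α → Measure β} (h : f =ᵐ[μ] g) : μ.bind f = μ.bind g := by
  rw [Measure.bind, Measure.bind, Measure.map_congr h]

/-- Regroups parameters and noises level by level. If the output depends on each level only through
`lev t`, it is a function of independent variables. -/
theorem map_map_pi_prod_pi {T : Type*} [Fintype T] {A : T → Type*} {Θ Z : Type*}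
    [∀ t, MeasurableSpace (A t)] [MeasurableSpace Θ] [MeasurableSpace Z]
    (π : ∀ t, Measure (A t)) [∀ t, IsProbabilityMeasure (π t)]
    (ν : Measure ℝ) [IsProbabilityMeasure ν] {Φ : (∀ t, A t) → Θ} (hΦ : Measurable Φ)
    {G : Θ × (T → ℝ) → Z} (hG : Measurable G) {lev : ∀ t, A t × ℝ → ℝ × ℝ}
    (hlev : ∀ t, Measurable (lev t)) {out : (T → ℝ × ℝ) → Z} (hout : Measurable out)
    (h : ∀ z ξ, G (Φ z, ξ) = out (fun t => lev t (z t, ξ t))) :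
    (((Measure.pi π).map Φ).prod (Measure.pi fun _ : T => ν)).map G =
      (Measure.pi fun t => ((π t).prod ν).map (lev t)).map out := by
  have hprob : ∀ t, IsProbabilityMeasure (((π t).prod ν).map (lev t)) := fun t =>
    Measure.isProbabilityMeasure_map (hlev t).aemeasurable
  have hlevpi : Measurable fun (p : ∀ t, A t × ℝ) t => lev t (p t) :=
    measurable_pi_lambda _ fun t => (hlev t).comp (measurable_pi_apply t)
  have hid : (Measure.pi fun _ : T => ν) = (Measure.pi fun _ : T => ν).map id :=
    Measure.map_id.symm
  rw [← Measure.pi_map_pi fun t => (hlev t).aemeasurable, Measure.map_map hout hlevpi, hid,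
    Measure.map_prod_map _ _ hΦ measurable_id, ← map_unzipPi,
    Measure.map_map (hΦ.prodMap measurable_id) measurable_unzipPi,
    Measure.map_map hG ((hΦ.prodMap measurable_id).comp measurable_unzipPi)]
  congr 1
  ext p : 1
  exact h _ _

namespace CokrigingDesign

variable {𝒳 : Type*} {s : ℕ} (D : CokrigingDesign 𝒳 s)

/-- The parameters `(β_t, γ_{t-1}, σ_t²)` of one level, with a dummy `γ` at level `0`. -/
abbrev LevelParam (t : Fin (s + 1)) : Type := (Fin (D.p t) → ℝ) × ℝ × ℝ

/-- All parameters, from those of the levels. -/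
def assemble (z : ∀ t, D.LevelParam t) : D.Param :=
  (fun t => (z t).1, fun t => (z t.succ).2.1, fun t => (z t).2.2)

theorem measurable_assemble : Measurable D.assemble := by
  unfold assemble
  fun_prop

/-- The reference measure for the scale discrepancies; the dummy one is zero. -/
noncomputable def scaleBase (t : Fin (s + 1)) : Measure ℝ :=
  Fin.cases (Measure.dirac 0) (fun _ => volume) t

instance (t : Fin (s + 1)) : SigmaFinite (scaleBase t) := by
  cases t using Fin.cases <;> simp only [scaleBase, Fin.cases_zero, Fin.cases_succ] <;>
    infer_instance

/-- The reference measure for the parameters of one level. -/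
noncomputable def levelBase (t : Fin (s + 1)) : Measure (D.LevelParam t) :=
  volume.prod ((scaleBase t).prod volume)

instance (t : Fin (s + 1)) : SigmaFinite (D.levelBase t) := by
  unfold levelBase; infer_instance

/-- The dummy coordinate carries a Dirac mass, of total mass one, so forgetting it loses nothing. -/
theorem map_tail_pi_scaleBase :
    (Measure.pi (scaleBase (s := s))).map (fun g t => g (Fin.succ t)) = volume := by
  refine (Measure.pi_eq fun S hS => ?_).symm
  have hm : Measurable fun (g : Fin (s + 1) → ℝ) (t : Fin s) => g t.succ := by fun_prop
  rw [Measure.map_apply hm (MeasurableSet.univ_pi hS)]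
  have h : (fun (g : Fin (s + 1) → ℝ) (t : Fin s) => g t.succ) ⁻¹' Set.univ.pi S =
      Set.univ.pi (Fin.cases Set.univ S : Fin (s + 1) → Set ℝ) := by
    ext g
    simp only [Set.mem_preimage, Set.mem_pi, Set.mem_univ, forall_const]
    constructor
    · intro hg t
      cases t using Fin.cases with
      | zero => trivial
      | succ t => exact hg t
    · exact fun hg t => hg t.succ
  rw [h, Measure.pi_pi, Fin.prod_univ_succ]
  simp [scaleBase]

/-- Makes Lebesgue measure on all parameters a product over the levels, by separating `β` from `(γ,
σ²)`, then `γ` from `σ²`, and dropping the dummy `γ`. -/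
theorem map_assemble : (Measure.pi D.levelBase).map D.assemble = volume := by
  have h1 := map_unzipPi (fun t => (volume : Measure (Fin (D.p t) → ℝ)))
    (fun t : Fin (s + 1) => (scaleBase t).prod (volume : Measure ℝ))
  have h2 := map_unzipPi (fun t : Fin (s + 1) => scaleBase t)
    (fun _ => (volume : Measure ℝ))
  have hm : Measurable fun (g : Fin (s + 1) → ℝ) (t : Fin s) => g t.succ := by fun_prop
  have h3 : D.assemble = (Prod.map id (Prod.map (fun g t => g (Fin.succ t)) id ∘ unzipPi)) ∘
      unzipPi := rfl
  have hmm : Measurable (Prod.map (fun (g : Fin (s + 1) → ℝ) (t : Fin s) => g t.succ)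
      (id : (Fin (s + 1) → ℝ) → _)) := hm.prodMap measurable_id
  rw [h3, ← Measure.map_map (measurable_id.prodMap (hmm.comp measurable_unzipPi)) measurable_unzipPi]
  change Measure.map _ (Measure.map _ (Measure.pi fun t => volume.prod ((scaleBase t).prod volume))) = _
  rw [h1, ← Measure.map_prod_map _ _ measurable_id (hmm.comp measurable_unzipPi), Measure.map_id,
    ← Measure.map_map hmm measurable_unzipPi, h2, ← Measure.map_prod_map _ _ hm measurable_id,
    map_tail_pi_scaleBase, Measure.map_id]
  rfl

theorem measurableSet_pos : MeasurableSet {θ : D.Param | ∀ t, 0 < θ.2.2 t} := by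
  have : {θ : D.Param | ∀ t, 0 < θ.2.2 t} = ⋂ t, {θ : D.Param | 0 < θ.2.2 t} := by ext; simp
  rw [this]
  exact MeasurableSet.iInter fun t => measurableSet_lt measurable_const (by fun_prop)

theorem ae_pos_prior : ∀ᵐ θ ∂D.prior, ∀ t, 0 < θ.2.2 t := by
  have h : ∀ᵐ θ ∂((volume : Measure D.Param).restrict {θ | ∀ t, 0 < θ.2.2 t}), ∀ t, 0 < θ.2.2 t :=
    ae_restrict_mem D.measurableSet_pos
  exact (withDensity_absolutelyContinuous _ _).ae_le h

/-- The parameters of level `0`, from the coefficients and the variance. -/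
def levelZero (p : (Fin (D.p 0) → ℝ) × ℝ) : D.LevelParam 0 := (p.1, 0, p.2)

/-- The parameters of level `t + 1`, from the coefficients and the variance. -/
def levelSucc (t : Fin s) (p : (Fin (D.p t.succ) ⊕ Unit → ℝ) × ℝ) : D.LevelParam t.succ :=
  (fun j => p.1 (Sum.inl j), p.1 (Sum.inr ()), p.2)

theorem measurable_levelZero : Measurable D.levelZero := by
  unfold levelZero; fun_prop

theorem measurable_levelSucc (t : Fin s) : Measurable (D.levelSucc t) := by
  unfold levelSucc; fun_prop

theorem map_levelZero : volume.map D.levelZero = D.levelBase 0 := by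
  rw [levelBase, show scaleBase (0 : Fin (s + 1)) = Measure.dirac 0 from rfl, Measure.dirac_prod]
  have h : (volume : Measure (Fin (D.p 0) → ℝ)) = volume.map id := Measure.map_id.symm
  rw [h, Measure.map_prod_map _ _ measurable_id measurable_prodMk_left]
  rfl

theorem map_levelSucc (t : Fin s) : volume.map (D.levelSucc t) = D.levelBase t.succ := by
  have h1 := volume_measurePreserving_sumPiEquivProdPi (fun _ : Fin (D.p t.succ) ⊕ Unit => ℝ)
  have h2 := volume_preserving_funUnique Unit ℝ
  have h3 := ((MeasurePreserving.id (volume : Measure (Fin (D.p t.succ) → ℝ))).prod h2).comp h1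
  have h4 := h3.prod (MeasurePreserving.id (volume : Measure ℝ))
  have h5 := (measurePreserving_prodAssoc (volume : Measure (Fin (D.p t.succ) → ℝ))
    (volume : Measure ℝ) (volume : Measure ℝ)).comp h4
  exact h5.map_eq

end CokrigingDesign

/-! ### Posterior and predictive distribution as products over the levels -/

namespace CokrigingModel

variable {𝒳 : Type*} {s : ℕ} {D : CokrigingDesign 𝒳 s} (M : CokrigingModel D)

/-- The output of level `t`, without the part explained by the level below. -/
def levelOutput (y : D.Data) (t : Fin (s + 1)) (z : D.LevelParam t) : D.pts t → ℝ :=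
  y t - z.2.1 • D.shift (fun _ => 1) y t

theorem levelOutput_assemble (y : D.Data) (t : Fin (s + 1)) (z : ∀ t, D.LevelParam t) :
    D.detrend (D.assemble z).2.1 y t = levelOutput y t (z t) := by
  cases t using Fin.cases with
  | zero => simp [levelOutput, CokrigingDesign.detrend_zero, CokrigingDesign.shift_zero]
  | succ t => simp [levelOutput, CokrigingDesign.detrend_succ, CokrigingDesign.shift_succ,
      CokrigingDesign.assemble]

/-- Prior times likelihood at one level. -/
noncomputable def levelDensity (L : ∀ t, Matrix (D.pts t) (D.pts t) ℝ) (y : D.Data)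
    (t : Fin (s + 1)) (z : D.LevelParam t) : ℝ≥0∞ :=
  nigDensity (L t) (M.R t) (levelOutput y t z - M.H t *ᵥ z.1) z.2.2

theorem measurable_levelDensity (L : ∀ t, Matrix (D.pts t) (D.pts t) ℝ) (y : D.Data)
    (t : Fin (s + 1)) : Measurable (M.levelDensity L y t) := by
  refine (measurable_nigDensity (L t) (M.R t)).comp (f := fun z : D.LevelParam t =>
    (levelOutput y t z - M.H t *ᵥ z.1, z.2.2)) ?_
  refine Measurable.prodMk (measurable_pi_lambda _ fun x => ?_) (by fun_prop)
  simp only [levelOutput, Pi.sub_apply, Pi.smul_apply, mulVec, dotProduct, smul_eq_mul]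
  fun_prop

theorem measurable_detrend_sub (y : D.Data) (t : Fin (s + 1)) :
    Measurable fun θ : D.Param => D.detrend θ.2.1 y t - M.H t *ᵥ θ.1 t := by
  refine measurable_pi_lambda _ fun x => ?_
  cases t using Fin.cases with
  | zero =>
    simp only [CokrigingDesign.detrend_zero, Pi.sub_apply, mulVec, dotProduct]
    fun_prop
  | succ t =>
    simp only [CokrigingDesign.detrend_succ, Pi.sub_apply, Pi.smul_apply, mulVec, dotProduct]
    fun_prop

/-- The likelihood is known only for positive variances, which is enough because the prior charges
no others; the cut-off inside `nigDensity` reproduces that restriction one level at a time. -/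
theorem unnormPosterior_eq (x₀ : 𝒳) (y : D.Data)
    (hR : ∀ t, (M.R t).PosDef) {L : ∀ t, Matrix (D.pts t) (D.pts t) ℝ}
    (hL : ∀ t, L t * (L t)ᵀ = M.R t) :
    M.unnormPosterior x₀ y = volume.withDensity (fun θ => ∏ t,
      nigDensity (L t) (M.R t) (D.detrend θ.2.1 y t - M.H t *ᵥ θ.1 t) (θ.2.2 t)) := by
  set S : Set D.Param := {θ : D.Param | ∀ t, 0 < θ.2.2 t} with hS
  have hSm : MeasurableSet S := D.measurableSet_pos
  have hf : Measurable fun θ : D.Param => ∏ t, ENNReal.ofReal (1 / θ.2.2 t) := by fun_prop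
  have hg : Measurable fun θ : D.Param => ∏ t, ENNReal.ofReal
      (gaussDensity (L t) (M.R t) (θ.2.2 t) (D.detrend θ.2.1 y t - M.H t *ᵥ θ.1 t)) := by
    refine Finset.measurable_prod _ fun t _ => ENNReal.measurable_ofReal.comp ?_
    exact (measurable_gaussDensity (L t) (M.R t)).comp
      (Measurable.prodMk (by fun_prop : Measurable fun θ : D.Param => θ.2.2 t) (M.measurable_detrend_sub y t))
  have hae : (fun θ => (M.likelihood x₀ y θ : ℝ≥0∞)) =ᵐ[D.prior] fun θ => ∏ t, ENNReal.ofReal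
      (gaussDensity (L t) (M.R t) (θ.2.2 t) (D.detrend θ.2.1 y t - M.H t *ᵥ θ.1 t)) := by
    filter_upwards [D.ae_pos_prior] with θ hθ
    exact M.likelihood_eq x₀ y hθ hR hL
  rw [unnormPosterior, withDensity_congr_ae hae, CokrigingDesign.prior, ← withDensity_mul _ hf hg,
    ← withDensity_indicator hSm]
  congr 1
  ext θ
  by_cases hθ : θ ∈ S
  · rw [Set.indicator_of_mem hθ, Pi.mul_apply, ← Finset.prod_mul_distrib]
    exact Finset.prod_congr rfl fun t _ => by rw [nigDensity, if_pos (hθ t)]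
  · rw [Set.indicator_of_notMem hθ]
    obtain ⟨t, ht⟩ : ∃ t, ¬ 0 < θ.2.2 t := by simpa [hS] using hθ
    exact (Finset.prod_eq_zero (Finset.mem_univ t) (by rw [nigDensity, if_neg ht])).symm

/-- The unnormalized posterior is a product of multiples of probability measures, so its total mass
is the product of the constants `C t`, and normalization removes exactly this. -/
theorem posterior_eq (x₀ : 𝒳) (y : D.Data)
    (hR : ∀ t, (M.R t).PosDef) {L : ∀ t, Matrix (D.pts t) (D.pts t) ℝ}
    (hL : ∀ t, L t * (L t)ᵀ = M.R t) (π : ∀ t, Measure (D.LevelParam t))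
    [∀ t, IsProbabilityMeasure (π t)] {C : Fin (s + 1) → ℝ≥0∞} (hC : ∀ t, C t ≠ 0)
    (hC' : ∀ t, C t ≠ ∞)
    (hπ : ∀ t, (D.levelBase t).withDensity (M.levelDensity L y t) = C t • π t) :
    M.posterior x₀ y = (Measure.pi π).map D.assemble := by
  have hfin : ∀ t, IsFiniteMeasure (C t • π t) := fun t => Measure.smul_finite _ (hC' t)
  have hsf : ∀ t, SigmaFinite ((D.levelBase t).withDensity (M.levelDensity L y t)) := fun t => by
    rw [hπ]; infer_instance
  have hpr := Measure.isProbabilityMeasure_map (μ := Measure.pi π) D.measurable_assemble.aemeasurable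
  have h : M.unnormPosterior x₀ y = (∏ t, C t) • (Measure.pi π).map D.assemble := by
    have hd : Measurable fun θ : D.Param => ∏ t,
        nigDensity (L t) (M.R t) (D.detrend θ.2.1 y t - M.H t *ᵥ θ.1 t) (θ.2.2 t) := by
      refine Finset.measurable_prod _ fun t _ => ?_
      exact (measurable_nigDensity (L t) (M.R t)).comp (Measurable.prodMk
        (M.measurable_detrend_sub y t) (by fun_prop : Measurable fun θ : D.Param => θ.2.2 t))
    rw [M.unnormPosterior_eq x₀ y hR hL, ← D.map_assemble,
      withDensity_map D.measurable_assemble hd, ← Measure.map_smul, ← pi_smul_measure]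
    simp_rw [← hπ]
    rw [pi_withDensity fun t => M.measurable_levelDensity L y t]
    congr 2
    ext z
    refine Finset.prod_congr rfl fun t _ => ?_
    rw [levelOutput_assemble]
    rfl
  rw [posterior, h, Measure.smul_apply, measure_univ, smul_eq_mul, mul_one, smul_smul,
    ENNReal.inv_mul_cancel (Finset.prod_ne_zero_iff.2 fun t _ => hC t)
      (ENNReal.prod_ne_top fun t _ => hC' t), one_smul]

theorem ae_pos_posterior (x₀ : 𝒳) (y : D.Data) : ∀ᵐ θ ∂(M.posterior x₀ y), ∀ t, 0 < θ.2.2 t := by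
  have h : ∀ᵐ θ ∂(M.unnormPosterior x₀ y), ∀ t, 0 < θ.2.2 t :=
    (withDensity_absolutelyContinuous D.prior _).ae_le D.ae_pos_prior
  exact Measure.ae_smul_measure h _

/-- The value of `δ_t` at `x₀` given the output and the parameters of level `t`, in terms of a
standard normal variable `ξ`. -/
noncomputable def levelVal (x₀ : 𝒳) (y : D.Data) (t : Fin (s + 1)) (z : D.LevelParam t) (ξ : ℝ) :
    ℝ :=
  M.h t x₀ ⬝ᵥ z.1 + krigWeighted (M.R t) (M.rvec x₀ t) (levelOutput y t z - M.H t *ᵥ z.1) +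
    √z.2.2 * √(M.r t x₀ x₀ - krigReduction (M.R t) (M.rvec x₀ t)) * ξ

theorem measurable_levelVal (x₀ : 𝒳) (y : D.Data) (t : Fin (s + 1)) :
    Measurable fun p : D.LevelParam t × ℝ => M.levelVal x₀ y t p.1 p.2 := by
  simp only [levelVal, krigWeighted, levelOutput, mulVec, dotProduct, Pi.sub_apply, Pi.smul_apply,
    smul_eq_mul]
  fun_prop

/-- The law of the scale discrepancy `γ_{t-1}` and of the value of `δ_t` at `x₀`, given the
output, when the parameters of level `t` have the law `π`. -/
noncomputable def levelLaw (x₀ : 𝒳) (y : D.Data) (t : Fin (s + 1)) (π : Measure (D.LevelParam t)) :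
    Measure (ℝ × ℝ) :=
  (π.prod (gaussianReal 0 1)).map fun p => (p.1.2.1, M.levelVal x₀ y t p.1 p.2)

theorem isProbabilityMeasure_levelLaw (x₀ : 𝒳) (y : D.Data) (t : Fin (s + 1))
    (π : Measure (D.LevelParam t)) [IsProbabilityMeasure π] :
    IsProbabilityMeasure (M.levelLaw x₀ y t π) :=
  Measure.isProbabilityMeasure_map
    (Measurable.prodMk (by fun_prop) (M.measurable_levelVal x₀ y t)).aemeasurable

theorem measurable_arSeq_fst_snd {s : ℕ} : Measurable fun g : Fin (s + 1) → ℝ × ℝ =>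
    arSeq (fun t => (g t.succ).1) (fun t => (g t).2) :=
  continuous_arSeq.measurable.comp (f := fun g : Fin (s + 1) → ℝ × ℝ =>
    ((fun t : Fin s => (g t.succ).1), fun t => (g t).2)) (by fun_prop)

/-- Given the data, the value of `δ_t` at `x₀` involves only the parameters and the noise of level
`t`. As both posterior and noise are products, the pairs (scale discrepancy, innovation) are
independent across levels. -/
theorem predictive_eq (x₀ : 𝒳) (y : D.Data)
    (hR : ∀ t, (M.R t).PosDef) {L : ∀ t, Matrix (D.pts t) (D.pts t) ℝ}
    (hL : ∀ t, L t * (L t)ᵀ = M.R t) (π : ∀ t, Measure (D.LevelParam t))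
    [∀ t, IsProbabilityMeasure (π t)] {C : Fin (s + 1) → ℝ≥0∞} (hC : ∀ t, C t ≠ 0)
    (hC' : ∀ t, C t ≠ ∞)
    (hπ : ∀ t, (D.levelBase t).withDensity (M.levelDensity L y t) = C t • π t) :
    M.predictive x₀ y = (Measure.pi fun t => M.levelLaw x₀ y t (π t)).map
      (fun g => arSeq (fun t => (g t.succ).1) (fun t => (g t).2)) := by
  have hpost := M.posterior_eq x₀ y hR hL π hC hC' hπ
  have hae : (fun θ => contCondLaw (M.jointLaw x₀ θ) y) =ᵐ[M.posterior x₀ y] fun θ =>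
      (stdNormal (Fin (s + 1))).map
      (fun ξ => arSeq θ.2.1 (fun t => M.condVal x₀ θ t (D.detrend θ.2.1 y t) (ξ t))) := by
    filter_upwards [M.ae_pos_posterior x₀ y] with θ hθ
    exact M.contCondLaw_jointLaw x₀ y hθ hR hL
  have hg : Measurable (Function.uncurry fun (θ : D.Param) (ξ : Fin (s + 1) → ℝ) =>
      arSeq θ.2.1 (fun t => M.condVal x₀ θ t (D.detrend θ.2.1 y t) (ξ t))) := by
    refine continuous_arSeq.measurable.comp (f := fun p : D.Param × (Fin (s + 1) → ℝ) =>
      (p.1.2.1, fun t => M.condVal x₀ p.1 t (D.detrend p.1.2.1 y t) (p.2 t))) ?_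
    refine Measurable.prodMk (by fun_prop) (measurable_pi_lambda _ fun t => ?_)
    have h1 : Measurable fun p : D.Param × (Fin (s + 1) → ℝ) =>
        krigWeighted (M.R t) (M.rvec x₀ t) (D.detrend p.1.2.1 y t - M.H t *ᵥ p.1.1 t) :=
      (measurable_krigWeighted _ _).comp ((M.measurable_detrend_sub y t).comp measurable_fst)
    have h2 : Measurable fun p : D.Param × (Fin (s + 1) → ℝ) => M.h t x₀ ⬝ᵥ p.1.1 t := by
      simp only [dotProduct]
      fun_prop
    unfold condVal
    fun_prop
  have hlev : ∀ t, Measurable fun p : D.LevelParam t × ℝ =>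
      (p.1.2.1, M.levelVal x₀ y t p.1 p.2) := fun t =>
    Measurable.prodMk (by fun_prop) (M.measurable_levelVal x₀ y t)
  rw [predictive, bind_congr_ae hae, bind_map_eq_map_prod _ _ hg, hpost]
  refine map_map_pi_prod_pi π (gaussianReal 0 1) D.measurable_assemble hg hlev
    measurable_arSeq_fst_snd fun z ξ => ?_
  simp only [Function.uncurry, condVal, levelVal, levelOutput_assemble]
  rfl

end CokrigingModel

/-! ### Moments -/

theorem memLp_mul_prod {α β : Type*} [MeasurableSpace α] [MeasurableSpace β] {μ : Measure α}
    {ν : Measure β} [SFinite μ] [SFinite ν] {f : α → ℝ} {g : β → ℝ} (hf : MemLp f 2 μ)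
    (hg : MemLp g 2 ν) : MemLp (fun p : α × β => f p.1 * g p.2) 2 (μ.prod ν) := by
  have h := hf.1.comp_fst (ν := ν) |>.mul (hg.1.comp_snd (μ := μ))
  refine (memLp_two_iff_integrable_sq h).2 ?_
  have := hf.integrable_sq.mul_prod hg.integrable_sq
  refine this.congr (.of_forall fun p => ?_)
  simp [mul_pow]

section AddMul

variable {α β : Type*} [MeasurableSpace α] [MeasurableSpace β] {μ : Measure α} {ν : Measure β}
  [IsProbabilityMeasure μ] [IsProbabilityMeasure ν] {A B : α → ℝ} {τ : β → ℝ}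

theorem memLp_add_mul_prod (hA : MemLp A 2 μ) (hB : MemLp B 2 μ) (hτ : MemLp τ 2 ν) :
    MemLp (fun p : α × β => A p.1 + B p.1 * τ p.2) 2 (μ.prod ν) :=
  (hA.comp_fst ν).add (memLp_mul_prod hB hτ)

theorem integral_add_mul_prod (hA : MemLp A 2 μ) (hB : MemLp B 2 μ) (hτ : MemLp τ 2 ν)
    (h0 : ∫ x, τ x ∂ν = 0) :
    ∫ p : α × β, (A p.1 + B p.1 * τ p.2) ∂(μ.prod ν) = ∫ x, A x ∂μ := by
  rw [integral_add ((hA.comp_fst ν).integrable one_le_two)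
    ((memLp_mul_prod hB hτ).integrable one_le_two), integral_prod_mul, h0, mul_zero, add_zero,
    integral_fun_fst]
  simp

/-- The cross term vanishes because `τ` is centred and independent of `A` and `B`. This is used once
for the normal part of the coefficients and once for the kriging error. -/
theorem integral_add_mul_prod_sq (hA : MemLp A 2 μ) (hB : MemLp B 2 μ) (hτ : MemLp τ 2 ν)
    (h0 : ∫ x, τ x ∂ν = 0) :
    ∫ p : α × β, (A p.1 + B p.1 * τ p.2) ^ 2 ∂(μ.prod ν) =
      ∫ x, A x ^ 2 ∂μ + (∫ x, B x ^ 2 ∂μ) * ∫ x, τ x ^ 2 ∂ν := by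
  have h1 : Integrable (fun p : α × β => A p.1 ^ 2) (μ.prod ν) := hA.integrable_sq.comp_fst ν
  have h2 : Integrable (fun p : α × β => (A p.1 * B p.1) * τ p.2) (μ.prod ν) :=
    (hA.integrable_mul hB).mul_prod (hτ.integrable one_le_two)
  have h3 : Integrable (fun p : α × β => B p.1 ^ 2 * τ p.2 ^ 2) (μ.prod ν) :=
    hB.integrable_sq.mul_prod hτ.integrable_sq
  have h4 : ∀ p : α × β, (A p.1 + B p.1 * τ p.2) ^ 2 =
      A p.1 ^ 2 + (2 * ((A p.1 * B p.1) * τ p.2) + B p.1 ^ 2 * τ p.2 ^ 2) := fun p => by ring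
  have h5 : Integrable (fun p : α × β => 2 * ((A p.1 * B p.1) * τ p.2) + B p.1 ^ 2 * τ p.2 ^ 2)
      (μ.prod ν) := (h2.const_mul 2).add h3
  simp_rw [h4]
  rw [integral_add h1 h5, integral_add (h2.const_mul 2) h3,
    integral_const_mul, integral_prod_mul (fun x => A x * B x), h0, integral_prod_mul (fun x => B x ^ 2)
      (fun x => τ x ^ 2), integral_fun_fst (fun x => A x ^ 2)]
  simp

end AddMul

section StdNormal

variable {κ : Type*} [Fintype κ]

theorem memLp_eval_stdNormal (i : κ) : MemLp (fun w : κ → ℝ => w i) 2 (stdNormal κ) :=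
  (memLp_id_gaussianReal 2).comp_measurePreserving
    (measurePreserving_eval (fun _ : κ => gaussianReal 0 1) i)

theorem memLp_dotProduct_stdNormal (u : κ → ℝ) : MemLp (fun w => u ⬝ᵥ w) 2 (stdNormal κ) := by
  simp only [dotProduct]
  exact memLp_finsetSum _ fun i _ => (memLp_eval_stdNormal i).const_mul (u i)

theorem integral_dotProduct_stdNormal (u : κ → ℝ) : ∫ w, u ⬝ᵥ w ∂(stdNormal κ) = 0 := by
  simp only [dotProduct]
  rw [integral_finsetSum]
  · refine Finset.sum_eq_zero fun i _ => ?_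
    have h2 : ∫ w : κ → ℝ, w i ∂(stdNormal κ) = 0 := by
      have h := integral_comp_eval (μ := fun _ : κ => gaussianReal 0 1) (i := i)
        (f := fun x : ℝ => x) measurable_id.aestronglyMeasurable
      exact h.trans integral_id_gaussianReal
    rw [integral_const_mul, h2, mul_zero]
  · exact fun i _ => ((memLp_eval_stdNormal i).const_mul (u i)).integrable one_le_two

theorem integral_dotProduct_sq_stdNormal (u : κ → ℝ) :
    ∫ w, (u ⬝ᵥ w) ^ 2 ∂(stdNormal κ) = u ⬝ᵥ u := by
  have h := variance_sum_pi (μ := fun _ : κ => gaussianReal 0 1) (X := fun i x => u i * x)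
    fun i => (memLp_id_gaussianReal 2).const_mul (u i)
  have h1 : (∑ i, fun w : κ → ℝ => u i * w i) = fun w => u ⬝ᵥ w := by
    ext w
    simp [dotProduct]
  rw [h1] at h
  have h2 : variance (fun w => u ⬝ᵥ w) (stdNormal κ) = ∫ w, (u ⬝ᵥ w) ^ 2 ∂(stdNormal κ) :=
    variance_of_integral_eq_zero (memLp_dotProduct_stdNormal u).1.aemeasurable
      (integral_dotProduct_stdNormal u)
  rw [← h2, stdNormal, h, dotProduct]
  refine Finset.sum_congr rfl fun i _ => ?_
  rw [variance_const_mul, variance_fun_id_gaussianReal]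
  simp [pow_two]

end StdNormal

section Nig

variable {ι κ : Type*} [Fintype ι] [Fintype κ]

/-- Finite second moments of the predictions come from here: shape larger than one means `n - q >
2`. -/
theorem memLp_sqrt_invGamma {a c : ℝ} (ha : 1 < a) (hc : 0 < c) :
    MemLp (fun v : ℝ => √v) 2 (invGamma a c) := by
  refine (memLp_two_iff_integrable_sq (by fun_prop)).2 ?_
  refine (integrable_id_invGamma ha hc).congr ?_
  filter_upwards [ae_pos_invGamma a c] with v hv
  exact (Real.sq_sqrt hv.le).symm

theorem integral_sqrt_sq_invGamma {a c : ℝ} (ha : 1 < a) (hc : 0 < c) :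
    ∫ v, √v ^ 2 ∂(invGamma a c) = c / (a - 1) := by
  rw [← integral_id_invGamma ha hc]
  refine integral_congr_ae ?_
  filter_upwards [ae_pos_invGamma a c] with v hv
  exact Real.sq_sqrt hv.le

variable {K : Matrix κ κ ℝ} {b : κ → ℝ} {a c : ℝ}

theorem measurePreserving_nigLaw (K : Matrix κ κ ℝ) (b : κ → ℝ) (a c : ℝ) :
    MeasurePreserving (fun p : ℝ × (κ → ℝ) => (b + √p.1 • K *ᵥ p.2, p.1))
      ((invGamma a c).prod (stdNormal κ)) (nigLaw K b a c) :=
  ⟨measurable_add_sqrt_smul_mulVec K b, rfl⟩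

/-- The first two moments of an affine function of the coefficients, plus noise. -/
theorem moments_nigLaw (ha : 1 < a) (hc : 0 < c) (g : κ → ℝ) (k d : ℝ) :
    MemLp (fun p : ((κ → ℝ) × ℝ) × ℝ => g ⬝ᵥ p.1.1 + k + √p.1.2 * d * p.2) 2
      ((nigLaw K b a c).prod (gaussianReal 0 1)) ∧
    ∫ p, (g ⬝ᵥ p.1.1 + k + √p.1.2 * d * p.2) ∂((nigLaw K b a c).prod (gaussianReal 0 1)) =
      g ⬝ᵥ b + k ∧
    ∫ p, (g ⬝ᵥ p.1.1 + k + √p.1.2 * d * p.2) ^ 2 ∂((nigLaw K b a c).prod (gaussianReal 0 1)) =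
      (g ⬝ᵥ b + k) ^ 2 + c / (a - 1) * (g ⬝ᵥ ((K * Kᵀ) *ᵥ g) + d ^ 2) := by
  have := isProbabilityMeasure_invGamma (by linarith : 0 < a) hc
  have := isProbabilityMeasure_nigLaw K b (by linarith : 0 < a) hc
  have hmp := measurePreserving_nigLaw K b a c
  -- Along `g` the random part of the coefficients is `√v * (u ⬝ᵥ w)`, and `u ⬝ᵥ u` is the quadratic
  -- form of `K * Kᵀ` at `g`.
  set u := Kᵀ *ᵥ g with hu
  have hs := memLp_sqrt_invGamma ha hc
  have hfun : ∀ p : ℝ × (κ → ℝ), g ⬝ᵥ (b + √p.1 • K *ᵥ p.2) + k =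
      (g ⬝ᵥ b + k) + √p.1 * (u ⬝ᵥ p.2) := fun p => by
    rw [dotProduct_add, dotProduct_smul, dotProduct_mulVec, ← mulVec_transpose, ← hu, smul_eq_mul]
    ring
  have hmA : Measurable fun p : (κ → ℝ) × ℝ => g ⬝ᵥ p.1 + k := by
    simp only [dotProduct]
    fun_prop
  have hconst : MemLp (fun _ : ℝ => g ⬝ᵥ b + k) 2 (invGamma a c) := memLp_const _
  have hu2 := memLp_dotProduct_stdNormal u
  have hu0 := integral_dotProduct_stdNormal u
  have hA : MemLp (fun p : (κ → ℝ) × ℝ => g ⬝ᵥ p.1 + k) 2 (nigLaw K b a c) := by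
    rw [nigLaw, memLp_map_measure_iff hmA.aestronglyMeasurable hmp.measurable.aemeasurable]
    simp only [Function.comp_def, hfun]
    exact memLp_add_mul_prod hconst hs hu2
  have hA1 : ∫ p, (g ⬝ᵥ p.1 + k) ∂(nigLaw K b a c) = g ⬝ᵥ b + k := by
    rw [nigLaw, integral_map hmp.measurable.aemeasurable hmA.aestronglyMeasurable]
    simp only [hfun]
    rw [integral_add_mul_prod hconst hs hu2 hu0]
    simp
  have hA2 : ∫ p, (g ⬝ᵥ p.1 + k) ^ 2 ∂(nigLaw K b a c) =
      (g ⬝ᵥ b + k) ^ 2 + c / (a - 1) * (g ⬝ᵥ ((K * Kᵀ) *ᵥ g)) := by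
    rw [nigLaw, integral_map hmp.measurable.aemeasurable (hmA.pow_const 2).aestronglyMeasurable]
    simp only [hfun]
    rw [integral_add_mul_prod_sq hconst hs hu2 hu0, integral_sqrt_sq_invGamma ha hc,
      integral_dotProduct_sq_stdNormal, hu, ← mulVec_mulVec, dotProduct_mulVec g,
      ← mulVec_transpose]
    simp
  have hmB : Measurable fun p : (κ → ℝ) × ℝ => √p.2 * d := by fun_prop
  have hB : MemLp (fun p : (κ → ℝ) × ℝ => √p.2 * d) 2 (nigLaw K b a c) := by
    rw [nigLaw, memLp_map_measure_iff hmB.aestronglyMeasurable hmp.measurable.aemeasurable]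
    exact (hs.mul_const d).comp_fst (stdNormal κ)
  have hB2 : ∫ p, (√p.2 * d) ^ 2 ∂(nigLaw K b a c) = c / (a - 1) * d ^ 2 := by
    rw [nigLaw, integral_map hmp.measurable.aemeasurable (hmB.pow_const 2).aestronglyMeasurable]
    simp only [mul_pow]
    rw [integral_fun_fst (fun v => √v ^ 2 * d ^ 2), integral_mul_const,
      integral_sqrt_sq_invGamma ha hc]
    simp
  have hξ : MemLp (fun x : ℝ => x) 2 (gaussianReal 0 1) := memLp_id_gaussianReal 2
  have hξ0 : ∫ x, x ∂(gaussianReal 0 1) = 0 := integral_id_gaussianReal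
  have hξ2 : ∫ x, x ^ 2 ∂(gaussianReal 0 1) = 1 := by
    have h := variance_of_integral_eq_zero (X := fun x : ℝ => x) (μ := gaussianReal 0 1)
      (by fun_prop) hξ0
    rw [← h, variance_fun_id_gaussianReal]
    simp
  refine ⟨memLp_add_mul_prod hA hB hξ, ?_, ?_⟩
  · rw [← hA1]
    exact integral_add_mul_prod hA hB hξ hξ0
  · rw [integral_add_mul_prod_sq hA hB hξ hξ0, hA2, hB2, hξ2]
    ring

/-- Exhibits the prediction as an affine function of the coefficients, whose gradient is the vector
occurring in `glsTerm`. -/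
theorem krigMean_add {R : Matrix ι ι ℝ} (hR : R.PosDef) (X : Matrix ι κ ℝ) (y r₀ : ι → ℝ)
    (f₀ b : κ → ℝ) :
    f₀ ⬝ᵥ b + krigWeighted R r₀ (y - X *ᵥ b) =
      (open scoped Classical in f₀ - Xᵀ *ᵥ (R⁻¹ *ᵥ r₀)) ⬝ᵥ b + krigWeighted R r₀ y := by
  classical
  have hRT : R⁻¹ᵀ = R⁻¹ := by
    rw [transpose_nonsing_inv]
    congr 1
    simpa using hR.isHermitian.eq
  have h : (Xᵀ *ᵥ (R⁻¹ *ᵥ r₀)) ⬝ᵥ b = r₀ ⬝ᵥ (R⁻¹ *ᵥ (X *ᵥ b)) := by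
    rw [dotProduct_mulVec r₀, ← mulVec_transpose, hRT, mulVec_transpose, ← dotProduct_mulVec]
  rw [krigWeighted, krigWeighted, mulVec_sub R⁻¹, dotProduct_sub, sub_dotProduct, h]
  ring

/-- The first two moments of the prediction at one level. -/
theorem moments_krig {R : Matrix ι ι ℝ} {X : Matrix ι κ ℝ} (hR : R.PosDef)
    (hK : K * Kᵀ = glsCov R X) (hnq : Fintype.card κ + 2 < Fintype.card ι) {y : ι → ℝ}
    (hy : 0 < krigReduction R (glsResid R X y)) (r₀ : ι → ℝ) (f₀ : κ → ℝ) {ρ : ℝ} (hρ : 0 ≤ ρ)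
    {ν : Measure (((κ → ℝ) × ℝ) × ℝ)}
    (hν : ν = (nigLaw K (glsCoef R X y) (((Fintype.card ι : ℝ) - Fintype.card κ) / 2)
      (krigReduction R (glsResid R X y) / 2)).prod (gaussianReal 0 1)) :
    MemLp (fun p : ((κ → ℝ) × ℝ) × ℝ =>
      f₀ ⬝ᵥ p.1.1 + krigWeighted R r₀ (y - X *ᵥ p.1.1) + √p.1.2 * √ρ * p.2) 2 ν ∧
    ∫ p, (f₀ ⬝ᵥ p.1.1 + krigWeighted R r₀ (y - X *ᵥ p.1.1) + √p.1.2 * √ρ * p.2) ∂ν =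
      krigMean R X y r₀ f₀ ∧
    ∫ p, (f₀ ⬝ᵥ p.1.1 + krigWeighted R r₀ (y - X *ᵥ p.1.1) + √p.1.2 * √ρ * p.2) ^ 2 ∂ν =
      krigMean R X y r₀ f₀ ^ 2 + ((Fintype.card ι : ℝ) - Fintype.card κ) /
        ((Fintype.card ι : ℝ) - Fintype.card κ - 2) * glsVar R X y * (ρ + glsTerm R X r₀ f₀) := by
  classical
  have hnq' : (Fintype.card κ : ℝ) + 2 < Fintype.card ι := by exact_mod_cast hnq
  set N : ℝ := (Fintype.card ι : ℝ) - Fintype.card κ with hN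
  have ha : 1 < N / 2 := by linarith
  have h := moments_nigLaw (K := K) (b := glsCoef R X y) ha (half_pos hy)
    (open scoped Classical in f₀ - Xᵀ *ᵥ (R⁻¹ *ᵥ r₀)) (krigWeighted R r₀ y) (√ρ)
  simp_rw [← krigMean_add hR] at h
  have hmean : krigMean R X y r₀ f₀ =
      f₀ ⬝ᵥ glsCoef R X y + krigWeighted R r₀ (y - X *ᵥ glsCoef R X y) := rfl
  have hterm : (f₀ - Xᵀ *ᵥ (open scoped Classical in R⁻¹ *ᵥ r₀)) ⬝ᵥ ((glsCov R X) *ᵥ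
      (f₀ - Xᵀ *ᵥ (open scoped Classical in R⁻¹ *ᵥ r₀))) = glsTerm R X r₀ f₀ := rfl
  -- The inverse gamma mean `c / (a - 1)` with `a = N / 2` and `c` half the residual sum of squares:
  -- this is where the factor `N / (N - 2)` arises.
  have hvar : krigReduction R (glsResid R X y) / 2 / (N / 2 - 1) =
      N / (N - 2) * glsVar R X y := by
    have hv : glsVar R X y = krigReduction R (glsResid R X y) / N := rfl
    rw [hv]
    have h1 : N - 2 ≠ 0 := by linarith
    have h2 : N ≠ 0 := by linarith
    have h3 : N / 2 - 1 ≠ 0 := by linarith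
    field_simp
  rw [hK, hterm, Real.sq_sqrt hρ, hvar, ← hmean, ← hν] at h
  rw [add_comm ρ]
  exact h

end Nig

/-! ### Moments of an autoregression with independent random coefficients -/

section Autoregression

variable {s : ℕ}

theorem arSeq_congr {γ γ' : Fin s → ℝ} {z z' : Fin (s + 1) → ℝ} {t : Fin (s + 1)}
    (hγ : ∀ j : Fin s, j.succ ≤ t → γ j = γ' j) (hz : ∀ j ≤ t, z j = z' j) :
    arSeq γ z t = arSeq γ' z' t := by
  induction t using Fin.induction with
  | zero => exact hz 0 le_rfl
  | succ t ih =>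
    have ht : t.castSucc ≤ t.succ := (Fin.castSucc_lt_succ).le
    rw [arSeq_succ, arSeq_succ, hγ t le_rfl, hz _ le_rfl,
      ih (fun j hj => hγ j (hj.trans ht)) fun j hj => hz j (hj.trans ht)]

/-- The value at time `t` of the autoregression whose coefficients and innovations are the two
components of `g`. -/
def arVal (t : Fin (s + 1)) (g : Fin (s + 1) → ℝ × ℝ) : ℝ :=
  arSeq (fun t => (g t.succ).1) (fun t => (g t).2) t

theorem arVal_succ (t : Fin s) (g : Fin (s + 1) → ℝ × ℝ) :
    arVal t.succ g = (g t.succ).1 * arVal t.castSucc g + (g t.succ).2 :=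
  arSeq_succ _ _ t

theorem measurable_arVal (t : Fin (s + 1)) : Measurable (arVal t) :=
  (measurable_pi_apply t).comp CokrigingModel.measurable_arSeq_fst_snd

theorem arVal_congr {g g' : Fin (s + 1) → ℝ × ℝ} {t : Fin (s + 1)} (h : ∀ j ≤ t, g j = g' j) :
    arVal t g = arVal t g' :=
  arSeq_congr (fun j hj => by rw [h _ hj]) fun j hj => by rw [h _ hj]

variable (l : Fin (s + 1) → Measure (ℝ × ℝ)) [∀ t, IsProbabilityMeasure (l t)]

/-- The value at level `t` is a function of the pairs up to `t` only, hence independent of the next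
pair. -/
theorem map_arVal_prod_eval (t : Fin s) :
    (Measure.pi l).map (fun g => (arVal t.castSucc g, g t.succ)) =
      ((Measure.pi l).map (arVal t.castSucc)).prod (l t.succ) := by
  have hi : iIndepFun (fun (j : Fin (s + 1)) (g : Fin (s + 1) → ℝ × ℝ) => g j) (Measure.pi l) :=
    iIndepFun_pi (X := fun _ x => x) fun j => measurable_id'.aemeasurable
  have h1 := hi.indepFun_finset (Finset.Iic t.castSucc) {t.succ}
    (Finset.disjoint_singleton_right.2 (by simp)) fun j => measurable_pi_apply j
  -- Extension by zero, so that `arVal` can be evaluated on a family known only up to level `t`; the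
  -- values above do not matter by `arVal_congr`.
  let φ : (Finset.Iic t.castSucc → ℝ × ℝ) → Fin (s + 1) → ℝ × ℝ :=
    fun k j => if hj : j ∈ Finset.Iic t.castSucc then k ⟨j, hj⟩ else 0
  have hφ : Measurable φ := measurable_pi_lambda _ fun j => by
    by_cases hj : j ∈ Finset.Iic t.castSucc
    · simpa only [φ, dif_pos hj] using measurable_pi_apply _
    · simpa only [φ, dif_neg hj] using measurable_const
  have h2 := h1.comp ((measurable_arVal t.castSucc).comp hφ)
    (measurable_pi_apply (⟨t.succ, Finset.mem_singleton_self _⟩ : ({t.succ} : Finset (Fin (s + 1)))))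
  have h3 : ((arVal t.castSucc ∘ φ) ∘ fun (a : Fin (s + 1) → ℝ × ℝ)
      (i : Finset.Iic t.castSucc) => a i) = arVal t.castSucc := by
    ext g
    change arVal t.castSucc (φ fun i => g i) = _
    refine arVal_congr fun j hj => ?_
    simp only [φ, dif_pos (Finset.mem_Iic.2 hj)]
  rw [h3] at h2
  have h4 := (indepFun_iff_map_prod_eq_prod_map_map (measurable_arVal t.castSucc).aemeasurable
    (measurable_pi_apply t.succ).aemeasurable).1 h2
  rw [← (measurePreserving_eval l t.succ).map_eq]
  exact h4

/-- The law of an autoregression with independent pairs (coefficient, innovation) of laws `l`. -/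
noncomputable def arLaw : Measure (Fin (s + 1) → ℝ) :=
  (Measure.pi l).map (fun g t => arVal t g)

instance isProbabilityMeasure_arLaw : IsProbabilityMeasure (arLaw l) :=
  Measure.isProbabilityMeasure_map (measurable_pi_lambda _ measurable_arVal).aemeasurable

omit [∀ t, IsProbabilityMeasure (l t)] in
theorem map_eval_arLaw (t : Fin (s + 1)) :
    (arLaw l).map (fun u => u t) = (Measure.pi l).map (arVal t) := by
  rw [arLaw, Measure.map_map (measurable_pi_apply t) (measurable_pi_lambda _ measurable_arVal)]
  rfl

theorem map_eval_zero_arLaw : (arLaw l).map (fun u => u 0) = (l 0).map Prod.snd := by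
  rw [map_eval_arLaw, ← (measurePreserving_eval l 0).map_eq,
    Measure.map_map measurable_snd (measurable_pi_apply 0)]
  rfl

theorem map_eval_succ_arLaw (t : Fin s) : (arLaw l).map (fun u => u t.succ) =
    (((arLaw l).map (fun u => u t.castSucc)).prod (l t.succ)).map
      fun p => p.2.1 * p.1 + p.2.2 := by
  rw [map_eval_arLaw, map_eval_arLaw, ← map_arVal_prod_eval, Measure.map_map (by fun_prop)
    ((measurable_arVal _).prodMk (measurable_pi_apply _))]
  exact congrArg (fun f => Measure.map f (Measure.pi l)) (funext fun g => arVal_succ t g)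

variable {l}

theorem memLp_mul_add_prod {μ : Measure ℝ} [IsProbabilityMeasure μ] {ν : Measure (ℝ × ℝ)}
    [IsProbabilityMeasure ν] (hμ : MemLp (fun x => x) 2 μ)
    (h1 : MemLp (fun p : ℝ × ℝ => p.1) 2 ν) (h2 : MemLp (fun p : ℝ × ℝ => p.2) 2 ν) :
    MemLp (fun p : ℝ × (ℝ × ℝ) => p.2.1 * p.1 + p.2.2) 2 (μ.prod ν) := by
  refine MemLp.add ?_ (h2.comp_snd μ)
  exact (memLp_mul_prod hμ h1).ae_eq (.of_forall fun p => mul_comm _ _)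

/-- By induction over the levels: a product of two square integrable variables is again square
integrable because they are independent. -/
theorem memLp_arLaw (h1 : ∀ t, MemLp (fun p : ℝ × ℝ => p.2) 2 (l t))
    (h2 : ∀ t : Fin s, MemLp (fun p : ℝ × ℝ => p.1) 2 (l t.succ)) (t : Fin (s + 1)) :
    MemLp (fun u => u t) 2 (arLaw l) := by
  have key : ∀ t, MemLp (fun x : ℝ => x) 2 ((arLaw l).map fun u => u t) ↔
      MemLp (fun u => u t) 2 (arLaw l) := fun t =>
    memLp_map_measure_iff measurable_id'.aestronglyMeasurable (measurable_pi_apply t).aemeasurable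
  rw [← key]
  induction t using Fin.induction with
  | zero =>
    rw [map_eval_zero_arLaw,
      memLp_map_measure_iff measurable_id'.aestronglyMeasurable measurable_snd.aemeasurable]
    exact h1 0
  | succ t ih =>
    have := Measure.isProbabilityMeasure_map (μ := arLaw l) (measurable_pi_apply t.castSucc).aemeasurable
    have hm : Measurable fun p : ℝ × (ℝ × ℝ) => p.2.1 * p.1 + p.2.2 := by fun_prop
    rw [map_eval_succ_arLaw, memLp_map_measure_iff measurable_id'.aestronglyMeasurable
      hm.aemeasurable]
    exact memLp_mul_add_prod ih (h2 t) (h1 _)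

/-- Mean and variance of `Z + G U` with `U` independent of `(G, Z)`, from the conditional moments
given `U`. -/
theorem integral_variance_mul_add_prod {μ : Measure ℝ} [IsProbabilityMeasure μ]
    {ν : Measure (ℝ × ℝ)} [IsProbabilityMeasure ν] (hμ : MemLp (fun x => x) 2 μ)
    (h1 : MemLp (fun p : ℝ × ℝ => p.1) 2 ν) (h2 : MemLp (fun p : ℝ × ℝ => p.2) 2 ν)
    {A γ T₀ T₁ T₂ : ℝ}
    (hm : ∀ u, ∫ p, (p.1 * u + p.2) ∂ν = A + γ * (u - ∫ x, x ∂μ))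
    (hv : ∀ u, ∫ p, (p.1 * u + p.2) ^ 2 ∂ν = (A + γ * (u - ∫ x, x ∂μ)) ^ 2 +
      (T₀ + T₁ * (u - ∫ x, x ∂μ) + T₂ * (u - ∫ x, x ∂μ) ^ 2)) :
    ∫ p, (p.2.1 * p.1 + p.2.2) ∂(μ.prod ν) = A ∧
    variance (fun p : ℝ × (ℝ × ℝ) => p.2.1 * p.1 + p.2.2) (μ.prod ν) =
      γ ^ 2 * variance (fun x => x) μ + (T₀ + T₂ * variance (fun x => x) μ) := by
  have hmem := memLp_mul_add_prod hμ h1 h2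
  set m := ∫ x, x ∂μ with hm_def
  have hd : MemLp (fun x => x - m) 2 μ := hμ.sub (memLp_const m)
  have hd1 : Integrable (fun x => x - m) μ := hd.integrable one_le_two
  have hd2 : Integrable (fun x => (x - m) ^ 2) μ := hd.integrable_sq
  have hi1 : ∫ x, (x - m) ∂μ = 0 := by
    rw [integral_sub (hμ.integrable one_le_two) (integrable_const m)]
    simp [hm_def]
  have hi2 : ∫ x, (x - m) ^ 2 ∂μ = variance (fun x => x) μ :=
    (variance_eq_integral aemeasurable_id).symm
  have hmean : ∫ p, (p.2.1 * p.1 + p.2.2) ∂(μ.prod ν) = A := by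
    rw [integral_prod _ (hmem.integrable one_le_two)]
    simp only [hm]
    rw [integral_add (integrable_const A) (hd1.const_mul γ), integral_const_mul, hi1]
    simp
  refine ⟨hmean, ?_⟩
  rw [variance_eq_sub hmem, hmean]
  have hsq : ∫ p : ℝ × (ℝ × ℝ), (p.2.1 * p.1 + p.2.2) ^ 2 ∂(μ.prod ν) =
      A ^ 2 + T₀ + (γ ^ 2 + T₂) * variance (fun x => x) μ := by
    rw [integral_prod _ hmem.integrable_sq]
    simp only [hv]
    -- Expansion about the mean `m`: every linear term integrates to zero, so `T₁` disappears and
    -- only `γ ^ 2 + T₂` multiplies the variance of `U`.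
    have h3 : ∀ u, (A + γ * (u - m)) ^ 2 + (T₀ + T₁ * (u - m) + T₂ * (u - m) ^ 2) =
        (A ^ 2 + T₀) + ((2 * A * γ + T₁) * (u - m) + (γ ^ 2 + T₂) * (u - m) ^ 2) := fun u => by ring
    have h4 : Integrable (fun u => (2 * A * γ + T₁) * (u - m) + (γ ^ 2 + T₂) * (u - m) ^ 2) μ :=
      (hd1.const_mul _).add (hd2.const_mul _)
    simp_rw [h3]
    rw [integral_add (integrable_const _) h4, integral_add (hd1.const_mul _) (hd2.const_mul _),
      integral_const_mul, integral_const_mul, hi1, hi2]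
    simp
  have : (fun p : ℝ × (ℝ × ℝ) => p.2.1 * p.1 + p.2.2) ^ 2 =
      fun p => (p.2.1 * p.1 + p.2.2) ^ 2 := rfl
  rw [this, hsq]
  ring

theorem integral_variance_arLaw_zero : ∫ u, u 0 ∂(arLaw l) = ∫ p, p.2 ∂(l 0) ∧
    variance (fun u => u 0) (arLaw l) = variance (fun p : ℝ × ℝ => p.2) (l 0) := by
  have h := map_eval_zero_arLaw l
  constructor
  · rw [← integral_map (μ := arLaw l) (φ := fun u => u 0) (f := fun x : ℝ => x)
      (measurable_pi_apply 0).aemeasurable measurable_id'.aestronglyMeasurable, h,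
      integral_map measurable_snd.aemeasurable measurable_id'.aestronglyMeasurable]
  · have h1 := variance_map (X := fun x : ℝ => x) (μ := arLaw l) (Y := fun u => u 0)
      measurable_id'.aemeasurable (measurable_pi_apply 0).aemeasurable
    have h2 := variance_map (X := fun x : ℝ => x) (μ := l 0) (Y := Prod.snd)
      aemeasurable_id measurable_snd.aemeasurable
    rw [h] at h1
    exact h1.symm.trans h2

theorem integral_variance_arLaw_succ (h1 : ∀ t, MemLp (fun p : ℝ × ℝ => p.2) 2 (l t))
    (h2 : ∀ t : Fin s, MemLp (fun p : ℝ × ℝ => p.1) 2 (l t.succ)) (t : Fin s)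
    {A γ T₀ T₁ T₂ : ℝ}
    (hm : ∀ u, ∫ p, (p.1 * u + p.2) ∂(l t.succ) = A + γ * (u - ∫ u, u t.castSucc ∂(arLaw l)))
    (hv : ∀ u, ∫ p, (p.1 * u + p.2) ^ 2 ∂(l t.succ) =
      (A + γ * (u - ∫ u, u t.castSucc ∂(arLaw l))) ^ 2 +
      (T₀ + T₁ * (u - ∫ u, u t.castSucc ∂(arLaw l)) +
        T₂ * (u - ∫ u, u t.castSucc ∂(arLaw l)) ^ 2)) :
    ∫ u, u t.succ ∂(arLaw l) = A ∧ variance (fun u => u t.succ) (arLaw l) =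
      γ ^ 2 * variance (fun u => u t.castSucc) (arLaw l) +
        (T₀ + T₂ * variance (fun u => u t.castSucc) (arLaw l)) := by
  have h := map_eval_succ_arLaw l t
  have hpr := Measure.isProbabilityMeasure_map (μ := arLaw l)
    (measurable_pi_apply t.castSucc).aemeasurable
  have hmean : ∀ t, ∫ u, u t ∂(arLaw l) = ∫ x, x ∂((arLaw l).map fun u => u t) := fun t =>
    (integral_map (φ := fun u : Fin (s + 1) → ℝ => u t) (f := fun x : ℝ => x)
      (measurable_pi_apply t).aemeasurable measurable_id'.aestronglyMeasurable).symm
  have hvar : ∀ t, variance (fun u => u t) (arLaw l) =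
      variance (fun x => x) ((arLaw l).map fun u => u t) := fun t =>
    (variance_map (X := fun x : ℝ => x) measurable_id'.aemeasurable
      (measurable_pi_apply t).aemeasurable).symm
  have hmem := (memLp_map_measure_iff (f := fun u : Fin (s + 1) → ℝ => u t.castSucc)
    (g := fun x : ℝ => x) measurable_id'.aestronglyMeasurable
    (measurable_pi_apply t.castSucc).aemeasurable).2 (memLp_arLaw h1 h2 t.castSucc)
  have hmble : Measurable fun p : ℝ × (ℝ × ℝ) => p.2.1 * p.1 + p.2.2 := by fun_prop
  simp only [hmean t.castSucc] at hm hv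
  have key := integral_variance_mul_add_prod hmem (h2 t) (h1 _) hm hv
  rw [hmean t.succ, hvar t.succ, hvar t.castSucc, h,
    integral_map hmble.aemeasurable measurable_id'.aestronglyMeasurable]
  refine ⟨key.1, Eq.trans ?_ key.2⟩
  exact variance_map (X := fun x : ℝ => x) measurable_id'.aemeasurable hmble.aemeasurable

end Autoregression

/-! ### Dependence of the kriging formulas on one regressor -/

section Quadratic

variable {ι κ : Type*} [Fintype ι] [Fintype κ] [DecidableEq κ]

theorem krigMean_add_smul_single (R : Matrix ι ι ℝ) (X : Matrix ι κ ℝ) (y r₀ : ι → ℝ) (f₀ : κ → ℝ)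
    (j : κ) (d : ℝ) : krigMean R X y r₀ (f₀ + d • Pi.single j 1) =
      krigMean R X y r₀ f₀ + glsCoef R X y j * d := by
  rw [krigMean, krigMean, add_dotProduct, smul_dotProduct, single_one_dotProduct, smul_eq_mul]
  ring

/-- A quadratic form along a line. The linear coefficient `T` is left unspecified because it
averages out; only the leading coefficient matters. -/
theorem exists_glsTerm_add_smul_single (R : Matrix ι ι ℝ) (X : Matrix ι κ ℝ) (r₀ : ι → ℝ)
    (f₀ : κ → ℝ) (j : κ) : ∃ T, ∀ d : ℝ, glsTerm R X r₀ (f₀ + d • Pi.single j 1) =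
      glsTerm R X r₀ f₀ + T * d + glsCov R X j j * d ^ 2 := by
  classical
  obtain ⟨A, hA⟩ : ∃ A, A = glsCov R X := ⟨_, rfl⟩
  obtain ⟨g, hg⟩ : ∃ g : κ → ℝ, ∀ f, glsTerm R X r₀ f = (f - g) ⬝ᵥ (A *ᵥ (f - g)) :=
    ⟨_, fun f => by rw [hA]; rfl⟩
  refine ⟨Pi.single j 1 ⬝ᵥ (A *ᵥ (f₀ - g)) + (f₀ - g) ⬝ᵥ (A *ᵥ Pi.single j 1), fun d => ?_⟩
  rw [hg, hg, ← hA, add_sub_right_comm]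
  have : Pi.single j 1 ⬝ᵥ (A *ᵥ (Pi.single j 1 : κ → ℝ)) = A j j := by
    rw [single_one_dotProduct, mulVec_single_one, col_apply]
  rw [mulVec_add, add_dotProduct, dotProduct_add, dotProduct_add, mulVec_smul, smul_dotProduct,
    smul_dotProduct, dotProduct_smul, dotProduct_smul, this]
  simp only [smul_eq_mul]
  ring

-- Regress `W` on `H`. The residual is `X v` with last coordinate of `v` equal to one, and it is
-- orthogonal to `H`, so the Gram matrix of `X` sends `v` to `Wᵀ Q W` times the last basis vector.
-- Applying the inverse and reading the last coordinate gives the claim.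
omit [DecidableEq κ] in
theorem glsCov_inr_inr {R : Matrix ι ι ℝ} (hR : R.PosDef) {H : Matrix ι κ ℝ} {W : ι → ℝ}
    (hX : LinearIndependent ℝ (fromCols H (replicateCol Unit W)).col) :
    glsCov R (fromCols H (replicateCol Unit W)) (Sum.inr ()) (Sum.inr ()) =
      (W ⬝ᵥ (projQ R H *ᵥ W))⁻¹ := by
  classical
  set X := fromCols H (replicateCol Unit W) with hXdef
  have hH : LinearIndependent ℝ H.col := hX.comp Sum.inl Sum.inl_injective
  have hG : IsUnit (Xᵀ * R⁻¹ * X).det := (posDef_gls hR hX).det_pos.ne'.isUnit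
  set v : κ ⊕ Unit → ℝ := Sum.elim (-glsCoef R H W) (fun _ => 1) with hv
  have hXv : X *ᵥ v = glsResid R H W := by
    rw [hXdef, hv, fromCols_mulVec_sumElim, mulVec_neg, glsResid, neg_add_eq_sub]
    congr 1
    ext i
    simp [mulVec, dotProduct]
  have hproj : W ⬝ᵥ (projQ R H *ᵥ W) = W ⬝ᵥ (R⁻¹ *ᵥ glsResid R H W) := by
    rw [projQ, glsResid, glsCoef, mulVec_sub, sub_mulVec]
    simp only [mulVec_mulVec, Matrix.mul_assoc]
  have hGv : (Xᵀ * R⁻¹ * X) *ᵥ v = (W ⬝ᵥ (projQ R H *ᵥ W)) • Pi.single (Sum.inr ()) 1 := by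
    rw [← mulVec_mulVec, ← mulVec_mulVec, hXv, hXdef, transpose_fromCols, fromRows_mulVec,
      transpose_mulVec_inv_mulVec_glsResid hR hH, hproj]
    ext (i | i)
    · simp
    · simp only [transpose_replicateCol, Sum.elim_inr, Pi.smul_apply, Pi.single_eq_same, smul_eq_mul,
        mul_one]
      rfl
  have h := congrArg (fun u => ((Xᵀ * R⁻¹ * X)⁻¹ *ᵥ u) (Sum.inr ())) hGv
  simp only [mulVec_mulVec, Matrix.nonsing_inv_mul _ hG, one_mulVec, mulVec_smul, Pi.smul_apply,
    mulVec_single_one, col_apply, smul_eq_mul] at h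
  rw [mul_comm] at h
  unfold glsCov
  convert! eq_inv_of_mul_eq_one_left h.symm

end Quadratic

/-! ### Moments of one level and the recursion over the levels -/

namespace CokrigingModel

variable {𝒳 : Type*} {s : ℕ} {D : CokrigingDesign 𝒳 s} (M : CokrigingModel D)

theorem krigReduction_rvec_le (x₀ : 𝒳) {t : Fin (s + 1)} (hR : (M.R t).PosDef) :
    0 ≤ M.r t x₀ x₀ - krigReduction (M.R t) (M.rvec x₀ t) := by
  have hS := (M.isCorrelation t).posSemidef (D.allPts x₀)
  exact sub_nonneg.2 (posSemidef_krigReduction_le hS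
    (fun x : D.pts t => ⟨x.1, D.mem_allPts x₀ x.2⟩) ⟨x₀, D.mem_allPts_self x₀⟩ hR)

/-- An output outside the column space has a nonzero residual, which makes the scale of the inverse
gamma posterior positive. -/
theorem krigReduction_glsResid_pos {ι κ : Type*} [Fintype ι] [Fintype κ] {R : Matrix ι ι ℝ}
    (hR : R.PosDef) {X : Matrix ι κ ℝ} {y : ι → ℝ} (hy : ∀ b, X *ᵥ b ≠ y) :
    0 < krigReduction R (glsResid R X y) :=
  krigReduction_pos hR fun h => hy _ (sub_eq_zero.1 h).symm

theorem exists_mul_transpose_eq_of_posDef {κ : Type*} [Fintype κ] {S : Matrix κ κ ℝ}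
    (hS : S.PosDef) : ∃ K : Matrix κ κ ℝ, K * Kᵀ = S := by
  classical
  exact exists_mul_transpose_eq hS.posSemidef

theorem levelLaw_map (x₀ : 𝒳) (y : D.Data) (t : Fin (s + 1)) {α : Type*} [MeasurableSpace α]
    {ν : Measure α} [IsProbabilityMeasure ν] {Φ : α → D.LevelParam t} (hΦ : Measurable Φ) :
    M.levelLaw x₀ y t (ν.map Φ) =
      (ν.prod (gaussianReal 0 1)).map fun p => ((Φ p.1).2.1, M.levelVal x₀ y t (Φ p.1) p.2) := by
  have h1 : (ν.map Φ).prod (gaussianReal 0 1) = (ν.prod (gaussianReal 0 1)).map (Prod.map Φ id) := by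
    have h := Measure.map_prod_map ν (gaussianReal 0 1) hΦ measurable_id
    rwa [Measure.map_id] at h
  rw [levelLaw, h1, Measure.map_map
    (Measurable.prodMk (by fun_prop) (M.measurable_levelVal x₀ y t)) (hΦ.prodMap measurable_id)]
  rfl

/-- The posterior distribution of the parameters of one level, and the first two moments of the
prediction at that level given the value `u` at the level below. The regression problem with matrix
`X` has the parameters `Φ`. -/
theorem exists_levelPosterior (y : D.Data) (t : Fin (s + 1)) {κ : Type*} [Fintype κ]
    {X : Matrix (D.pts t) κ ℝ} (hR : (M.R t).PosDef) (hX : LinearIndependent ℝ X.col)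
    (hy : ∀ b, X *ᵥ b ≠ y t) (hκ : Fintype.card κ = D.q t) (hn : D.q t + 2 < D.n t)
    {L : ∀ t, Matrix (D.pts t) (D.pts t) ℝ} (hL : L t * (L t)ᵀ = M.R t)
    {Φ : (κ → ℝ) × ℝ → D.LevelParam t} (hΦ : Measurable Φ) (hΦv : volume.map Φ = D.levelBase t)
    (hΦ1 : ∀ p, levelOutput y t (Φ p) - M.H t *ᵥ (Φ p).1 = y t - X *ᵥ p.1)
    (hΦ2 : ∀ p, (Φ p).2.2 = p.2) {f : 𝒳 → ℝ → κ → ℝ}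
    (hf : ∀ x₀ u p, (Φ p).2.1 * u + M.h t x₀ ⬝ᵥ (Φ p).1 = f x₀ u ⬝ᵥ p.1) :
    ∃ π : Measure (D.LevelParam t), IsProbabilityMeasure π ∧
      (∃ C : ℝ≥0∞, C ≠ 0 ∧ C ≠ ∞ ∧
        (D.levelBase t).withDensity (M.levelDensity L y t) = C • π) ∧
      ∀ x₀ u, MemLp (fun p : ℝ × ℝ => p.1 * u + p.2) 2 (M.levelLaw x₀ y t π) ∧
        ∫ p, (p.1 * u + p.2) ∂(M.levelLaw x₀ y t π) =
          krigMean (M.R t) X (y t) (M.rvec x₀ t) (f x₀ u) ∧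
        ∫ p, (p.1 * u + p.2) ^ 2 ∂(M.levelLaw x₀ y t π) =
          krigMean (M.R t) X (y t) (M.rvec x₀ t) (f x₀ u) ^ 2 +
          ((D.n t : ℝ) - D.q t) / ((D.n t : ℝ) - D.q t - 2) * glsVar (M.R t) X (y t) *
            (M.r t x₀ x₀ - krigReduction (M.R t) (M.rvec x₀ t) +
              glsTerm (M.R t) X (M.rvec x₀ t) (f x₀ u)) := by
  have hcn : Fintype.card (D.pts t) = D.n t := Fintype.card_coe _
  have hpos := krigReduction_glsResid_pos hR hy
  obtain ⟨K, hK⟩ := exists_mul_transpose_eq_of_posDef (posDef_glsCov hR hX)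
  have hnq : Fintype.card κ + 2 < Fintype.card (D.pts t) := by omega
  obtain ⟨C, hC, hC', h⟩ := exists_withDensity_nigDensity_eq hR hL hX hK (by omega) (y t) hpos
  have hprob := isProbabilityMeasure_nigLaw K (glsCoef (M.R t) X (y t))
    (a := ((Fintype.card (D.pts t) : ℝ) - Fintype.card κ) / 2) (by
      have : (Fintype.card κ : ℝ) + 2 < Fintype.card (D.pts t) := by exact_mod_cast hnq
      linarith) (half_pos hpos)
  set ν := nigLaw K (glsCoef (M.R t) X (y t)) (((Fintype.card (D.pts t) : ℝ) - Fintype.card κ) / 2)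
    (krigReduction (M.R t) (glsResid (M.R t) X (y t)) / 2) with hν
  refine ⟨ν.map Φ, Measure.isProbabilityMeasure_map hΦ.aemeasurable, ⟨C, hC, hC', ?_⟩,
    fun x₀ u => ?_⟩
  · rw [← hΦv, withDensity_map hΦ (M.measurable_levelDensity L y t), ← Measure.map_smul, ← h]
    congr 2
    ext p
    rw [levelDensity, hΦ1, hΦ2]
  · have hm := moments_krig hR hK hnq hpos (M.rvec x₀ t) (f x₀ u)
      (M.krigReduction_rvec_le x₀ hR) rfl
    have hmeas : Measurable fun p : ((κ → ℝ) × ℝ) × ℝ =>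
        ((Φ p.1).2.1, M.levelVal x₀ y t (Φ p.1) p.2) :=
      (by fun_prop : Measurable fun p : ((κ → ℝ) × ℝ) × ℝ => (Φ p.1).2.1).prodMk
        ((M.measurable_levelVal x₀ y t).comp (hΦ.prodMap measurable_id))
    -- The frozen value `u` multiplies the random scale discrepancy, so it acts as one more
    -- regressor at `x₀`.
    have hval : ∀ p : ((κ → ℝ) × ℝ) × ℝ, (Φ p.1).2.1 * u + M.levelVal x₀ y t (Φ p.1) p.2 =
        f x₀ u ⬝ᵥ p.1.1 + krigWeighted (M.R t) (M.rvec x₀ t) (y t - X *ᵥ p.1.1) +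
          √p.1.2 * √(M.r t x₀ x₀ - krigReduction (M.R t) (M.rvec x₀ t)) * p.2 := fun p => by
      rw [levelVal, hΦ1, hΦ2, ← hf]
      ring
    have hlin : Measurable fun p : ℝ × ℝ => p.1 * u + p.2 := by fun_prop
    simp_rw [← hval] at hm
    rw [hcn, hκ] at hm
    rw [M.levelLaw_map x₀ y t hΦ,
      memLp_map_measure_iff hlin.aestronglyMeasurable hmeas.aemeasurable,
      integral_map hmeas.aemeasurable hlin.aestronglyMeasurable,
      integral_map hmeas.aemeasurable (hlin.pow_const 2).aestronglyMeasurable, hν]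
    rw [hcn, hκ]
    exact hm

variable (y : D.Data)

/-- The frozen value `u` has no effect here, the dummy coefficient being zero; it is kept so that
all levels have the same form. -/
theorem exists_levelPosterior_zero (hy : M.Nondegenerate y) (hn : D.q 0 + 2 < D.n 0)
    {L : ∀ t, Matrix (D.pts t) (D.pts t) ℝ} (hL : ∀ t, L t * (L t)ᵀ = M.R t) :
    ∃ π : Measure (D.LevelParam 0), IsProbabilityMeasure π ∧
      (∃ C : ℝ≥0∞, C ≠ 0 ∧ C ≠ ∞ ∧
        (D.levelBase 0).withDensity (M.levelDensity L y 0) = C • π) ∧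
      ∀ x₀, ∀ u : ℝ, MemLp (fun p : ℝ × ℝ => p.1 * u + p.2) 2 (M.levelLaw x₀ y 0 π) ∧
        ∫ p, (p.1 * u + p.2) ∂(M.levelLaw x₀ y 0 π) =
          krigMean (M.R 0) (M.H 0) (y 0) (M.rvec x₀ 0) (M.h 0 x₀) ∧
        ∫ p, (p.1 * u + p.2) ^ 2 ∂(M.levelLaw x₀ y 0 π) =
          krigMean (M.R 0) (M.H 0) (y 0) (M.rvec x₀ 0) (M.h 0 x₀) ^ 2 +
          ((D.n 0 : ℝ) - D.q 0) / ((D.n 0 : ℝ) - D.q 0 - 2) * glsVar (M.R 0) (M.H 0) (y 0) *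
            (M.r 0 x₀ x₀ - krigReduction (M.R 0) (M.rvec x₀ 0) +
              glsTerm (M.R 0) (M.H 0) (M.rvec x₀ 0) (M.h 0 x₀)) := by
  refine M.exists_levelPosterior y 0 (hy.posDef 0) hy.indep_zero hy.resid_zero
    (by simp [CokrigingDesign.q]) hn (hL 0) D.measurable_levelZero D.map_levelZero (fun p => ?_)
    (fun p => rfl) (f := fun x₀ _ => M.h 0 x₀) fun x₀ u p => ?_
  · rw [levelOutput, CokrigingDesign.shift_zero, smul_zero, sub_zero]
    rfl
  · simp [CokrigingDesign.levelZero]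

theorem exists_levelPosterior_succ (hy : M.Nondegenerate y) (t : Fin s)
    (hn : D.q t.succ + 2 < D.n t.succ)
    {L : ∀ t, Matrix (D.pts t) (D.pts t) ℝ} (hL : ∀ t, L t * (L t)ᵀ = M.R t) :
    ∃ π : Measure (D.LevelParam t.succ), IsProbabilityMeasure π ∧
      (∃ C : ℝ≥0∞, C ≠ 0 ∧ C ≠ ∞ ∧
        (D.levelBase t.succ).withDensity (M.levelDensity L y t.succ) = C • π) ∧
      ∀ x₀ u, MemLp (fun p : ℝ × ℝ => p.1 * u + p.2) 2 (M.levelLaw x₀ y t.succ π) ∧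
        ∫ p, (p.1 * u + p.2) ∂(M.levelLaw x₀ y t.succ π) =
          krigMean (M.R t.succ) (M.X y t) (y t.succ) (M.rvec x₀ t.succ) (M.f x₀ t u) ∧
        ∫ p, (p.1 * u + p.2) ^ 2 ∂(M.levelLaw x₀ y t.succ π) =
          krigMean (M.R t.succ) (M.X y t) (y t.succ) (M.rvec x₀ t.succ) (M.f x₀ t u) ^ 2 +
          ((D.n t.succ : ℝ) - D.q t.succ) / ((D.n t.succ : ℝ) - D.q t.succ - 2) *
            glsVar (M.R t.succ) (M.X y t) (y t.succ) *
            (M.r t.succ x₀ x₀ - krigReduction (M.R t.succ) (M.rvec x₀ t.succ) +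
              glsTerm (M.R t.succ) (M.X y t) (M.rvec x₀ t.succ) (M.f x₀ t u)) := by
  refine M.exists_levelPosterior y t.succ (hy.posDef _) (hy.indep_succ t) (hy.resid_succ t)
    (by simp [CokrigingDesign.q]) hn (hL _) (D.measurable_levelSucc t) (D.map_levelSucc t)
    (fun p => ?_) (fun p => rfl) (f := fun x₀ u => M.f x₀ t u) fun x₀ u p => ?_
  · have h1 : M.X y t *ᵥ p.1 = M.H t.succ *ᵥ (p.1 ∘ Sum.inl) + p.1 (Sum.inr ()) • D.W y t := by
      rw [X, ← Sum.elim_comp_inl_inr p.1, fromCols_mulVec_sumElim]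
      congr 1
      ext x
      simp [mulVec, dotProduct, mul_comm]
    rw [h1, levelOutput, CokrigingDesign.shift_succ]
    simp only [CokrigingDesign.levelSucc, one_smul]
    abel
  · simp only [CokrigingDesign.levelSucc, f, dotProduct, Fintype.sum_sum_type, Sum.elim_inl,
      Sum.elim_inr, Finset.univ_unique, Finset.sum_singleton]
    rw [add_comm, mul_comm u]


/-- The predictive distribution is the law of an autoregression with independent pairs
(scale discrepancy, innovation); the moments of these pairs are explicit. -/
theorem exists_predictive_eq_arLaw (hy : M.Nondegenerate y) (hn : ∀ t, D.q t + 2 < D.n t)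
    (x₀ : 𝒳) :
    ∃ l : Fin (s + 1) → Measure (ℝ × ℝ), (∀ t, IsProbabilityMeasure (l t)) ∧
      M.predictive x₀ y = arLaw l ∧
      (∀ u : ℝ, MemLp (fun p : ℝ × ℝ => p.1 * u + p.2) 2 (l 0) ∧
        ∫ p, (p.1 * u + p.2) ∂(l 0) =
          krigMean (M.R 0) (M.H 0) (y 0) (M.rvec x₀ 0) (M.h 0 x₀) ∧
        ∫ p, (p.1 * u + p.2) ^ 2 ∂(l 0) =
          krigMean (M.R 0) (M.H 0) (y 0) (M.rvec x₀ 0) (M.h 0 x₀) ^ 2 +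
          ((D.n 0 : ℝ) - D.q 0) / ((D.n 0 : ℝ) - D.q 0 - 2) * glsVar (M.R 0) (M.H 0) (y 0) *
            (M.r 0 x₀ x₀ - krigReduction (M.R 0) (M.rvec x₀ 0) +
              glsTerm (M.R 0) (M.H 0) (M.rvec x₀ 0) (M.h 0 x₀))) ∧
      ∀ (t : Fin s) (u : ℝ), MemLp (fun p : ℝ × ℝ => p.1 * u + p.2) 2 (l t.succ) ∧
        ∫ p, (p.1 * u + p.2) ∂(l t.succ) =
          krigMean (M.R t.succ) (M.X y t) (y t.succ) (M.rvec x₀ t.succ) (M.f x₀ t u) ∧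
        ∫ p, (p.1 * u + p.2) ^ 2 ∂(l t.succ) =
          krigMean (M.R t.succ) (M.X y t) (y t.succ) (M.rvec x₀ t.succ) (M.f x₀ t u) ^ 2 +
          ((D.n t.succ : ℝ) - D.q t.succ) / ((D.n t.succ : ℝ) - D.q t.succ - 2) *
            glsVar (M.R t.succ) (M.X y t) (y t.succ) *
            (M.r t.succ x₀ x₀ - krigReduction (M.R t.succ) (M.rvec x₀ t.succ) +
              glsTerm (M.R t.succ) (M.X y t) (M.rvec x₀ t.succ) (M.f x₀ t u)) := by
  choose L hL using fun t => exists_mul_transpose_eq_of_posDef (hy.posDef t)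
  obtain ⟨π₀, hπ₀, hC₀, hm₀⟩ := M.exists_levelPosterior_zero y hy (hn 0) hL
  choose π' hπ' hC' hm' using fun t : Fin s => M.exists_levelPosterior_succ y hy t (hn t.succ) hL
  let π : ∀ t, Measure (D.LevelParam t) := Fin.cases π₀ π'
  have hπ : ∀ t, IsProbabilityMeasure (π t) := Fin.cases hπ₀ hπ'
  have hC : ∀ t, ∃ C : ℝ≥0∞, C ≠ 0 ∧ C ≠ ∞ ∧
    (D.levelBase t).withDensity (M.levelDensity L y t) = C • π t := Fin.cases hC₀ hC'
  choose C h0 h1 h2 using hC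
  exact ⟨fun t => M.levelLaw x₀ y t (π t), fun t => M.isProbabilityMeasure_levelLaw x₀ y t (π t),
    M.predictive_eq x₀ y hy.posDef hL π h0 h1 h2, hm₀ x₀, fun t => hm' t x₀⟩

theorem f_eq_add_smul_single (x₀ : 𝒳) (t : Fin s) (u m : ℝ) :
    M.f x₀ t u = M.f x₀ t m + (u - m) • Pi.single (Sum.inr ()) 1 := by
  ext (i | i) <;> simp [f]

/-- Mean and variance of the predictive distribution. -/
theorem predictive_moments (hy : M.Nondegenerate y) (hn : ∀ t, D.q t + 2 < D.n t) (x₀ : 𝒳) :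
    IsProbabilityMeasure (M.predictive x₀ y) ∧
    (∀ t, MemLp (fun u : Fin (s + 1) → ℝ => u t) 2 (M.predictive x₀ y)) ∧
    M.predictor x₀ y 0 = krigMean (M.R 0) (M.H 0) (y 0) (M.rvec x₀ 0) (M.h 0 x₀) ∧
    M.predVariance x₀ y 0 =
      ((D.n 0 : ℝ) - D.q 0) / ((D.n 0 : ℝ) - D.q 0 - 2) * glsVar (M.R 0) (M.H 0) (y 0) *
        (M.r 0 x₀ x₀ - krigReduction (M.R 0) (M.rvec x₀ 0) +
          glsTerm (M.R 0) (M.H 0) (M.rvec x₀ 0) (M.h 0 x₀)) ∧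
    ∀ t : Fin s,
      M.predictor x₀ y t.succ =
        krigMean (M.R t.succ) (M.X y t) (y t.succ) (M.rvec x₀ t.succ)
          (M.f x₀ t (M.predictor x₀ y t.castSucc)) ∧
      M.predVariance x₀ y t.succ =
        M.gammaHat y t ^ 2 * M.predVariance x₀ y t.castSucc +
        ((D.n t.succ : ℝ) - D.q t.succ) / ((D.n t.succ : ℝ) - D.q t.succ - 2) *
          glsVar (M.R t.succ) (M.X y t) (y t.succ) *
          (M.r t.succ x₀ x₀ - krigReduction (M.R t.succ) (M.rvec x₀ t.succ) +
            M.kappa x₀ y t (M.predictor x₀ y t.castSucc) (M.predVariance x₀ y t.castSucc)) := by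
  obtain ⟨l, hl, hpred, hm0, hms⟩ := M.exists_predictive_eq_arLaw y hy hn x₀
  have h2 : ∀ t, MemLp (fun p : ℝ × ℝ => p.2) 2 (l t) := fun t => by
    cases t using Fin.cases with
    | zero => simpa using (hm0 0).1
    | succ t => simpa using (hms t 0).1
  -- The first component is the difference of the affine combinations at `u = 1` and `u = 0`.
  have h1 : ∀ t : Fin s, MemLp (fun p : ℝ × ℝ => p.1) 2 (l t.succ) := fun t => by
    have h := (hms t 1).1.sub (hms t 0).1
    refine h.ae_eq (.of_forall fun p => ?_)
    simp
  simp only [predictor, predVariance, hpred]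
  refine ⟨inferInstance, memLp_arLaw h2 h1, ?_, ?_, fun t => ?_⟩
  · rw [integral_variance_arLaw_zero.1, ← (hm0 0).2.1]
    simp
  · rw [integral_variance_arLaw_zero.2, variance_eq_sub (h2 0)]
    have e1 := (hm0 0).2.1
    have e2 := (hm0 0).2.2
    simp only [mul_zero, zero_add] at e1 e2
    rw [e1]
    refine (congrArg (· - _) e2).trans ?_
    ring
  · set m := ∫ u, u t.castSucc ∂(arLaw l) with hm
    obtain ⟨T, hT⟩ := exists_glsTerm_add_smul_single (M.R t.succ) (M.X y t) (M.rvec x₀ t.succ)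
      (M.f x₀ t m) (Sum.inr ())
    have hmean : ∀ u, krigMean (M.R t.succ) (M.X y t) (y t.succ) (M.rvec x₀ t.succ) (M.f x₀ t u) =
        krigMean (M.R t.succ) (M.X y t) (y t.succ) (M.rvec x₀ t.succ) (M.f x₀ t m) +
          M.gammaHat y t * (u - m) := fun u => by
      rw [M.f_eq_add_smul_single x₀ t u m, krigMean_add_smul_single]
      rfl
    have hcov : glsCov (M.R t.succ) (M.X y t) (Sum.inr ()) (Sum.inr ()) =
      (D.W y t ⬝ᵥ (projQ (M.R t.succ) (M.H t.succ) *ᵥ D.W y t))⁻¹ :=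
      glsCov_inr_inr (hy.posDef _) (hy.indep_succ t)
    set c := ((D.n t.succ : ℝ) - D.q t.succ) / ((D.n t.succ : ℝ) - D.q t.succ - 2) *
      glsVar (M.R t.succ) (M.X y t) (y t.succ) with hc
    set ρ := M.r t.succ x₀ x₀ - krigReduction (M.R t.succ) (M.rvec x₀ t.succ) with hρ
    -- Regressors are expanded about the mean `m` of the level below: `T₀` is the conditional
    -- variance at `u = m`, and `T₂` supplies the second term of `kappa`.
    have key := integral_variance_arLaw_succ h2 h1 t
      (A := krigMean (M.R t.succ) (M.X y t) (y t.succ) (M.rvec x₀ t.succ) (M.f x₀ t m))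
      (γ := M.gammaHat y t)
      (T₀ := c * (ρ + glsTerm (M.R t.succ) (M.X y t) (M.rvec x₀ t.succ) (M.f x₀ t m)))
      (T₁ := c * T) (T₂ := c * glsCov (M.R t.succ) (M.X y t) (Sum.inr ()) (Sum.inr ()))
      (fun u => by rw [(hms t u).2.1, hmean u]) (fun u => by
        rw [(hms t u).2.2, ← hmean u, M.f_eq_add_smul_single x₀ t u m, hT]
        ring)
    refine ⟨key.1, key.2.trans ?_⟩
    rw [kappa, hcov]
    ring

end CokrigingModel

/-! ### Cost of straight-line computations -/

section Cost

variable {E ι : Type*} (inp : E → ι → ℝ)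

theorem runFrom_append (x : ι → ℝ) (m : List ℝ) (P Q : List (Instr ι)) :
    runFrom x m (P ++ Q) = (runFrom x m P).bind fun m' => runFrom x m' Q := by
  induction P generalizing m with
  | nil => rfl
  | cons i P ih =>
    simp only [List.cons_append, runFrom, Option.bind_assoc, ih]

/-- From the values of the functions in `S` one can compute the values of the functions in `T`
with at most `k` instructions, uniformly in the environment `e : E` that determines the inputs. -/
def Cost (S T : Set (E → ℝ)) (k : ℕ) : Prop :=
  ∀ l : List (E → ℝ), (∀ f ∈ S, f ∈ l) → ∃ (P : List (Instr ι)) (l' : List (E → ℝ)),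
    P.length ≤ k ∧ (∀ e, runFrom (inp e) (l.map (· e)) P = some ((l ++ l').map (· e))) ∧
      ∀ f ∈ T, f ∈ l ++ l'

variable {inp} {S S' T T' U : Set (E → ℝ)} {f g : E → ℝ} {a b k k' : ℕ}

namespace Cost

theorem mono_cost (h : Cost inp S T k) (hk : k ≤ k') : Cost inp S T k' := fun l hl =>
  let ⟨P, l', h1, h2⟩ := h l hl
  ⟨P, l', h1.trans hk, h2⟩

theorem mono_left (h : Cost inp S T k) (hS : S ⊆ S') : Cost inp S' T k :=
  fun l hl => h l fun f hf => hl f (hS hf)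

theorem mono_right (h : Cost inp S T k) (hT : T' ⊆ T) : Cost inp S T' k := fun l hl =>
  let ⟨P, l', h1, h2, h3⟩ := h l hl
  ⟨P, l', h1, h2, fun f hf => h3 f (hT hf)⟩

theorem of_subset (h : T ⊆ S) : Cost inp S T 0 := fun l hl =>
  ⟨[], [], le_rfl, fun e => by simp [runFrom], fun f hf => by simpa using hl f (h hf)⟩

theorem of_mem (h : f ∈ S) : Cost inp S {f} 0 := of_subset (Set.singleton_subset_iff.2 h)

/-- `Cost` quantifies over every memory containing the values of `S`, so the second program can run
on what the first one leaves behind, and nothing computed is ever lost. -/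
theorem bind_union (h : Cost inp S T a) (h' : Cost inp (S ∪ T) U b) :
    Cost inp S (T ∪ U) (a + b) := fun l hl => by
  obtain ⟨P, l', h1, h2, h3⟩ := h l hl
  obtain ⟨Q, l'', h1', h2', h3'⟩ := h' (l ++ l') fun f hf =>
    hf.elim (fun hf => List.mem_append_left _ (hl f hf)) (h3 f)
  refine ⟨P ++ Q, l' ++ l'', by rw [List.length_append]; omega, fun e => ?_, fun f hf => ?_⟩
  · rw [runFrom_append, h2, Option.bind_some, h2', List.append_assoc]
  · rw [← List.append_assoc]
    exact hf.elim (fun hf => List.mem_append_left _ (h3 f hf)) (h3' f)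

theorem bind (h : Cost inp S T a) (h' : Cost inp (S ∪ T) U b) : Cost inp S U (a + b) :=
  (h.bind_union h').mono_right Set.subset_union_right

theorem union (h : Cost inp S T a) (h' : Cost inp S U b) : Cost inp S (T ∪ U) (a + b) :=
  h.bind_union (h'.mono_left Set.subset_union_left)

theorem range {α : Type*} [Fintype α] {F : α → E → ℝ} (h : ∀ i, Cost inp S {F i} k) :
    Cost inp S (Set.range F) (Fintype.card α * k) := by
  classical
  have key : ∀ s : Finset α, Cost inp S (F '' s) (s.card * k) := fun s => by
    induction s using Finset.induction_on with
    | empty => exact (of_subset (by simp)).mono_cost (Nat.zero_le _)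
    | insert i s hi ih =>
      rw [Finset.card_insert_of_notMem hi, Nat.succ_mul, Finset.coe_insert, Set.image_insert_eq,
        Set.insert_eq, Set.union_comm]
      exact ih.union (h i)
  simpa using key Finset.univ

theorem of_instr (h : ∀ l : List (E → ℝ), (∀ f ∈ S, f ∈ l) →
    ∃ i : Instr ι, ∀ e, i.eval (inp e) (l.map (· e)) = some (f e)) : Cost inp S {f} 1 :=
  fun l hl => by
    obtain ⟨i, hi⟩ := h l hl
    refine ⟨[i], [f], le_rfl, fun e => ?_, fun f' hf' => ?_⟩
    · simp [runFrom, hi e]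
    · simp [Set.mem_singleton_iff.1 hf']

theorem input (i : ι) : Cost inp S {fun e => inp e i} 1 :=
  of_instr fun _ _ => ⟨.input i, fun _ => rfl⟩

theorem const (c : ℚ) : Cost inp S {fun _ => (c : ℝ)} 1 :=
  of_instr fun _ _ => ⟨.const c, fun _ => rfl⟩

theorem exists_getElem? {l : List (E → ℝ)} (hf : f ∈ l) :
    ∃ j : ℕ, ∀ e, (l.map (· e))[j]? = some (f e) := by
  obtain ⟨j, hj⟩ := List.mem_iff_getElem?.1 hf
  exact ⟨j, fun e => by rw [List.getElem?_map, hj]; rfl⟩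

theorem binary {φ : ℝ → ℝ → ℝ} {op : ℕ → ℕ → Instr ι}
    (hop : ∀ e (m : List ℝ) i j, m[i]? = some (f e) → m[j]? = some (g e) →
      (op i j).eval (inp e) m = some (φ (f e) (g e)))
    (hf : Cost inp S {f} a) (hg : Cost inp S {g} b) :
    Cost inp S {fun e => φ (f e) (g e)} (a + b + 1) :=
  (hf.union hg).bind <| of_instr fun l hl => by
    obtain ⟨i, hi⟩ := exists_getElem? (hl f (by simp))
    obtain ⟨j, hj⟩ := exists_getElem? (hl g (by simp))
    exact ⟨op i j, fun e => hop e _ i j (hi e) (hj e)⟩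

theorem add (hf : Cost inp S {f} a) (hg : Cost inp S {g} b) :
    Cost inp S {fun e => f e + g e} (a + b + 1) :=
  binary (φ := fun x y => x + y) (op := Instr.add) (fun e m i j h1 h2 => by simp [Instr.eval, h1, h2]) hf hg

theorem sub (hf : Cost inp S {f} a) (hg : Cost inp S {g} b) :
    Cost inp S {fun e => f e - g e} (a + b + 1) :=
  binary (φ := fun x y => x - y) (op := Instr.sub) (fun e m i j h1 h2 => by simp [Instr.eval, h1, h2]) hf hg

theorem mul (hf : Cost inp S {f} a) (hg : Cost inp S {g} b) :
    Cost inp S {fun e => f e * g e} (a + b + 1) :=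
  binary (φ := fun x y => x * y) (op := Instr.mul) (fun e m i j h1 h2 => by simp [Instr.eval, h1, h2]) hf hg

/-- The divisor must be nonzero in every environment, since the program cannot branch; this is why
environments will be restricted to nondegenerate problems. -/
theorem div (hf : Cost inp S {f} a) (hg : Cost inp S {g} b) (h0 : ∀ e, g e ≠ 0) :
    Cost inp S {fun e => f e / g e} (a + b + 1) :=
  binary (φ := fun x y => x / y) (op := Instr.div)
    (fun e m i j h1 h2 => by simp [Instr.eval, h1, h2, h0 e]) hf hg

theorem sum {α : Type*} (s : Finset α) {F : α → E → ℝ} (h : ∀ i, Cost inp S {F i} k) :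
    Cost inp S {fun e => ∑ i ∈ s, F i e} (s.card * (k + 1) + 1) := by
  classical
  induction s using Finset.induction_on with
  -- The empty sum still loads the constant zero: this is the final `+ 1`.
  | empty => simpa using const (inp := inp) (S := S) 0
  | insert i s hi ih =>
    simp only [Finset.sum_insert hi, Finset.card_insert_of_notMem hi]
    exact ((h i).add ih).mono_cost (by rw [Nat.succ_mul]; omega)

end Cost

/-! #### Vectors and matrices -/

/-- The coordinates of a vector that depends on the environment. -/
def coords {m : Type*} (v : E → m → ℝ) : Set (E → ℝ) := Set.range fun i e => v e i

/-- The entries of a matrix that depends on the environment. -/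
def entries {m n : Type*} (A : E → Matrix m n ℝ) : Set (E → ℝ) :=
  Set.range fun (p : m × n) e => A e p.1 p.2

theorem mem_coords {m : Type*} (v : E → m → ℝ) (i : m) : (fun e => v e i) ∈ coords v := ⟨i, rfl⟩

theorem mem_entries {m n : Type*} (A : E → Matrix m n ℝ) (i : m) (j : n) :
    (fun e => A e i j) ∈ entries A := ⟨(i, j), rfl⟩

namespace Cost

variable {l m n : Type*} {A : E → Matrix m n ℝ} {B : E → Matrix n l ℝ} {v w : E → n → ℝ}

theorem coord (h : Cost inp S (coords v) a) (i : n) : Cost inp S {fun e => v e i} a :=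
  h.mono_right (Set.singleton_subset_iff.2 (mem_coords v i))

theorem entry (h : Cost inp S (entries A) a) (i : m) (j : n) : Cost inp S {fun e => A e i j} a :=
  h.mono_right (Set.singleton_subset_iff.2 (mem_entries A i j))

theorem transpose (h : Cost inp S (entries A) a) : Cost inp S (entries fun e => (A e)ᵀ) a :=
  h.mono_right (by rintro _ ⟨p, rfl⟩; exact ⟨(p.2, p.1), rfl⟩)

theorem submatrix {m' n' : Type*} (h : Cost inp S (entries A) a) (φ : m' → m) (ψ : n' → n) :
    Cost inp S (entries fun e => (A e).submatrix φ ψ) a :=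
  h.mono_right (by rintro _ ⟨p, rfl⟩; exact ⟨(φ p.1, ψ p.2), rfl⟩)

variable [Fintype l] [Fintype m] [Fintype n]

theorem coords_sub (hv : Cost inp S (coords v) a) (hw : Cost inp S (coords w) b) :
    Cost inp S (coords fun e => v e - w e) (a + b + Fintype.card n) :=
  (hv.union hw).bind <| (range fun i =>
    ((of_mem (.inr (.inl (mem_coords v i)))).sub
      (of_mem (.inr (.inr (mem_coords w i)))))).mono_cost (by simp)

theorem sum_mul {f g : n → E → ℝ} (hf : ∀ i, f i ∈ S) (hg : ∀ i, g i ∈ S) :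
    Cost inp S {fun e => ∑ i, f i e * g i e} (2 * Fintype.card n + 1) :=
  (sum Finset.univ fun i => (of_mem (hf i)).mul (of_mem (hg i))).mono_cost
    (by rw [Finset.card_univ]; omega)

theorem dotProduct (hv : Cost inp S (coords v) a) (hw : Cost inp S (coords w) b) :
    Cost inp S {fun e => v e ⬝ᵥ w e} (a + b + (2 * Fintype.card n + 1)) :=
  (hv.union hw).bind <| sum_mul (fun i => .inr (.inl (mem_coords v i)))
    fun i => .inr (.inr (mem_coords w i))

theorem mulVec (hA : Cost inp S (entries A) a) (hv : Cost inp S (coords v) b) :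
    Cost inp S (coords fun e => A e *ᵥ v e)
      (a + b + Fintype.card m * (2 * Fintype.card n + 1)) :=
  (hA.union hv).bind <| range fun i => sum_mul (fun j => .inr (.inl (mem_entries A i j)))
    fun j => .inr (.inr (mem_coords v j))

theorem matrix_mul (hA : Cost inp S (entries A) a) (hB : Cost inp S (entries B) b) :
    Cost inp S (entries fun e => A e * B e)
      (a + b + Fintype.card m * Fintype.card l * (2 * Fintype.card n + 1)) := by
  rw [← Fintype.card_prod]
  exact (hA.union hB).bind <| range fun p : m × l => sum_mul
    (fun j => .inr (.inl (mem_entries A p.1 j))) fun j => .inr (.inr (mem_entries B j p.2))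

end Cost

/-! #### Inversion of positive definite matrices by bordering -/

section Inv

/-- Block inversion with the scalar Schur complement `c - b ⬝ᵥ u`, checked by multiplying out. The
entries are written with the available instructions, whence `0 - x` for a negation. -/
theorem inv_fromBlocks_border {m : Type*} [Fintype m] [DecidableEq m] {B : Matrix m m ℝ}
    {b u : m → ℝ} {c : ℝ} (hB : IsUnit B.det) (hBT : Bᵀ = B) (hu : u = B⁻¹ *ᵥ b)
    (hσ : c - b ⬝ᵥ u ≠ 0) :
    (fromBlocks B (replicateCol (Fin 1) b) (replicateRow (Fin 1) b) (of fun _ _ => c))⁻¹ =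
      fromBlocks (B⁻¹ + of fun i j => u i * (u j / (c - b ⬝ᵥ u)))
        (replicateCol (Fin 1) fun i => 0 - u i / (c - b ⬝ᵥ u))
        (replicateRow (Fin 1) fun i => 0 - u i / (c - b ⬝ᵥ u)) (of fun _ _ => 1 / (c - b ⬝ᵥ u)) := by
  have hBu : B *ᵥ u = b := by
    rw [hu, mulVec_mulVec, Matrix.mul_nonsing_inv _ hB, one_mulVec]
  have hbu : ∀ i, ∑ j, B i j * u j = b i := fun i => congrFun hBu i
  have hub : b ᵥ* B⁻¹ = u := by
    rw [← mulVec_transpose, transpose_nonsing_inv, hBT, hu]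
  have hub' : ∀ j, ∑ i, b i * B⁻¹ i j = u j := fun i => congrFun hub i
  set σ := c - b ⬝ᵥ u with hσd
  have hc : ∑ i, b i * u i = c - σ := by rw [hσd, sub_sub_cancel]; rfl
  refine Matrix.inv_eq_right_inv ?_
  rw [fromBlocks_multiply, ← fromBlocks_one]
  congr 1
  · rw [Matrix.mul_add, Matrix.mul_nonsing_inv _ hB, add_assoc]
    convert add_zero _
    ext i j
    simp only [Matrix.add_apply, mul_apply, of_apply, replicateCol_apply, replicateRow_apply,
      Finset.univ_unique, Finset.sum_singleton, ← mul_assoc, ← Finset.sum_mul, hbu, Matrix.zero_apply]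
    ring
  · ext i j
    simp only [Matrix.add_apply, mul_apply, of_apply, replicateCol_apply,
      Finset.univ_unique, Finset.sum_singleton, zero_sub, mul_neg, Finset.sum_neg_distrib, mul_div,
      ← Finset.sum_div, hbu, Matrix.zero_apply]
    ring
  · ext i j
    simp only [Matrix.mul_add, Matrix.add_apply, mul_apply, of_apply, replicateRow_apply,
      Finset.univ_unique, Finset.sum_singleton, ← mul_assoc, ← Finset.sum_mul, hub', hc, Matrix.zero_apply]
    field_simp
    ring
  · ext i j
    obtain rfl : i = j := Subsingleton.elim i j
    simp only [Matrix.add_apply, mul_apply, of_apply, replicateCol_apply, replicateRow_apply,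
      Finset.univ_unique, Finset.sum_singleton, zero_sub, mul_neg, Finset.sum_neg_distrib, mul_div,
      ← Finset.sum_div, hc, one_apply_eq]
    field_simp
    ring

/-- The quadratic form at the vector `(-u, 1)` is exactly this Schur complement, so it cannot
vanish. -/
theorem schur_ne_zero_of_posDef {m : Type*} [Fintype m] [DecidableEq m] {B : Matrix m m ℝ}
    {b : m → ℝ} {c : ℝ} (h : (fromBlocks B (replicateCol (Fin 1) b) (replicateRow (Fin 1) b)
      (of fun _ _ => c)).PosDef) (hB : IsUnit B.det) : c - b ⬝ᵥ (B⁻¹ *ᵥ b) ≠ 0 := by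
  set u := B⁻¹ *ᵥ b with hu
  have hBu : B *ᵥ u = b := by
    rw [hu, mulVec_mulVec, Matrix.mul_nonsing_inv _ hB, one_mulVec]
  intro h0
  have h := h.dotProduct_mulVec_pos
    (x := Sum.elim (-u) fun _ => 1) fun h => one_ne_zero (congrFun h (Sum.inr 0))
  rw [fromBlocks_mulVec, Sum.elim_comp_inl, Sum.elim_comp_inr, mulVec_neg, mulVec_neg, hBu] at h
  have h1 : -(replicateRow (Fin 1) b *ᵥ u) + of (fun _ _ => c) *ᵥ (fun _ : Fin 1 => (1 : ℝ)) =
      0 := by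
    ext i
    simp only [Pi.add_apply, Pi.neg_apply, replicateRow_apply, mulVec, dotProduct, of_apply, Finset.univ_unique,
      Finset.sum_singleton, mul_one, Pi.zero_apply] at h0 ⊢
    linarith
  have h2 : -b + replicateCol (Fin 1) b *ᵥ (fun _ : Fin 1 => (1 : ℝ)) = 0 := by
    ext i
    simp [mulVec, dotProduct]
  rw [h1, h2] at h
  simp [dotProduct] at h

/-- Induction on the size. Removing the last row and column leaves a positive definite matrix, so no
pivoting is needed, and restoring them costs one matrix-vector product, one inner product and a
rank-one update. -/
theorem Cost.inv_fin {k : ℕ} : ∀ {S : Set (E → ℝ)} {A : E → Matrix (Fin k) (Fin k) ℝ},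
    entries A ⊆ S → (∀ e, (A e).PosDef) →
    Cost inp S (entries fun e => (A e)⁻¹) (5 * k ^ 3) := by
  induction k with
  | zero =>
    intro S A _ _
    exact of_subset (by rintro _ ⟨p, rfl⟩; exact p.1.elim0)
  | succ k ih =>
    intro S A hA hpos
    set φ : Fin k ⊕ Fin 1 ≃ Fin (k + 1) := finSumFinEquiv with hφ
    set B : E → Matrix (Fin k) (Fin k) ℝ := fun e => (A e).submatrix (φ ∘ Sum.inl) (φ ∘ Sum.inl)
    set b : E → Fin k → ℝ := fun e i => A e (φ (.inl i)) (φ (.inr 0)) with hb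
    set c : E → ℝ := fun e => A e (φ (.inr 0)) (φ (.inr 0)) with hc
    set u : E → Fin k → ℝ := fun e => (B e)⁻¹ *ᵥ b e with hu
    set σ : E → ℝ := fun e => c e - b e ⬝ᵥ u e with hσ
    have hBpos : ∀ e, (B e).PosDef := fun e =>
      (hpos e).submatrix (φ.injective.comp Sum.inl_injective)
    have hAT : ∀ e i j, A e i j = A e j i := fun e i j => by
      simpa using ((hpos e).isHermitian.apply i j).symm
    have hblock : ∀ e, (A e).submatrix φ φ = fromBlocks (B e) (replicateCol (Fin 1) (b e))
        (replicateRow (Fin 1) (b e)) (of fun _ _ => c e) := fun e => by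
      ext (i | i) (j | j)
      · rfl
      · rw [Subsingleton.elim j 0]; rfl
      · rw [Subsingleton.elim i 0]; exact hAT _ _ _
      · rw [Subsingleton.elim i 0, Subsingleton.elim j 0]; rfl
    have hσpos : ∀ e, σ e ≠ 0 := fun e =>
      schur_ne_zero_of_posDef ((hpos e).submatrix φ.injective |> (hblock e ▸ ·))
        (hBpos e).det_pos.ne'.isUnit
    have hinv : ∀ e, (A e)⁻¹ = (fromBlocks ((B e)⁻¹ + of fun i j => u e i * (u e j / σ e))
        (replicateCol (Fin 1) fun i => 0 - u e i / σ e)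
        (replicateRow (Fin 1) fun i => 0 - u e i / σ e)
        (of fun _ _ => 1 / σ e)).submatrix φ.symm φ.symm := fun e => by
      rw [← inv_fromBlocks_border (hBpos e).det_pos.ne'.isUnit (by ext i j; exact hAT _ _ _) rfl
        (hσpos e), ← hblock, inv_submatrix_equiv]
      simp
    have hentry : ∀ i j, (fun e => A e i j) ∈ S := fun i j => hA (mem_entries A i j)
    have hBS : entries B ⊆ S := by rintro _ ⟨p, rfl⟩; exact hentry _ _
    have hbS : coords b ⊆ S := by rintro _ ⟨p, rfl⟩; exact hentry _ _
    have h1 := ih hBS hBpos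
    have h2 : Cost inp (S ∪ entries fun e => (B e)⁻¹) (coords u) _ :=
      mulVec (of_subset Set.subset_union_right) (of_subset (hbS.trans Set.subset_union_left))
    have h3 : Cost inp ((S ∪ entries fun e => (B e)⁻¹) ∪ coords u) {σ} _ :=
      sub (of_mem (.inl (.inl (hentry _ _))))
        (dotProduct (of_subset fun f hf => .inl (.inl (hbS hf))) (of_subset Set.subset_union_right))
    have h4 : Cost inp (((S ∪ entries fun e => (B e)⁻¹) ∪ coords u) ∪ {σ})
        (entries fun e => (A e)⁻¹) (Fintype.card (Fin (k + 1) × Fin (k + 1)) * 3) := by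
      refine range fun p => ?_
      simp only [hinv, submatrix_apply]
      have hmB : ∀ i j, Cost inp (((S ∪ entries fun e => (B e)⁻¹) ∪ coords u) ∪ {σ})
        {fun e => (B e)⁻¹ i j} 0 := fun i j => of_mem (.inl (.inl (.inr (mem_entries _ i j))))
      have hmu : ∀ i, Cost inp (((S ∪ entries fun e => (B e)⁻¹) ∪ coords u) ∪ {σ})
        {fun e => u e i} 0 := fun i => of_mem (.inl (.inr (mem_coords u i)))
      have hmσ : Cost inp (((S ∪ entries fun e => (B e)⁻¹) ∪ coords u) ∪ {σ}) {σ} 0 :=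
        of_mem (.inr rfl)
      have hside : ∀ i, Cost inp (((S ∪ entries fun e => (B e)⁻¹) ∪ coords u) ∪ {σ})
          {fun e => 0 - u e i / σ e} 3 := fun i => by
        simpa using (const 0).sub ((hmu i).div hmσ hσpos)
      rcases φ.symm p.1 with i | i <;> rcases φ.symm p.2 with j | j
      · exact (hmB i j).add ((hmu i).mul ((hmu j).div hmσ hσpos))
      · exact hside i
      · exact hside j
      · simpa using ((const 1).div hmσ hσpos).mono_cost (by norm_num : _ ≤ 3)
    -- The new work is `k (2k + 1) + (2k + 2) + 3 (k + 1)² = 5k² + 9k + 5`, at most `5 (k + 1)³ -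
    -- 5k³`.
    refine (h1.bind (h2.bind (h3.bind h4))).mono_cost ?_
    simp only [Fintype.card_prod, Fintype.card_fin]
    nlinarith

theorem Cost.matrix_inv {m : Type*} [Fintype m] [DecidableEq m] {A : E → Matrix m m ℝ}
    (hA : Cost inp S (entries A) a) (hpos : ∀ e, (A e).PosDef) :
    Cost inp S (entries fun e => (A e)⁻¹) (a + 5 * Fintype.card m ^ 3) := by
  set φ := Fintype.equivFin m
  have h : ∀ e, (A e)⁻¹ = (((A e).submatrix φ.symm φ.symm)⁻¹).submatrix φ φ := fun e => by
    rw [← inv_submatrix_equiv]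
    simp
  simp only [h]
  refine hA.bind (Cost.submatrix (Cost.inv_fin ?_ fun e => (hpos e).submatrix φ.symm.injective) φ φ)
  rintro _ ⟨p, rfl⟩
  exact .inr (mem_entries A _ _)

end Inv

end Cost

/-! ### Cost of the kriging formulas -/

section KrigCost

variable {E η : Type*} (inp : E → η → ℝ) (N : ℕ)

/-- Computability with at most `c N ^ 3` instructions. -/
def CubicCost (S T : Set (E → ℝ)) (c : ℕ) : Prop := Cost inp S T (c * N ^ 3)

variable {inp N} {S T T' : Set (E → ℝ)} {f g : E → ℝ} {a b c : ℕ}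

namespace CubicCost

theorem mono (h : CubicCost inp N S T a) (hab : a ≤ b) : CubicCost inp N S T b :=
  Cost.mono_cost h (Nat.mul_le_mul_right _ hab)

theorem of_cost {k : ℕ} (h : Cost inp S T k) (hk : k ≤ N ^ 3) : CubicCost inp N S T 1 :=
  h.mono_cost (by rwa [one_mul])

theorem union (h : CubicCost inp N S T a) (h' : CubicCost inp N S T' b) :
    CubicCost inp N S (T ∪ T') (a + b) :=
  (Cost.union h h').mono_cost (by rw [add_mul])

section Ops

variable (hN : 1 ≤ N)
include hN

theorem const (q : ℚ) : CubicCost inp N S {fun _ => (q : ℝ)} 1 :=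
  of_cost (Cost.const q) (Nat.one_le_pow _ _ hN)

theorem add (hf : CubicCost inp N S {f} a) (hg : CubicCost inp N S {g} b) :
    CubicCost inp N S {fun e => f e + g e} (a + b + 1) :=
  (Cost.add hf hg).mono_cost (by rw [add_mul, add_mul, one_mul]; gcongr; exact Nat.one_le_pow _ _ hN)

theorem sub (hf : CubicCost inp N S {f} a) (hg : CubicCost inp N S {g} b) :
    CubicCost inp N S {fun e => f e - g e} (a + b + 1) :=
  (Cost.sub hf hg).mono_cost (by rw [add_mul, add_mul, one_mul]; gcongr; exact Nat.one_le_pow _ _ hN)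

theorem mul (hf : CubicCost inp N S {f} a) (hg : CubicCost inp N S {g} b) :
    CubicCost inp N S {fun e => f e * g e} (a + b + 1) :=
  (Cost.mul hf hg).mono_cost (by rw [add_mul, add_mul, one_mul]; gcongr; exact Nat.one_le_pow _ _ hN)

variable {l m n : Type*} [Fintype l] [Fintype m] [Fintype n] {A : E → Matrix m n ℝ}
  {B : E → Matrix n l ℝ} {v w : E → n → ℝ}

omit hN in
theorem coords_sub (hn : Fintype.card n ≤ N) (hv : CubicCost inp N S (coords v) a)
    (hw : CubicCost inp N S (coords w) b) :
    CubicCost inp N S (coords fun e => v e - w e) (a + b + 1) :=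
  (Cost.coords_sub hv hw).mono_cost (by
    rw [add_mul, add_mul, one_mul]
    gcongr
    exact hn.trans (Nat.le_self_pow (by norm_num) N))

theorem dotProduct (hn : Fintype.card n ≤ N) (hv : CubicCost inp N S (coords v) a)
    (hw : CubicCost inp N S (coords w) b) :
    CubicCost inp N S {fun e => v e ⬝ᵥ w e} (a + b + 3) :=
  (Cost.dotProduct hv hw).mono_cost (by
    have h1 : N ≤ N ^ 3 := Nat.le_self_pow (by norm_num) N
    rw [add_mul, add_mul]
    gcongr
    omega)

theorem mulVec (hm : Fintype.card m ≤ N) (hn : Fintype.card n ≤ N)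
    (hA : CubicCost inp N S (entries A) a) (hv : CubicCost inp N S (coords v) b) :
    CubicCost inp N S (coords fun e => A e *ᵥ v e) (a + b + 3) :=
  (Cost.mulVec hA hv).mono_cost (by
    rw [add_mul, add_mul]
    refine Nat.add_le_add_left ?_ _
    calc _ ≤ N * (2 * N + 1) := by gcongr
      _ ≤ N * (3 * N ^ 2) := Nat.mul_le_mul_left _ (by nlinarith)
      _ = _ := by ring)

theorem matrix_mul (hm : Fintype.card m ≤ N) (hn : Fintype.card n ≤ N) (hl : Fintype.card l ≤ N)
    (hA : CubicCost inp N S (entries A) a) (hB : CubicCost inp N S (entries B) b) :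
    CubicCost inp N S (entries fun e => A e * B e) (a + b + 3) :=
  (Cost.matrix_mul hA hB).mono_cost (by
    rw [add_mul, add_mul]
    refine Nat.add_le_add_left ?_ _
    calc _ ≤ N * N * (2 * N + 1) := by gcongr
      _ ≤ N * N * (3 * N) := Nat.mul_le_mul_left _ (by omega)
      _ = _ := by ring)

omit hN in
theorem matrix_inv [DecidableEq m] {A : E → Matrix m m ℝ} (hm : Fintype.card m ≤ N)
    (hA : CubicCost inp N S (entries A) a) (hpos : ∀ e, (A e).PosDef) :
    CubicCost inp N S (entries fun e => (A e)⁻¹) (a + 5) :=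
  (Cost.matrix_inv hA hpos).mono_cost (by rw [add_mul]; gcongr)

end Ops

section Krig

variable {ι κ : Type*} [Fintype ι] [Fintype κ] {R : E → Matrix ι ι ℝ} {X : E → Matrix ι κ ℝ}
  {y r₀ : E → ι → ℝ} {f₀ : E → κ → ℝ} (hN : 1 ≤ N) (hι : Fintype.card ι ≤ N)
  (hκ : Fintype.card κ ≤ N) (hpos : ∀ e, (R e).PosDef)
  (hX : ∀ e, LinearIndependent ℝ (X e).col) (cR : CubicCost inp N S (entries R) 1)
  (cX : CubicCost inp N S (entries X) 1) (cy : CubicCost inp N S (coords y) 1)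
  (cr : CubicCost inp N S (coords r₀) 1) (cf : CubicCost inp N S (coords f₀) 1)

include hN hι hpos cR

-- The constants of this section add up mechanically: one for each input array, three for each
-- product, five for each inversion, one for each sum or difference. Repeated subexpressions are
-- counted again each time.
include cr in
theorem krigReduction : CubicCost inp N S {fun e => krigReduction (R e) (r₀ e)} 14 := by
  classical
  exact dotProduct hN hι cr (mulVec hN hι hι (matrix_inv hι cR hpos) cr)

include hκ hX cX

theorem glsCov : CubicCost inp N S (entries fun e => glsCov (R e) (X e)) 19 := by
  classical
  exact matrix_inv hκ (matrix_mul hN hκ hι hκ (matrix_mul hN hκ hι hι (Cost.transpose cX)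
    (matrix_inv hι cR hpos)) cX) fun e => posDef_gls (hpos e) (hX e)

include cr cf in
theorem glsTerm : CubicCost inp N S {fun e => glsTerm (R e) (X e) (r₀ e) (f₀ e)} 57 := by
  classical
  have hd := coords_sub hκ cf (mulVec hN hκ hι (Cost.transpose cX)
    (mulVec hN hι hι (matrix_inv hι cR hpos) cr))
  exact dotProduct hN hκ hd (mulVec hN hκ hκ (glsCov hN hι hκ hpos hX cR cX) hd)

include cy

theorem glsCoef : CubicCost inp N S (coords fun e => glsCoef (R e) (X e) (y e)) 36 := by
  classical
  exact mulVec hN hκ hκ (glsCov hN hι hκ hpos hX cR cX) (mulVec hN hκ hι (Cost.transpose cX)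
    (mulVec hN hι hι (matrix_inv hι cR hpos) cy))

theorem glsResid : CubicCost inp N S (coords fun e => glsResid (R e) (X e) (y e)) 42 :=
  coords_sub hι cy (mulVec hN hι hκ cX (glsCoef hN hι hκ hpos hX cR cX cy))

theorem glsVar : CubicCost inp N S {fun e => glsVar (R e) (X e) (y e)} 98 := by
  classical
  have hr := glsResid hN hι hκ hpos hX cR cX cy
  -- Division by `n - q` becomes multiplication by a rational constant fixed by the design.
  have h := mul hN (dotProduct hN hι hr (mulVec hN hι hι (matrix_inv hι cR hpos) hr))
    (const hN ((Fintype.card ι : ℚ) - Fintype.card κ)⁻¹)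
  push_cast at h
  exact h

include cr cf in
theorem krigMean :
    CubicCost inp N S {fun e => krigMean (R e) (X e) (y e) (r₀ e) (f₀ e)} 96 := by
  classical
  exact add hN (dotProduct hN hκ cf (glsCoef hN hι hκ hpos hX cR cX cy))
    (dotProduct hN hι cr (mulVec hN hι hι (matrix_inv hι cR hpos)
      (glsResid hN hι hκ hpos hX cR cX cy)))

end Krig

end CubicCost

end KrigCost

/-! ### Cost of cokriging -/

/-- Each level needs only the results of the level below, and these remain in memory, so the costs
add instead of compounding. -/
theorem Cost.iUnion_levels {E ι : Type*} {inp : E → ι → ℝ} : ∀ {s : ℕ}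
    {T : Fin (s + 1) → Set (E → ℝ)} {k : Fin (s + 1) → ℕ}, Cost inp ∅ (T 0) (k 0) →
    (∀ t : Fin s, Cost inp (T t.castSucc) (T t.succ) (k t.succ)) →
    Cost inp ∅ (⋃ t, T t) (∑ t, k t) := by
  intro s
  induction s with
  | zero =>
    intro T k h0 _
    rw [Fin.sum_univ_one]
    exact h0.mono_right (Set.iUnion_subset fun t => by rw [Fin.fin_one_eq_zero t])
  | succ s ih =>
    intro T k h0 hs
    have h := ih (T := fun t => T t.castSucc) (k := fun t => k t.castSucc) h0
      fun t => hs t.castSucc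
    have h1 := h.bind_union ((hs (Fin.last s)).mono_left ((Set.subset_iUnion
      (fun t : Fin (s + 1) => T t.castSucc) (Fin.last s)).trans Set.subset_union_right))
    rw [Fin.sum_univ_castSucc]
    refine h1.mono_right (Set.iUnion_subset fun t => ?_)
    cases t using Fin.lastCases with
    | last => exact Set.subset_union_right
    | cast t =>
      exact (Set.subset_iUnion (fun t : Fin (s + 1) => T t.castSucc) t).trans
        Set.subset_union_left

namespace CubicCost

variable {E η : Type*} {inp : E → η → ℝ} {N : ℕ} {S : Set (E → ℝ)}

theorem coords_of_le_one {m : Type*} [Fintype m] {v : E → m → ℝ} (hm : Fintype.card m ≤ N)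
    (h : ∀ i, Cost inp S {fun e => v e i} 1) : CubicCost inp N S (coords v) 1 :=
  of_cost (Cost.range h) (by
    rw [mul_one]
    exact hm.trans (Nat.le_self_pow (by norm_num) N))

theorem entries_of_le_one {m n : Type*} [Fintype m] [Fintype n] {A : E → Matrix m n ℝ}
    (hN : 1 ≤ N) (hm : Fintype.card m ≤ N) (hn : Fintype.card n ≤ N)
    (h : ∀ i j, Cost inp S {fun e => A e i j} 1) : CubicCost inp N S (entries A) 1 :=
  of_cost (Cost.range fun p => h p.1 p.2) (by
    rw [mul_one, Fintype.card_prod]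
    calc _ ≤ N * N := by gcongr
      _ = N ^ 2 := by ring
      _ ≤ N ^ 3 := Nat.pow_le_pow_right hN (by norm_num))

end CubicCost

namespace CokrigingDesign

variable {𝒳 : Type*} {s : ℕ} (D : CokrigingDesign 𝒳 s)

/-- The nondegenerate cokriging problems with design `D`. -/
abbrev Problem : Type _ :=
  {e : CokrigingModel D × 𝒳 × D.Data // e.1.Nondegenerate e.2.2}

namespace Problem

variable {D}

/-- The inputs of a cokriging problem. -/
noncomputable def value (e : D.Problem) : CokrigingInput D → ℝ :=
  e.1.1.inputValue e.1.2.1 e.1.2.2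

/-- The cokriging predictor, as a function of the problem. -/
noncomputable def mean (t : Fin (s + 1)) (e : D.Problem) : ℝ := e.1.1.predictor e.1.2.1 e.1.2.2 t

/-- The cokriging variance, as a function of the problem. -/
noncomputable def var (t : Fin (s + 1)) (e : D.Problem) : ℝ :=
  e.1.1.predVariance e.1.2.1 e.1.2.2 t

theorem cost_of_input {S : Set (D.Problem → ℝ)} {f : D.Problem → ℝ} (i : CokrigingInput D)
    (h : ∀ e, f e = e.value i) : Cost value S {f} 1 := by
  rw [funext h]
  exact Cost.input (inp := value) i

theorem cubicCost_zero (hn : ∀ t, D.q t + 2 < D.n t) :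
    CubicCost value (D.n 0) ∅ ({mean (D := D) 0} ∪ {var 0}) 369 := by
  have hN : 1 ≤ D.n 0 := by have := hn 0; omega
  have hι : Fintype.card (D.pts 0) ≤ D.n 0 := (Fintype.card_coe _).le
  have hκ : Fintype.card (Fin (D.p 0)) ≤ D.n 0 := by
    have := hn 0
    have hq : D.q 0 = D.p 0 := by simp [CokrigingDesign.q]
    rw [Fintype.card_fin]
    omega
  have hpos : ∀ e : D.Problem, (e.1.1.R 0).PosDef := fun e => e.2.posDef 0
  have hX : ∀ e : D.Problem, LinearIndependent ℝ (e.1.1.H 0).col := fun e => e.2.indep_zero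
  have cR : CubicCost value (D.n 0) ∅ (entries fun e : D.Problem => e.1.1.R 0) 1 :=
    .entries_of_le_one hN hι hι fun i j => cost_of_input (.corr 0 i j) fun e => rfl
  have cX : CubicCost value (D.n 0) ∅ (entries fun e : D.Problem => e.1.1.H 0) 1 :=
    .entries_of_le_one hN hι hκ fun i j => cost_of_input (.basis 0 i j) fun e => rfl
  have cy : CubicCost value (D.n 0) ∅ (coords fun e : D.Problem => e.1.2.2 0) 1 :=
    .coords_of_le_one hι fun i => cost_of_input (.output 0 i) fun e => rfl
  have cr : CubicCost value (D.n 0) ∅ (coords fun e : D.Problem => e.1.1.rvec e.1.2.1 0) 1 :=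
    .coords_of_le_one hι fun i => cost_of_input (.corrNew 0 i) fun e => rfl
  have cf : CubicCost value (D.n 0) ∅ (coords fun e : D.Problem => e.1.1.h 0 e.1.2.1) 1 :=
    .coords_of_le_one hκ fun i => cost_of_input (.basisNew 0 i) fun e => rfl
  have cs : CubicCost value (D.n 0) ∅ {fun e : D.Problem => e.1.1.r 0 e.1.2.1 e.1.2.1} 1 :=
    .of_cost (cost_of_input (.corrSelf 0) fun e => rfl) (Nat.one_le_pow _ _ hN)
  have hc := CubicCost.const (inp := value (D := D)) (S := ∅) hN
    (((D.n 0 : ℚ) - D.q 0) / ((D.n 0 : ℚ) - D.q 0 - 2))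
  push_cast at hc
  have hm := CubicCost.krigMean hN hι hκ hpos hX cR cX cy cr cf
  have hv := CubicCost.mul hN
    (CubicCost.mul hN hc (CubicCost.glsVar hN hι hκ hpos hX cR cX cy))
    (CubicCost.add hN (CubicCost.sub hN cs (CubicCost.krigReduction hN hι hpos cR cr))
      (CubicCost.glsTerm hN hι hκ hpos hX cR cX cr cf))
  have key := fun e : D.Problem => e.1.1.predictive_moments e.1.2.2 e.2 hn e.1.2.1
  have em : mean (D := D) 0 = _ := funext fun e => (key e).2.2.1
  have ev : var (D := D) 0 = _ := funext fun e => (key e).2.2.2.1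
  rw [em, ev]
  exact (hm.union hv).mono (by norm_num)

/-- The predictor below enters as one more regressor at `x₀` and the variance below as a scalar, so
one level is a fixed arithmetic formula in matrices of size at most `n_t`. -/
theorem cubicCost_succ (hn : ∀ t, D.q t + 2 < D.n t) (t : Fin s) :
    CubicCost value (D.n t.succ) ({mean (D := D) t.castSucc} ∪ {var t.castSucc})
      ({mean t.succ} ∪ {var t.succ}) 369 := by
  set S : Set (D.Problem → ℝ) := {mean t.castSucc} ∪ {var t.castSucc} with hS
  have hN : 1 ≤ D.n t.succ := by have := hn t.succ; omega
  have hι : Fintype.card (D.pts t.succ) ≤ D.n t.succ := (Fintype.card_coe _).le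
  have hκ : Fintype.card (Fin (D.p t.succ) ⊕ Unit) ≤ D.n t.succ := by
    have := hn t.succ
    have hq : D.q t.succ = D.p t.succ + 1 := by simp [CokrigingDesign.q]
    rw [Fintype.card_sum, Fintype.card_fin, Fintype.card_unit]
    omega
  have hpos : ∀ e : D.Problem, (e.1.1.R t.succ).PosDef := fun e => e.2.posDef _
  have hX : ∀ e : D.Problem, LinearIndependent ℝ (e.1.1.X e.1.2.2 t).col :=
    fun e => e.2.indep_succ t
  have cR : CubicCost value (D.n t.succ) S (entries fun e : D.Problem => e.1.1.R t.succ) 1 :=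
    .entries_of_le_one hN hι hι fun i j => cost_of_input (.corr t.succ i j) fun e => rfl
  have cX : CubicCost value (D.n t.succ) S (entries fun e : D.Problem => e.1.1.X e.1.2.2 t) 1 :=
    .entries_of_le_one hN hι hκ fun i j => match j with
      | .inl j => cost_of_input (.basis t.succ i j) fun e => rfl
      | .inr _ => cost_of_input (.output t.castSucc ⟨i.1, D.nested t i.2⟩) fun e => rfl
  have cy : CubicCost value (D.n t.succ) S (coords fun e : D.Problem => e.1.2.2 t.succ) 1 :=
    .coords_of_le_one hι fun i => cost_of_input (.output t.succ i) fun e => rfl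
  have cr : CubicCost value (D.n t.succ) S
      (coords fun e : D.Problem => e.1.1.rvec e.1.2.1 t.succ) 1 :=
    .coords_of_le_one hι fun i => cost_of_input (.corrNew t.succ i) fun e => rfl
  have cf : CubicCost value (D.n t.succ) S
      (coords fun e : D.Problem => e.1.1.f e.1.2.1 t (mean t.castSucc e)) 1 :=
    .coords_of_le_one hκ fun i => match i with
      | .inl i => cost_of_input (.basisNew t.succ i) fun e => rfl
      | .inr _ => (Cost.of_mem (.inl rfl : mean t.castSucc ∈ S)).mono_cost zero_le_one
  have cs : CubicCost value (D.n t.succ) S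
      {fun e : D.Problem => e.1.1.r t.succ e.1.2.1 e.1.2.1} 1 :=
    .of_cost (cost_of_input (.corrSelf t.succ) fun e => rfl) (Nat.one_le_pow _ _ hN)
  have cV : CubicCost value (D.n t.succ) S {var t.castSucc} 1 :=
    .of_cost (Cost.of_mem (.inr rfl)) (Nat.zero_le _)
  have hc := CubicCost.const (inp := value (D := D)) (S := S) hN
    (((D.n t.succ : ℚ) - D.q t.succ) / ((D.n t.succ : ℚ) - D.q t.succ - 2))
  push_cast at hc
  have cγ := Cost.coord (CubicCost.glsCoef hN hι hκ hpos hX cR cX cy) (Sum.inr ())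
  have cK := Cost.entry (CubicCost.glsCov hN hι hκ hpos hX cR cX) (Sum.inr ()) (Sum.inr ())
  have hm := CubicCost.krigMean hN hι hκ hpos hX cR cX cy cr cf
  have hv := CubicCost.add hN (CubicCost.mul hN (CubicCost.mul hN cγ cγ) cV) (CubicCost.mul hN
    (CubicCost.mul hN hc (CubicCost.glsVar hN hι hκ hpos hX cR cX cy))
    (CubicCost.add hN (CubicCost.sub hN cs (CubicCost.krigReduction hN hι hpos cR cr))
      (CubicCost.add hN (CubicCost.glsTerm hN hι hκ hpos hX cR cX cr cf)
        (CubicCost.mul hN cV cK))))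
  have key := fun e : D.Problem => (e.1.1.predictive_moments e.1.2.2 e.2 hn e.1.2.1).2.2.2.2 t
  have em : mean (D := D) t.succ = _ := funext fun e => (key e).1
  -- The factor `(Wᵀ Q W)⁻¹` is read off as a diagonal entry of `glsCov`; the matrix `projQ` is
  -- never formed.
  have ev : var (D := D) t.succ = _ := funext fun e => (key e).2.trans (by
    rw [CokrigingModel.kappa, ← glsCov_inr_inr (e.2.posDef t.succ) (e.2.indep_succ t), pow_two])
  rw [em, ev]
  -- The absolute constant: 96 for the mean and 273 for the variance, that is 369; level `0` needs
  -- less.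
  exact (hm.union hv).mono (by norm_num)

theorem cost_mean_var (hn : ∀ t, D.q t + 2 < D.n t) :
    Cost value ∅ (⋃ t, ({mean (D := D) t} ∪ {var t})) (369 * ∑ t, D.n t ^ 3) := by
  rw [Finset.mul_sum]
  exact Cost.iUnion_levels (cubicCost_zero hn) (cubicCost_succ hn)

end Problem

/-- Cokriging predictors and variances are computed by a straight-line program of cubic length. -/
theorem exists_program (hn : ∀ t, D.q t + 2 < D.n t) :
    ∃ (P : List (Instr (CokrigingInput D))) (mean var : Fin (s + 1) → ℕ),
      P.length ≤ 369 * ∑ t, D.n t ^ 3 ∧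
      ∀ (M : CokrigingModel D) (x₀ : 𝒳) (y : D.Data), M.Nondegenerate y →
        ∃ m : List ℝ, runFrom (M.inputValue x₀ y) [] P = some m ∧
          ∀ t, m[mean t]? = some (M.predictor x₀ y t) ∧
            m[var t]? = some (M.predVariance x₀ y t) := by
  -- Starting from empty memory. The environment ranges over all nondegenerate problems of the
  -- design, so `P` and the addresses are chosen before the model, the data and `x₀`.
  obtain ⟨P, l, hP, hrun, hl⟩ := Problem.cost_mean_var hn [] (by simp)
  simp only [List.nil_append] at hrun hl
  choose mean hmean using fun t => Cost.exists_getElem?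
    (hl (Problem.mean t) (Set.mem_iUnion.2 ⟨t, .inl rfl⟩))
  choose var hvar using fun t => Cost.exists_getElem?
    (hl (Problem.var t) (Set.mem_iUnion.2 ⟨t, .inr rfl⟩))
  refine ⟨P, mean, var, hP, fun M x₀ y hy => ?_⟩
  exact ⟨_, hrun ⟨(M, x₀, y), hy⟩, fun t =>
    ⟨hmean t ⟨(M, x₀, y), hy⟩, hvar t ⟨(M, x₀, y), hy⟩⟩⟩

end CokrigingDesign

theorem mainTheorem1 :
    (∀ {𝒳 : Type*} {s : ℕ} (D : CokrigingDesign 𝒳 s) (M : CokrigingModel D) (x₀ : 𝒳) (y : D.Data),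
      (∀ t, D.q t + 2 < D.n t) → M.Nondegenerate y →
        IsProbabilityMeasure (M.predictive x₀ y) ∧
        (∀ t, MemLp (fun u : Fin (s + 1) → ℝ => u t) 2 (M.predictive x₀ y)) ∧
        M.predictor x₀ y 0 = krigMean (M.R 0) (M.H 0) (y 0) (M.rvec x₀ 0) (M.h 0 x₀) ∧
        M.predVariance x₀ y 0 =
          ((D.n 0 : ℝ) - D.q 0) / ((D.n 0 : ℝ) - D.q 0 - 2) * glsVar (M.R 0) (M.H 0) (y 0) *
            (M.r 0 x₀ x₀ - krigReduction (M.R 0) (M.rvec x₀ 0) +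
              glsTerm (M.R 0) (M.H 0) (M.rvec x₀ 0) (M.h 0 x₀)) ∧
        ∀ t : Fin s,
          M.predictor x₀ y t.succ =
            krigMean (M.R t.succ) (M.X y t) (y t.succ) (M.rvec x₀ t.succ)
              (M.f x₀ t (M.predictor x₀ y t.castSucc)) ∧
          M.predVariance x₀ y t.succ =
            M.gammaHat y t ^ 2 * M.predVariance x₀ y t.castSucc +
            ((D.n t.succ : ℝ) - D.q t.succ) / ((D.n t.succ : ℝ) - D.q t.succ - 2) *
              glsVar (M.R t.succ) (M.X y t) (y t.succ) *
              (M.r t.succ x₀ x₀ - krigReduction (M.R t.succ) (M.rvec x₀ t.succ) +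
                M.kappa x₀ y t (M.predictor x₀ y t.castSucc) (M.predVariance x₀ y t.castSucc))) ∧
    (∃ C : ℕ, ∀ {𝒳 : Type*} {s : ℕ} (D : CokrigingDesign 𝒳 s), (∀ t, D.q t + 2 < D.n t) →
      ∃ (P : List (Instr (CokrigingInput D))) (mean var : Fin (s + 1) → ℕ),
        P.length ≤ C * ∑ t, D.n t ^ 3 ∧
        ∀ (M : CokrigingModel D) (x₀ : 𝒳) (y : D.Data), M.Nondegenerate y →
          ∃ m : List ℝ, runFrom (M.inputValue x₀ y) [] P = some m ∧
            ∀ t, m[mean t]? = some (M.predictor x₀ y t) ∧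
              m[var t]? = some (M.predVariance x₀ y t)) := by
  refine ⟨fun D M x₀ y hn hy => M.predictive_moments y hy hn x₀, 369, fun D hn => ?_⟩
  exact D.exists_program hn
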